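/- **Setting.** Let $\mathcal X\subset\mathbb R^d$ be bounded and measurable, and let $k:\mathcal X\times\mathcal X\to\mathbb R$ be a measurable positive semidefinite kernel with $|k(x,y)|\le L$ for all $x,y\in\mathcal X$, where $L>0$. Let $H$ be its reproducing kernel Hilbert space. Let $f^\ast\in H$ with $\|f^\ast\|_H\le D$, where $D>0$. In round $t=1,\dots,T$ a learner plays a random action $X_t\in\mathcal X$ and observes $Y_t=f^\ast(X_t)+\epsilon_t$. Conditionally on $\sigma(Y_{1:t-1},X_{1:t})$ the noise $\epsilon_t$ is $\sigma$-subGaussian ($\sigma\ge 0$): $\mathbb E[e^{\lambda\epsilon_t}\mid Y_{1:t-1},X_{1:t}]\le e^{\lambda^2\sigma^2/2}$ for all $\lambda\in\mathbb R$. The regret is $R_T=\sum_{t=1}^T\big(\sup_{x\in\mathcal X}f^\ast(x)-f^\ast(X_t)\big)$. For $t\ge1$ and $\rho>0$, the maximum information gain is $$\gamma_t(\rho)=\sup_{x_1,\dots,x_t\in\mathcal X}\tfrac12\log\det\big(I_t+\rho^{-1}(k(x_i,x_j))_{i,j\le t}\big).$$ *GP-UCB* with regularization $\rho$ and confidence level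 $\delta\in(0,1)$: let $V_t=\sum_{s\le t}k(\cdot,X_s)k(\cdot,X_s)^\top$, $K_t=(k(X_i,X_j))_{i,j\le t}$, $f_t=(\rho\,\mathrm{id}_H+V_t)^{-1}\sum_{s\le t}Y_s\,k(\cdot,X_s)$, and $$U_t=\sigma\sqrt{2\log\Big(\tfrac1\delta\sqrt{\det(I_t+\rho^{-1}K_t)}\Big)}+\rho^{1/2}D .$$ Put $E_0=\{f\in H:\|f\|_H\le D\}$ and $E_t=\{f\in H:\|(\rho\,\mathrm{id}_H+V_t)^{1/2}(f_t-f)\|_H\le U_t\}$ for $t\ge1$. In round $t$ the algorithm plays the first component of a maximizer $(X_t,\tilde f_t)$ of $(x,f)\mapsto f(x)$ over $\mathcal X\times E_{t-1}$ (almost surely, such a maximizer existing). Let $T_kf(x)=\int_{\mathcal X}k(x,y)f(y)\,dy$ on $L^2(\mathcal X)$ (Lebesgue measure). Let $\mu_1\ge\mu_2\ge\cdots\ge0$ be its eigenvalues with multiplicity (followed by zeros if only finitely many are nonzero), and let $\phi_n$, for $\mu_n\ne0$, be corresponding $L^2$-orthonormal eigenfunctions, with $T_k\phi_n(x)=\mu_n\phi_n(x)$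 for every $x\in\mathcal X$. The kernel has *$(C,\beta)$-polynomial eigendecay* if $\mu_n\le Cn^{-\beta}$ for all $n\ge1$. **Theorem.** Let $\delta\in(0,1)$, $D>0$, $\sigma\ge0$. 1. There is a constant $K$, depending only on $\sigma,D,\delta$, such that for all $\mathcal X,k,L$ as above, all $T\ge1$ and all $\rho\ge\max(1,L)$, with probability at least $1-\delta$ GP-UCB satisfies $$R_T\le K\Big(\gamma_T(\rho)\sqrt T+\sqrt{\rho\,\gamma_T(\rho)\,T}\Big).$$ 2. Let $L,B,C,\beta,c_1,c_2>0$. There are constants $A,p$, depending only on these and on $\sigma,D,\delta$, with the following property. Suppose that, in addition to the setting, a function in $H$ that vanishes almost everywhere on $\mathcal X$ vanishes everywhere (for instance $k$ is continuous and every nonempty relatively open subset of $\mathcal X$ has positive Lebesgue measure), that $|\phi_n(x)|\le B$ for all $x\in\mathcal X$ and all $n$ with $\mu_n\ne0$, and that $k$ has $(C,\beta)$-polynomial eigendecay. If $T\ge1$, $\rho\ge\max(1,L)$ and $c_1T^{1/(1+\beta)}\le\rho\le c_2T^{1/(1+\beta)}$, then with probability at least $1-\delta$ $$R_T\le A\,T^{\frac{3+\beta}{2+2\beta}}(1+\log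 T)^p .$$ For every $\beta>1$ this bound is sublinear: divided by $T$ it tends to $0$ as $T\to\infty$. 3. (Matérn kernels.) Let $d\ge1$, $\nu>1/2$, $\ell>0$, and let $k$ be the Matérn kernel on $\mathcal X\subset\mathbb R^d$, $$k(x,y)=\frac{1}{\Gamma(\nu)2^{\nu-1}}\Big(\frac{\sqrt{2\nu}\|x-y\|_2}{\ell}\Big)^{\nu}B_\nu\Big(\frac{\sqrt{2\nu}\|x-y\|_2}{\ell}\Big)\quad(x\ne y),\qquad k(x,x)=1,$$ with $B_\nu$ the modified Bessel function of the second kind. Let $L,B,c_1,c_2>0$. There are constants $A,p$, depending only on $d,\mathcal X,\nu,\ell,L,B,c_1,c_2,\sigma,D,\delta$, such that the following holds. Suppose that functions in $H$ vanishing almost everywhere vanish everywhere and that $|\phi_n(x)|\le B$ for all $x\in\mathcal X$ and all $n$ with $\mu_n\ne0$. If $T\ge1$, $\rho\ge\max(1,L)$ and $c_1T^{d/(2\nu+2d)}\le\rho\le c_2T^{d/(2\nu+2d)}$, then with probability at least $1-\delta$ $$R_T\le A\,T^{\frac{\nu+2d}{2\nu+2d}}(1+\log T)^p ,$$ and this bound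 divided by $T$ tends to $0$ as $T\to\infty$. -/

import Mathlib

open MeasureTheory Filter Topology

universe u v

-- a subset of `ℝ^d` carries the restricted Lebesgue measure
attribute [local instance] Measure.Subtype.measureSpace

noncomputable section

namespace GPUCB

/-! ### Reproducing kernel, Gram matrices, maximum information gain -/

section Kernel

variable {S : Type*}

/-- The function `k(·, x)`, as an element of the reproducing kernel Hilbert space `H` of real
functions on `S`. -/
def kerAt (H : Type*) [NormedAddCommGroup H] [InnerProductSpace ℝ H] [CompleteSpace H]
    [RKHS ℝ H S ℝ] (x : S) : H :=
  RKHS.kerFun H x (1 : ℝ)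

/-- The scalar reproducing kernel `k(x, y)` of `H`. -/
def rkhsKer (H : Type*) [NormedAddCommGroup H] [InnerProductSpace ℝ H] [CompleteSpace H]
    [RKHS ℝ H S ℝ] (x y : S) : ℝ :=
  RKHS.kernel H x y (1 : ℝ)

/-- `det (I_t + ρ⁻¹ K_t)`, with `K_t` the Gram matrix of the points `x_1, …, x_t`. -/
def regDet (k : S → S → ℝ) (ρ : ℝ) {t : ℕ} (x : Fin t → S) : ℝ :=
  (1 + ρ⁻¹ • Matrix.of (fun i j : Fin t => k (x i) (x j))).det

/-- Maximum information gain
`γ_t(ρ) = sup_{x_1, …, x_t} (1/2) log det (I_t + ρ⁻¹ K_t)`. -/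
def infoGain (k : S → S → ℝ) (t : ℕ) (ρ : ℝ) : ℝ :=
  ⨆ x : Fin t → S, (1 / 2) * Real.log (regDet k ρ x)

end Kernel

/-! ### The integral operator of the kernel and its eigendecay -/

section Spectrum

variable {S : Type*} [MeasureSpace S]

/-- `(T_k f)(x) = ∫ k(x, y) f(y) dy`. -/
def kerOp (k : S → S → ℝ) (f : S → ℝ) (x : S) : ℝ :=
  ∫ y, k x y * f y

/-- `μ` is the non-increasing sequence of eigenvalues of `T_k` on `L²(S)`, repeated according to
multiplicity and continued by zeros when there are only finitely many nonzero ones, and the `φ n`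
with `μ n ≠ 0` are corresponding `L²`-orthonormal eigenfunctions. The last field says that no
nonzero eigenvalue is left out: a function orthogonal to all these eigenfunctions lies in the
kernel of `T_k`. Nothing is asked of `φ n` when `μ n = 0`. The sequences are indexed from `0`. -/
structure IsEigensystem (k : S → S → ℝ) (μ : ℕ → ℝ) (φ : ℕ → S → ℝ) : Prop where
  antitone : Antitone μ
  nonneg : ∀ n, 0 ≤ μ n
  memLp : ∀ n, μ n ≠ 0 → MemLp (φ n) 2 volume
  orthonormal : ∀ m n, μ m ≠ 0 → μ n ≠ 0 → ∫ x, φ m x * φ n x = if m = n then 1 else 0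
  eigen : ∀ n, μ n ≠ 0 → ∀ x, kerOp k (φ n) x = μ n * φ n x
  complete : ∀ g : S → ℝ, MemLp g 2 volume → (∀ n, μ n ≠ 0 → ∫ x, φ n x * g x = 0) →
    kerOp k g =ᵐ[volume] 0

/-- `(C, β)`-polynomial eigendecay: the `n`-th eigenvalue (counted from `1`) is at most
`C n^(-β)`. -/
def PolyEigendecay (μ : ℕ → ℝ) (C β : ℝ) : Prop :=
  ∀ n : ℕ, μ n ≤ C * ((n : ℝ) + 1) ^ (-β)

/-- The eigenfunctions are bounded by `B` everywhere on the domain. -/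
def EigenfunctionsBounded (μ : ℕ → ℝ) (φ : ℕ → S → ℝ) (B : ℝ) : Prop :=
  ∀ n, μ n ≠ 0 → ∀ x, |φ n x| ≤ B

/-- A function in `H` that vanishes almost everywhere vanishes everywhere. -/
def AEDetermined (H : Type*) [NormedAddCommGroup H] [InnerProductSpace ℝ H] [CompleteSpace H]
    [RKHS ℝ H S ℝ] : Prop :=
  ∀ f : H, (⇑f : S → ℝ) =ᵐ[volume] 0 → f = 0

end Spectrum

/-! ### The algorithm

Rounds are numbered from `0`: `X t` is the action of the round that is preceded by exactly `t`
observations. -/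

section Algorithm

variable {S : Type*} {H : Type*} [NormedAddCommGroup H] [InnerProductSpace ℝ H] [CompleteSpace H]
  [RKHS ℝ H S ℝ]

/-- `V_t = ∑ k(·, x_s) k(·, x_s)ᵀ`, over the first `t` actions. -/
def covOp (H : Type*) [NormedAddCommGroup H] [InnerProductSpace ℝ H] [CompleteSpace H]
    [RKHS ℝ H S ℝ] (x : ℕ → S) (t : ℕ) : H →L[ℝ] H :=
  ∑ s ∈ Finset.range t, InnerProductSpace.rankOne ℝ (kerAt H (x s)) (kerAt H (x s))

/-- `ρ id_H + V_t`. -/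
def regCovOp (H : Type*) [NormedAddCommGroup H] [InnerProductSpace ℝ H] [CompleteSpace H]
    [RKHS ℝ H S ℝ] (ρ : ℝ) (x : ℕ → S) (t : ℕ) : H →L[ℝ] H :=
  ρ • ContinuousLinearMap.id ℝ H + covOp H x t

/-- Kernel ridge regression `f_t = (ρ id_H + V_t)⁻¹ ∑ y_s k(·, x_s)` from the first `t` rounds. -/
def ridge (H : Type*) [NormedAddCommGroup H] [InnerProductSpace ℝ H] [CompleteSpace H]
    [RKHS ℝ H S ℝ] (ρ : ℝ) (x : ℕ → S) (y : ℕ → ℝ) (t : ℕ) : H :=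
  Ring.inverse (regCovOp H ρ x t) (∑ s ∈ Finset.range t, y s • kerAt H (x s))

/-- `U_t = σ √(2 log (δ⁻¹ √(det (I_t + ρ⁻¹ K_t)))) + √ρ D`. -/
def confRadius (k : S → S → ℝ) (σ D δ ρ : ℝ) (x : ℕ → S) (t : ℕ) : ℝ :=
  σ * √(2 * Real.log (δ⁻¹ * √(regDet k ρ (fun i : Fin t => x i)))) + √ρ * D

/-- The confidence set after `t` rounds: the `D`-ball at the start, and
`{f : ‖(ρ id_H + V_t)^{1/2} (f_t - f)‖ ≤ U_t}` afterwards, where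
`‖A^{1/2} h‖ = √⟪A h, h⟫`. -/
def confSet (H : Type*) [NormedAddCommGroup H] [InnerProductSpace ℝ H] [CompleteSpace H]
    [RKHS ℝ H S ℝ] (σ D δ ρ : ℝ) (x : ℕ → S) (y : ℕ → ℝ) (t : ℕ) : Set H :=
  if t = 0 then {f | ‖f‖ ≤ D}
  else {f | √(inner ℝ (regCovOp H ρ x t (ridge H ρ x y t - f)) (ridge H ρ x y t - f))
    ≤ confRadius (rkhsKer H) σ D δ ρ x t}

/-- The action `x` is the first component of a maximizer of `(x, f) ↦ f(x) = ⟪f, k(·, x)⟫` over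
`S × E`. -/
def IsOptimistic (E : Set H) (x : S) : Prop :=
  ∃ g ∈ E, ∀ f ∈ E, ∀ x' : S, f x' ≤ g x

end Algorithm

/-! ### The stochastic bandit problem -/

section Bandit

variable {S : Type*} [MeasurableSpace S] {H : Type*} [NormedAddCommGroup H]
  [InnerProductSpace ℝ H] [CompleteSpace H] [RKHS ℝ H S ℝ] {Ω : Type*} [MeasurableSpace Ω]

/-- `ε` is `σ`-subGaussian conditionally on `m`: `log E[exp(l ε) | m] ≤ l² σ² / 2` for all real
`l`. -/
def CondSubGaussian (P : Measure Ω) (m : MeasurableSpace Ω) (ε : Ω → ℝ) (σ : ℝ) : Prop :=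
  ∀ l : ℝ, Integrable (fun ω => Real.exp (l * ε ω)) P ∧
    P[fun ω => Real.exp (l * ε ω) | m] ≤ᵐ[P] fun _ => Real.exp (l ^ 2 * σ ^ 2 / 2)

/-- The observation `f⋆(X_t) + ε_t`. -/
def reward (f : H) (X : ℕ → Ω → S) (ε : ℕ → Ω → ℝ) (t : ℕ) (ω : Ω) : ℝ :=
  f (X t ω) + ε t ω

/-- The `σ`-algebra generated by the past observations and by the actions up to and including the
current one. -/
abbrev history (f : H) (X : ℕ → Ω → S) (ε : ℕ → Ω → ℝ) (t : ℕ) : MeasurableSpace Ω :=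
  (⨆ s ∈ Finset.range t, MeasurableSpace.comap (reward f X ε s) inferInstance) ⊔
    ⨆ s ∈ Finset.range (t + 1), MeasurableSpace.comap (X s) inferInstance

/-- The target `f` has norm at most `D` and in each of the `T` rounds the noise is conditionally
`σ`-subGaussian. -/
structure IsBandit (P : Measure Ω) (T : ℕ) (σ D : ℝ) (f : H) (X : ℕ → Ω → S)
    (ε : ℕ → Ω → ℝ) : Prop where
  norm_le : ‖f‖ ≤ D
  measurable_action : ∀ t < T, Measurable (X t)
  measurable_noise : ∀ t < T, Measurable (ε t)
  subGaussian : ∀ t < T, CondSubGaussian P (history f X ε t) (ε t) σ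

/-- The `T` actions are almost surely chosen by GP-UCB with regularization `ρ`. -/
def IsGPUCB (P : Measure Ω) (T : ℕ) (σ D δ ρ : ℝ) (f : H) (X : ℕ → Ω → S)
    (ε : ℕ → Ω → ℝ) : Prop :=
  ∀ t < T, ∀ᵐ ω ∂P,
    IsOptimistic (confSet H σ D δ ρ (fun s => X s ω) (fun s => reward f X ε s ω) t) (X t ω)

/-- `R_T = ∑ (max f - f(X_t))`, with the supremum in place of the maximum. -/
def regret (f : H) (X : ℕ → Ω → S) (T : ℕ) (ω : Ω) : ℝ :=
  ∑ t ∈ Finset.range T, ((⨆ x : S, f x) - f (X t ω))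

end Bandit

/-! ### Matérn kernels -/

/-- Modified Bessel function of the second kind, `K_ν(z) = ∫_0^∞ exp(-z cosh t) cosh(ν t) dt` for
`z > 0`. -/
def besselK (ν z : ℝ) : ℝ :=
  ∫ t in Set.Ioi (0 : ℝ), Real.exp (-z * Real.cosh t) * Real.cosh (ν * t)

/-- Matérn covariance at distance `r`, with smoothness `ν` and bandwidth `l`, extended by its limit
`1` to `r = 0`. -/
def maternFun (ν l r : ℝ) : ℝ :=
  if r = 0 then 1
  else 1 / (Real.Gamma ν * 2 ^ (ν - 1)) * (√(2 * ν) * r / l) ^ ν * besselK ν (√(2 * ν) * r / l)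

/-- The Matérn kernel on a subset of `ℝ^d`. -/
def matern {d : ℕ} {𝒳 : Set (EuclideanSpace ℝ (Fin d))} (ν l : ℝ) (x y : 𝒳) : ℝ :=
  maternFun ν l ‖(x : EuclideanSpace ℝ (Fin d)) - y‖

end GPUCB

end

noncomputable section

namespace GPUCB

/-! ### Determinants of perturbations of the identity -/

section Determinant

open Matrix

lemma posSemidef_vecMulVec_self {n : Type*} [Fintype n] (a : n → ℝ) :
    (vecMulVec a a).PosSemidef := by
  simpa using posSemidef_vecMulVec_self_star a

lemma posSemidef_sum_vecMulVec {n ι : Type*} [Fintype n] (s : Finset ι) (v : ι → n → ℝ) :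
    (∑ j ∈ s, vecMulVec (v j) (v j)).PosSemidef := by
  classical
  induction s using Finset.induction_on with
  | empty => simpa using PosSemidef.zero
  | insert a s ha ih =>
    rw [Finset.sum_insert ha]
    exact (posSemidef_vecMulVec_self _).add ih

/-- A rank-one perturbation of a matrix `1 + B` with `B` positive semidefinite. -/
lemma det_one_add_add_vecMulVec_le {n : Type*} [Fintype n] [DecidableEq n] {B : Matrix n n ℝ}
    (hB : B.PosSemidef) (a : n → ℝ) :
    (1 + B + vecMulVec a a).det ≤ (1 + B).det * (1 + a ⬝ᵥ a) := by
  have hA : (1 + B).PosDef := PosDef.one.add_posSemidef hB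
  have hu : IsUnit (1 + B).det := (isUnit_iff_isUnit_det _).1 hA.isUnit
  rw [vecMulVec_eq Unit, det_add_replicateCol_mul_replicateRow hu]
  refine mul_le_mul_of_nonneg_left ?_ hA.det_pos.le
  set z := (1 + B)⁻¹ *ᵥ a with hz
  have hza : (1 + B) *ᵥ z = a := by
    rw [hz, mulVec_mulVec, mul_nonsing_inv _ hu, one_mulVec]
  have hdet : (1 + replicateRow Unit a * (1 + B)⁻¹ * replicateCol Unit a).det = 1 + a ⬝ᵥ z := by
    rw [Matrix.mul_assoc, ← replicateCol_mulVec, det_unique]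
    simp [Matrix.mul_apply, dotProduct, hz]
  rw [hdet]
  have h1 : z ⬝ᵥ a = z ⬝ᵥ z + z ⬝ᵥ B *ᵥ z := by
    conv_lhs => rw [← hza]
    rw [add_mulVec, one_mulVec, dotProduct_add]
  have h2 : 0 ≤ z ⬝ᵥ B *ᵥ z := by simpa using hB.dotProduct_mulVec_nonneg z
  have h3 : 0 ≤ (a - z) ⬝ᵥ (a - z) := by simpa using dotProduct_star_self_nonneg (a - z)
  rw [sub_dotProduct, dotProduct_sub, dotProduct_sub] at h3
  have h4 := dotProduct_comm a z
  linarith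

lemma det_one_add_sum_vecMulVec_le {n ι : Type*} [Fintype n] [DecidableEq n]
    (s : Finset ι) (v : ι → n → ℝ) :
    (1 + ∑ j ∈ s, vecMulVec (v j) (v j)).det ≤ ∏ j ∈ s, (1 + v j ⬝ᵥ v j) := by
  classical
  induction s using Finset.induction_on with
  | empty => simp
  | insert a s ha ih =>
    rw [Finset.sum_insert ha, Finset.prod_insert ha, add_comm (vecMulVec _ _), ← add_assoc,
      mul_comm]
    refine (det_one_add_add_vecMulVec_le (posSemidef_sum_vecMulVec s v) (v a)).trans ?_
    refine mul_le_mul_of_nonneg_right ih ?_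
    have : 0 ≤ v a ⬝ᵥ v a := by simpa using dotProduct_star_self_nonneg (v a)
    linarith

variable {E : Type*} [NormedAddCommGroup E] [InnerProductSpace ℝ E]

lemma sum_inner_sq_eq_norm_sq {W : Submodule ℝ E} [FiniteDimensional ℝ W] {x y : E} (hx : x ∈ W)
    (hy : y ∈ W) :
    inner ℝ x y = ∑ j, inner ℝ ((stdOrthonormalBasis ℝ W j : W) : E) x *
      inner ℝ ((stdOrthonormalBasis ℝ W j : W) : E) y := by
  have h := (stdOrthonormalBasis ℝ W).sum_inner_mul_inner ⟨x, hx⟩ ⟨y, hy⟩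
  simp only [Submodule.coe_inner] at h
  rw [← h]
  exact Finset.sum_congr rfl fun j _ => by rw [real_inner_comm]

/-- If the vectors `ψ i` are within squared distance `η` of a subspace of dimension `N`, then the
regularized determinant of their Gram matrix is that of a matrix of rank `N`, up to a factor
`exp (t η / ρ)`. -/
theorem det_one_add_gram_le {t N : ℕ} (ψ : Fin t → E) (W : Submodule ℝ E) [FiniteDimensional ℝ W]
    (hN : Module.finrank ℝ W ≤ N) {ρ L η : ℝ} (hρ : 0 < ρ) (hL : 0 ≤ L)
    (hψ : ∀ i, ‖ψ i‖ ^ 2 ≤ L) (hW : ∀ i, ∃ w ∈ W, ‖ψ i - w‖ ^ 2 ≤ η) :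
    (1 + ρ⁻¹ • Matrix.of (fun i j => inner ℝ (ψ i) (ψ j))).det ≤
      (1 + t * L / ρ) ^ N * Real.exp (t * η / ρ) := by
  set p : Fin t → E := fun i => W.starProjection (ψ i) with hp
  set r : Fin t → E := fun i => ψ i - p i with hr
  have hpW : ∀ i, p i ∈ W := fun i => W.starProjection_apply_mem (ψ i)
  have hrW : ∀ i, r i ∈ Wᗮ := fun i => W.sub_starProjection_mem_orthogonal (ψ i)
  set G : Submodule ℝ E := Submodule.span ℝ (Set.range r) with hG
  have hrG : ∀ i, r i ∈ G := fun i => Submodule.subset_span ⟨i, rfl⟩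
  have : FiniteDimensional ℝ G := FiniteDimensional.span_of_finite ℝ (Set.finite_range r)
  have hψpr : ∀ i, ψ i = p i + r i := fun i => by simp [hr]
  have hpr : ∀ i j, inner ℝ (p i) (r j) = 0 := fun i j =>
    Submodule.inner_right_of_mem_orthogonal (hpW i) (hrW j)
  have hinner : ∀ i j, inner ℝ (ψ i) (ψ j) = inner ℝ (p i) (p j) + inner ℝ (r i) (r j) := by
    intro i j
    rw [hψpr i, hψpr j, inner_add_left, inner_add_right, inner_add_right, hpr,
      real_inner_comm (p j) (r i), hpr]
    ring
  have hnorm : ∀ i, ‖ψ i‖ ^ 2 = ‖p i‖ ^ 2 + ‖r i‖ ^ 2 := fun i => by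
    simpa only [real_inner_self_eq_norm_sq] using hinner i i
  have hpL : ∀ i, ‖p i‖ ^ 2 ≤ L := fun i => by nlinarith [hψ i, hnorm i, sq_nonneg ‖r i‖]
  have hrη : ∀ i, ‖r i‖ ^ 2 ≤ η := by
    intro i
    obtain ⟨w, hw, hle⟩ := hW i
    refine le_trans ?_ hle
    have h1 : ψ i - w = (p i - w) + r i := by simp [hr]
    have h2 : inner ℝ (p i - w) (r i) = 0 :=
      Submodule.inner_right_of_mem_orthogonal (W.sub_mem (hpW i) hw) (hrW i)
    rw [h1, pow_two ‖_ + _‖, norm_add_sq_eq_norm_sq_add_norm_sq_of_inner_eq_zero _ _ h2]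
    nlinarith [mul_self_nonneg ‖p i - w‖]
  obtain ⟨q, hρ'⟩ : ∃ q : ℝ, q * q = ρ⁻¹ := ⟨_, Real.mul_self_sqrt (inv_nonneg.2 hρ.le)⟩
  set e : Fin (Module.finrank ℝ W) ⊕ Fin (Module.finrank ℝ G) → Fin t → ℝ :=
    Sum.elim (fun j i => q * inner ℝ ((stdOrthonormalBasis ℝ W j : W) : E) (p i))
      (fun j i => q * inner ℝ ((stdOrthonormalBasis ℝ G j : G) : E) (r i)) with he
  have hmat : ρ⁻¹ • Matrix.of (fun i j => inner ℝ (ψ i) (ψ j)) =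
      ∑ j, vecMulVec (e j) (e j) := by
    ext i k
    simp only [Matrix.smul_apply, of_apply, Matrix.sum_apply, vecMulVec_apply, Fintype.sum_sum_type,
      he,
      Sum.elim_inl, Sum.elim_inr, smul_eq_mul]
    rw [hinner, sum_inner_sq_eq_norm_sq (hpW i) (hpW k), sum_inner_sq_eq_norm_sq (hrG i) (hrG k),
      mul_add, Finset.mul_sum, Finset.mul_sum, ← hρ']
    congr 1 <;> exact Finset.sum_congr rfl fun j _ => by ring
  have hdot : ∀ j, e j ⬝ᵥ e j = ∑ i, e j i ^ 2 := fun j => by simp [dotProduct, pow_two]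
  have hleft : ∀ j, e (Sum.inl j) ⬝ᵥ e (Sum.inl j) ≤ t * L / ρ := by
    intro j
    rw [hdot]
    calc ∑ i, e (Sum.inl j) i ^ 2 ≤ ∑ _i : Fin t, L / ρ := by
          refine Finset.sum_le_sum fun i _ => ?_
          simp only [he, Sum.elim_inl, mul_pow, pow_two q, hρ']
          rw [div_eq_inv_mul]
          refine mul_le_mul_of_nonneg_left ?_ (inv_nonneg.2 hρ.le)
          refine le_trans ?_ (hpL i)
          have h := abs_real_inner_le_norm ((stdOrthonormalBasis ℝ W j : W) : E) (p i)
          have h1 : ‖((stdOrthonormalBasis ℝ W j : W) : E)‖ = 1 := by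
            rw [← (stdOrthonormalBasis ℝ W).orthonormal.1 j]; rfl
          rw [h1, one_mul] at h
          exact sq_le_sq' (neg_le_of_abs_le h) (le_of_abs_le h)
      _ = t * L / ρ := by simp; ring
  have hright : ∑ j, e (Sum.inr j) ⬝ᵥ e (Sum.inr j) ≤ t * η / ρ := by
    simp only [hdot]
    rw [Finset.sum_comm]
    calc ∑ i, ∑ j, e (Sum.inr j) i ^ 2 = ∑ i, ρ⁻¹ * ‖r i‖ ^ 2 := by
          refine Finset.sum_congr rfl fun i _ => ?_
          rw [← real_inner_self_eq_norm_sq, sum_inner_sq_eq_norm_sq (hrG i) (hrG i),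
            Finset.mul_sum, ← hρ']
          exact Finset.sum_congr rfl fun j _ => by simp only [he, Sum.elim_inr]; ring
      _ ≤ ∑ _i : Fin t, ρ⁻¹ * η := Finset.sum_le_sum fun i _ =>
          mul_le_mul_of_nonneg_left (hrη i) (inv_nonneg.2 hρ.le)
      _ = t * η / ρ := by simp; ring
  have hx : 0 ≤ t * L / ρ := by positivity
  have hpos : ∀ j, 0 ≤ e j ⬝ᵥ e j := fun j => by
    rw [hdot]; exact Finset.sum_nonneg fun i _ => sq_nonneg _
  rw [hmat]
  refine (det_one_add_sum_vecMulVec_le Finset.univ e).trans ?_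
  rw [Fintype.prod_sum_type]
  refine mul_le_mul ?_ ?_ (Finset.prod_nonneg fun j _ => by linarith [hpos (Sum.inr j)])
    (by positivity)
  · calc ∏ j, (1 + e (Sum.inl j) ⬝ᵥ e (Sum.inl j))
        ≤ ∏ _j : Fin (Module.finrank ℝ W), (1 + t * L / ρ) :=
          Finset.prod_le_prod (fun j _ => by linarith [hpos (Sum.inl j)])
            fun j _ => by linarith [hleft j]
      _ = (1 + t * L / ρ) ^ Module.finrank ℝ W := by simp
      _ ≤ (1 + t * L / ρ) ^ N := pow_le_pow_right₀ (by linarith) hN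
  · calc ∏ j, (1 + e (Sum.inr j) ⬝ᵥ e (Sum.inr j))
        ≤ ∏ j, Real.exp (e (Sum.inr j) ⬝ᵥ e (Sum.inr j)) :=
          Finset.prod_le_prod (fun j _ => by linarith [hpos (Sum.inr j)])
            fun j _ => by linarith [Real.add_one_le_exp (e (Sum.inr j) ⬝ᵥ e (Sum.inr j))]
      _ = Real.exp (∑ j, e (Sum.inr j) ⬝ᵥ e (Sum.inr j)) := (Real.exp_sum _ _).symm
      _ ≤ Real.exp (t * η / ρ) := Real.exp_le_exp.2 hright

end Determinant

/-! ### The inverse of the regularized covariance operator -/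

section Resolvent

variable {H : Type*} [NormedAddCommGroup H] [InnerProductSpace ℝ H]

/-- `ρ id + ∑_{s < t} a_s a_sᵀ`. -/
def regSum (ρ : ℝ) (a : ℕ → H) (t : ℕ) : H →L[ℝ] H :=
  ρ • ContinuousLinearMap.id ℝ H + ∑ s ∈ Finset.range t, InnerProductSpace.rankOne ℝ (a s) (a s)

/-- The inverse of `ρ id + ∑_{s < t} a_s a_sᵀ`, computed by the Sherman–Morrison recursion. -/
def regInv (ρ : ℝ) (a : ℕ → H) : ℕ → H →L[ℝ] H
  | 0 => ρ⁻¹ • ContinuousLinearMap.id ℝ H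
  | t + 1 => regInv ρ a t - (1 + inner ℝ (a t) (regInv ρ a t (a t)))⁻¹ •
      InnerProductSpace.rankOne ℝ (regInv ρ a t (a t)) (regInv ρ a t (a t))

/-- The squared width `⟪a_t, (ρ id + ∑_{s < t} a_s a_sᵀ)⁻¹ a_t⟫`. -/
def sqWidth (ρ : ℝ) (a : ℕ → H) (t : ℕ) : ℝ := inner ℝ (a t) (regInv ρ a t (a t))

variable {ρ : ℝ} {a : ℕ → H} {t : ℕ}

lemma regSum_apply (h : H) :
    regSum ρ a t h = ρ • h + ∑ s ∈ Finset.range t, inner ℝ (a s) h • a s := by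
  simp [regSum]

lemma regSum_succ_apply (h : H) :
    regSum ρ a (t + 1) h = regSum ρ a t h + inner ℝ (a t) h • a t := by
  rw [regSum_apply, regSum_apply, Finset.sum_range_succ, add_assoc]

lemma regInv_succ_apply (h : H) :
    regInv ρ a (t + 1) h = regInv ρ a t h -
      ((1 + sqWidth ρ a t)⁻¹ * inner ℝ (regInv ρ a t (a t)) h) • regInv ρ a t (a t) := by
  simp [regInv, sqWidth, smul_smul]

lemma regSum_symm (u v : H) : inner ℝ (regSum ρ a t u) v = inner ℝ u (regSum ρ a t v) := by
  simp only [regSum_apply, inner_add_left, inner_add_right, sum_inner, inner_sum, inner_smul_left,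
    inner_smul_right]
  congr 1
  refine Finset.sum_congr rfl fun s _ => ?_
  simp [real_inner_comm, mul_comm]

lemma regInv_symm (u v : H) : inner ℝ (regInv ρ a t u) v = inner ℝ u (regInv ρ a t v) := by
  induction t generalizing u v with
  | zero => simp [regInv, inner_smul_left, inner_smul_right]
  | succ t ih =>
    rw [regInv_succ_apply, regInv_succ_apply, inner_sub_left, inner_sub_right, ih,
      inner_smul_left, inner_smul_right, real_inner_comm (regInv ρ a t (a t)) u]
    simp only [conj_trivial]
    ring

lemma le_inner_regSum (h : H) : ρ * ‖h‖ ^ 2 ≤ inner ℝ (regSum ρ a t h) h := by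
  rw [regSum_apply, inner_add_left, inner_smul_left, real_inner_self_eq_norm_sq, sum_inner]
  simp only [conj_trivial, inner_smul_left]
  exact le_add_of_nonneg_right (Finset.sum_nonneg fun s _ => mul_self_nonneg _)

lemma inner_regSum_nonneg (hρ : 0 < ρ) (h : H) : 0 ≤ inner ℝ (regSum ρ a t h) h :=
  le_trans (by positivity) (le_inner_regSum h)

lemma inner_regInv_nonneg_of_regSum (hρ : 0 < ρ)
    (hR : ∀ h, regSum ρ a t (regInv ρ a t h) = h) (h : H) : 0 ≤ inner ℝ h (regInv ρ a t h) := by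
  have := inner_regSum_nonneg (t := t) (a := a) hρ (regInv ρ a t h)
  rwa [hR] at this

lemma regSum_regInv (hρ : 0 < ρ) (h : H) : regSum ρ a t (regInv ρ a t h) = h := by
  induction t generalizing h with
  | zero => simp [regSum_apply, regInv, smul_smul, hρ.ne']
  | succ t ih =>
    have hw : 0 ≤ sqWidth ρ a t := inner_regInv_nonneg_of_regSum hρ ih (a t)
    have hw' : 1 + sqWidth ρ a t ≠ 0 := by positivity
    have h1 : inner ℝ (a t) (regInv ρ a t (a t)) = sqWidth ρ a t := rfl
    rw [regInv_succ_apply, regSum_succ_apply, map_sub, map_smul, ih, ih, inner_sub_right,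
      inner_smul_right, h1, regInv_symm]
    set b := inner ℝ (a t) (regInv ρ a t h)
    have h2 : b - (1 + sqWidth ρ a t)⁻¹ * b * sqWidth ρ a t = (1 + sqWidth ρ a t)⁻¹ * b := by
      field_simp; ring
    rw [h2, sub_add_cancel]

lemma regInv_regSum (hρ : 0 < ρ) (h : H) : regInv ρ a t (regSum ρ a t h) = h := by
  refine ext_inner_right ℝ fun v => ?_
  rw [regInv_symm, regSum_symm, regSum_regInv hρ]

lemma inner_regInv_nonneg (hρ : 0 < ρ) (h : H) : 0 ≤ inner ℝ h (regInv ρ a t h) :=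
  inner_regInv_nonneg_of_regSum hρ (fun _ => regSum_regInv hρ _) h

lemma sqWidth_nonneg (hρ : 0 < ρ) : 0 ≤ sqWidth ρ a t := inner_regInv_nonneg hρ _

lemma inner_regInv_le (hρ : 0 < ρ) (h : H) : inner ℝ h (regInv ρ a t h) ≤ ‖h‖ ^ 2 / ρ := by
  have h1 := le_inner_regSum (ρ := ρ) (a := a) (t := t) (regInv ρ a t h)
  rw [regSum_regInv hρ] at h1
  have h2 := real_inner_le_norm h (regInv ρ a t h)
  rw [le_div_iff₀ hρ]
  nlinarith [sq_nonneg (ρ * ‖regInv ρ a t h‖ - ‖h‖), norm_nonneg h, norm_nonneg (regInv ρ a t h)]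

lemma ringInverse_regSum (hρ : 0 < ρ) : Ring.inverse (regSum ρ a t) = regInv ρ a t := by
  let U : (H →L[ℝ] H)ˣ := ⟨regSum ρ a t, regInv ρ a t,
    ContinuousLinearMap.ext fun h => regSum_regInv hρ h,
    ContinuousLinearMap.ext fun h => regInv_regSum hρ h⟩
  exact Ring.inverse_unit U

/-- Cauchy–Schwarz for the pair of dual norms given by `regSum` and `regInv`. -/
lemma inner_sq_le_regSum_mul_regInv (hρ : 0 < ρ) (u v : H) :
    inner ℝ u v ^ 2 ≤ inner ℝ (regSum ρ a t u) u * inner ℝ v (regInv ρ a t v) := by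
  have key : ∀ c : ℝ, 0 ≤ inner ℝ (regSum ρ a t u) u - 2 * c * inner ℝ u v +
      c ^ 2 * inner ℝ v (regInv ρ a t v) := by
    intro c
    have h := inner_regSum_nonneg (a := a) (t := t) hρ (u - c • regInv ρ a t v)
    rw [map_sub, map_smul, regSum_regInv hρ, inner_sub_left, inner_sub_right, inner_sub_right,
      inner_smul_left, inner_smul_right, inner_smul_left, inner_smul_right,
      regSum_symm u (regInv ρ a t v), regSum_regInv hρ, real_inner_comm u v] at h
    simp only [conj_trivial] at h
    linarith
  have h := discrim_le_zero (a := inner ℝ v (regInv ρ a t v)) (b := -2 * inner ℝ u v)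
    (c := inner ℝ (regSum ρ a t u) u) fun c => by linarith [key c]
  rw [discrim] at h
  linarith

/-- Triangle inequality for `√⟪h, (ρ id + ∑ a_s a_sᵀ)⁻¹ h⟫`. -/
lemma sqrt_inner_regInv_sub_le (hρ : 0 < ρ) (u v : H) :
    √(inner ℝ (u - v) (regInv ρ a t (u - v))) ≤
      √(inner ℝ u (regInv ρ a t u)) + √(inner ℝ v (regInv ρ a t v)) := by
  have hu := inner_regInv_nonneg (a := a) (t := t) hρ u
  have hv := inner_regInv_nonneg (a := a) (t := t) hρ v
  have h1 := inner_sq_le_regSum_mul_regInv (a := a) (t := t) hρ (regInv ρ a t u) v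
  rw [regSum_regInv hρ, regInv_symm] at h1
  have h2 : |inner ℝ u (regInv ρ a t v)| ≤
      √(inner ℝ u (regInv ρ a t u)) * √(inner ℝ v (regInv ρ a t v)) := by
    rw [← Real.sqrt_mul hu]
    exact Real.abs_le_sqrt h1
  refine Real.sqrt_le_iff.2 ⟨by positivity, ?_⟩
  rw [map_sub, inner_sub_left, inner_sub_right, inner_sub_right, ← regInv_symm v u,
    real_inner_comm u]
  nlinarith [Real.sq_sqrt hu, Real.sq_sqrt hv, neg_le_of_abs_le h2]

/-- The change of `‖S‖²` in the dual norm under `S ↦ S + ε a_t`. -/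
lemma inner_regInv_succ (hρ : 0 < ρ) (S : H) (ε : ℝ) :
    inner ℝ (S + ε • a t) (regInv ρ a (t + 1) (S + ε • a t)) =
      inner ℝ S (regInv ρ a t S) + (2 * ε * inner ℝ (a t) (regInv ρ a t S) +
        ε ^ 2 * sqWidth ρ a t - inner ℝ (a t) (regInv ρ a t S) ^ 2) / (1 + sqWidth ρ a t) := by
  have hw := sqWidth_nonneg (a := a) (t := t) hρ
  have hw' : 1 + sqWidth ρ a t ≠ 0 := by positivity
  have h1 : inner ℝ (a t) (regInv ρ a t (a t)) = sqWidth ρ a t := rfl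
  have h2 : inner ℝ S (regInv ρ a t (a t)) = inner ℝ (a t) (regInv ρ a t S) := by
    rw [← regInv_symm, real_inner_comm]
  rw [regInv_succ_apply, inner_sub_right, inner_smul_right, regInv_symm, map_add, map_smul]
  simp only [inner_add_left, inner_add_right, inner_smul_left, inner_smul_right, conj_trivial,
    h1, h2]
  field_simp
  ring

open Matrix in
/-- The regularized determinant of the Gram matrix grows by the factor `1 + sqWidth`. -/
lemma det_one_add_gram_succ (hρ : 0 < ρ) (a : ℕ → H) (t : ℕ) :
    (1 + ρ⁻¹ • Matrix.of (fun i j : Fin (t + 1) => inner ℝ (a i) (a j))).det =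
      (1 + ρ⁻¹ • Matrix.of (fun i j : Fin t => inner ℝ (a i) (a j))).det *
        (1 + sqWidth ρ a t) := by
  set A := 1 + ρ⁻¹ • Matrix.of (fun i j : Fin t => inner ℝ (a i) (a j)) with hA
  set h := regInv ρ a t (a t) with hh
  set B : Matrix (Fin t) (Fin 1) ℝ := Matrix.of fun i _ => ρ⁻¹ * inner ℝ (a i) (a t) with hB
  set C : Matrix (Fin 1) (Fin t) ℝ := Matrix.of fun _ j => ρ⁻¹ * inner ℝ (a t) (a j) with hC
  set z : Matrix (Fin t) (Fin 1) ℝ := Matrix.of fun i _ => inner ℝ (a i) h with hz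
  set w : Matrix (Fin 1) (Fin 1) ℝ := Matrix.of fun _ _ => 1 + sqWidth ρ a t with hw
  have hh' : ρ • h + ∑ s : Fin t, inner ℝ (a s) h • a s = a t := by
    rw [Fin.sum_univ_eq_sum_range (fun s => inner ℝ (a s) h • a s) t, ← regSum_apply,
      regSum_regInv hρ]
  have hin : ∀ u : H, ρ * inner ℝ u h + ∑ s : Fin t, inner ℝ u (a s) * inner ℝ (a s) h =
      inner ℝ u (a t) := by
    intro u
    conv_rhs => rw [← hh']
    rw [inner_add_right, inner_smul_right, inner_sum]
    congr 1
    exact Finset.sum_congr rfl fun s _ => by rw [inner_smul_right]; ring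
  have h1 : A * z = B := by
    ext i j
    rw [hA, Matrix.add_mul, Matrix.one_mul, Matrix.add_apply, Matrix.smul_mul, Matrix.smul_apply,
      Matrix.mul_apply]
    simp only [hz, hB, of_apply, smul_eq_mul]
    rw [← hin (a i)]
    field_simp
  have h2 : C * z + w = Matrix.of fun _ _ => 1 + ρ⁻¹ * inner ℝ (a t) (a t) := by
    ext i j
    rw [Matrix.add_apply, Matrix.mul_apply]
    simp only [hz, hC, hw, of_apply, sqWidth, ← hh, mul_assoc, ← Finset.mul_sum]
    rw [← hin (a t)]
    field_simp
    ring
  have hfac : fromBlocks A 0 C w * fromBlocks 1 z 0 1 =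
      (1 + ρ⁻¹ • Matrix.of (fun i j : Fin (t + 1) => inner ℝ (a i) (a j))).submatrix
        finSumFinEquiv finSumFinEquiv := by
    rw [fromBlocks_multiply]
    simp only [Matrix.mul_one, Matrix.mul_zero, add_zero, h1, h2]
    ext i j
    rcases i with i | i <;> rcases j with j | j
    · simp [hA, Matrix.one_apply]
    · simp [hB, Fin.ext_iff, i.2.ne]
    · simp [hC, Fin.ext_iff, j.2.ne']
    · simp [Subsingleton.elim i j]
  have hdet := congrArg Matrix.det hfac
  rw [Matrix.det_mul, det_fromBlocks_zero₁₂, det_fromBlocks_zero₂₁, det_submatrix_equiv_self,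
    det_one, det_one, mul_one, mul_one, det_unique w] at hdet
  rw [← hdet, hw]
  simp

end Resolvent

/-! ### Conditionally sub-Gaussian noise and Gaussian mixtures -/

section SubGaussian

open scoped ENNReal

variable {Ω : Type*} {m m0 : MeasurableSpace Ω} {P : Measure Ω} [IsProbabilityMeasure P]
  {ε : Ω → ℝ} {σ : ℝ}

lemma CondSubGaussian.setIntegral_exp_le (hm : m ≤ m0) (h : CondSubGaussian P m ε σ) (l : ℝ)
    {A : Set Ω} (hA : MeasurableSet[m] A) :
    ∫ ω in A, Real.exp (l * ε ω) ∂P ≤ P.real A * Real.exp (l ^ 2 * σ ^ 2 / 2) := by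
  obtain ⟨hint, hle⟩ := h l
  rw [← setIntegral_condExp hm hint hA]
  calc ∫ ω in A, (P[fun ω => Real.exp (l * ε ω) | m]) ω ∂P
      ≤ ∫ _ω in A, Real.exp (l ^ 2 * σ ^ 2 / 2) ∂P :=
        setIntegral_mono_ae integrable_condExp.integrableOn (integrable_const _).integrableOn hle
    _ = _ := by rw [setIntegral_const, smul_eq_mul]

lemma CondSubGaussian.ae_eq_zero (hm : m ≤ m0) (h : CondSubGaussian P m ε 0) :
    ∀ᵐ ω ∂P, ε ω = 0 := by
  have h1 : ∀ l : ℝ, ∫ ω, Real.exp (l * ε ω) ∂P ≤ 1 := fun l => by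
    simpa using h.setIntegral_exp_le hm l MeasurableSet.univ
  have hi := fun l => (h l).1
  have hint : Integrable (fun ω => Real.exp (1 * ε ω) + Real.exp (-1 * ε ω) - 2) P :=
    ((hi 1).add (hi (-1))).sub (integrable_const 2)
  have hcosh : ∀ x : ℝ, Real.exp (1 * x) + Real.exp (-1 * x) - 2 = 2 * (Real.cosh x - 1) :=
    fun x => by rw [Real.cosh_eq, one_mul, neg_one_mul]; ring
  have hnn : 0 ≤ᵐ[P] fun ω => Real.exp (1 * ε ω) + Real.exp (-1 * ε ω) - 2 :=
    Eventually.of_forall fun ω => by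
      have := Real.one_le_cosh (ε ω)
      simp only [Pi.zero_apply, hcosh]
      linarith
  have hz : ∫ ω, (Real.exp (1 * ε ω) + Real.exp (-1 * ε ω) - 2) ∂P = 0 := by
    refine le_antisymm ?_ (integral_nonneg_of_ae hnn)
    have e1 := integral_sub ((hi 1).add (hi (-1))) (integrable_const (μ := P) (2 : ℝ))
    have e2 := integral_add (hi 1) (hi (-1))
    simp only [Pi.add_apply, integral_const, probReal_univ, one_smul] at e1 e2
    rw [e1, e2]
    linarith [h1 1, h1 (-1)]
  filter_upwards [(integral_eq_zero_iff_of_nonneg_ae hnn hint).1 hz] with ω hω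
  rw [hcosh] at hω
  by_contra hne
  have := Real.one_lt_cosh.2 hne
  simp only [Pi.zero_apply] at hω
  linarith

/-- Multiplying by `exp (l ε - l² σ² / 2)` does not increase the integral of an `m`-measurable
function. -/
lemma CondSubGaussian.lintegral_mul_exp_le (hm : m ≤ m0) (h : CondSubGaussian P m ε σ)
    (hε : Measurable ε) (l : ℝ) {Z : Ω → ℝ≥0∞} (hZ : Measurable[m] Z) :
    ∫⁻ ω, Z ω * ENNReal.ofReal (Real.exp (l * ε ω - l ^ 2 * σ ^ 2 / 2)) ∂P ≤ ∫⁻ ω, Z ω ∂P := by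
  set D : Ω → ℝ≥0∞ := fun ω => ENNReal.ofReal (Real.exp (l * ε ω - l ^ 2 * σ ^ 2 / 2)) with hD
  have hDm : Measurable D := by fun_prop
  have hle : (P.withDensity D).trim hm ≤ P.trim hm := by
    refine Measure.le_iff.2 fun A hA => ?_
    rw [trim_measurableSet_eq hm hA, trim_measurableSet_eq hm hA, withDensity_apply _ (hm A hA)]
    have hi : IntegrableOn (fun ω => Real.exp (l * ε ω - l ^ 2 * σ ^ 2 / 2)) A P := by
      simp_rw [Real.exp_sub]
      exact ((h l).1.div_const _).integrableOn
    rw [hD, ← ofReal_integral_eq_lintegral_ofReal hi (Eventually.of_forall fun _ => by positivity)]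
    rw [← ofReal_measureReal (measure_ne_top P A)]
    refine ENNReal.ofReal_le_ofReal ?_
    simp_rw [Real.exp_sub]
    rw [integral_div, div_le_iff₀ (Real.exp_pos _)]
    exact h.setIntegral_exp_le hm l hA
  calc ∫⁻ ω, Z ω * D ω ∂P = ∫⁻ ω, Z ω ∂(P.withDensity D) := by
        rw [lintegral_withDensity_eq_lintegral_mul _ hDm (hZ.mono hm le_rfl)]
        simp [mul_comm]
    _ = ∫⁻ ω, Z ω ∂((P.withDensity D).trim hm) := (lintegral_trim hm hZ).symm
    _ ≤ ∫⁻ ω, Z ω ∂(P.trim hm) := lintegral_mono' hle le_rfl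
    _ = ∫⁻ ω, Z ω ∂P := lintegral_trim hm hZ

/-- The same with an `m`-measurable exponent. -/
lemma CondSubGaussian.lintegral_mul_exp_le' (hm : m ≤ m0) (h : CondSubGaussian P m ε σ)
    (hε : Measurable ε) {l : Ω → ℝ} (hl : Measurable[m] l) {Z : Ω → ℝ≥0∞} (hZ : Measurable[m] Z) :
    ∫⁻ ω, Z ω * ENNReal.ofReal (Real.exp (l ω * ε ω - l ω ^ 2 * σ ^ 2 / 2)) ∂P ≤
      ∫⁻ ω, Z ω ∂P := by
  have hl' : StronglyMeasurable[m] l := hl.stronglyMeasurable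
  have hZ0 : Measurable Z := hZ.mono hm le_rfl
  obtain ⟨f, hfm, hfin, hlim⟩ : ∃ f : ℕ → Ω → ℝ, (∀ n, Measurable[m] (f n)) ∧
      (∀ n, (Set.range (f n)).Finite) ∧ ∀ ω, Tendsto (fun n => f n ω) atTop (𝓝 (l ω)) :=
    ⟨fun n => @SimpleFunc.toFun Ω m ℝ (hl'.approx n),
      fun n => @SimpleFunc.measurable Ω ℝ m _ (hl'.approx n),
      fun n => @SimpleFunc.finite_range Ω ℝ m (hl'.approx n), fun ω => hl'.tendsto_approx ω⟩
  have hsimple : ∀ n, ∫⁻ ω, Z ω * ENNReal.ofReal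
      (Real.exp (f n ω * ε ω - f n ω ^ 2 * σ ^ 2 / 2)) ∂P ≤ ∫⁻ ω, Z ω ∂P := by
    intro n
    set g := f n
    have hsplit : ∀ (F : ℝ → Ω → ℝ≥0∞) (ω : Ω), F (g ω) ω =
        ∑ c ∈ (hfin n).toFinset, (g ⁻¹' {c}).indicator (F c) ω := by
      intro F ω
      rw [Finset.sum_eq_single (g ω)]
      · simp
      · intro c _ hc
        exact Set.indicator_of_notMem (fun hmem => hc (by simpa using hmem.symm)) _
      · intro hc
        exact absurd ((hfin n).mem_toFinset.2 ⟨ω, rfl⟩) hc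
    have hZc : ∀ c, Measurable[m] ((g ⁻¹' {c}).indicator Z) := fun c =>
      hZ.indicator (hfm n (measurableSet_singleton c))
    have hmeas : ∀ c, Measurable fun ω => (g ⁻¹' {c}).indicator Z ω *
        ENNReal.ofReal (Real.exp (c * ε ω - c ^ 2 * σ ^ 2 / 2)) := fun c =>
      ((hZc c).mono hm le_rfl).mul (by fun_prop)
    calc ∫⁻ ω, Z ω * ENNReal.ofReal (Real.exp (g ω * ε ω - g ω ^ 2 * σ ^ 2 / 2)) ∂P
        = ∫⁻ ω, ∑ c ∈ (hfin n).toFinset, (g ⁻¹' {c}).indicator Z ω *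
            ENNReal.ofReal (Real.exp (c * ε ω - c ^ 2 * σ ^ 2 / 2)) ∂P := by
          refine lintegral_congr fun ω => ?_
          rw [hsplit (fun c ω => Z ω *
            ENNReal.ofReal (Real.exp (c * ε ω - c ^ 2 * σ ^ 2 / 2))) ω]
          exact Finset.sum_congr rfl fun c _ => Set.indicator_mul_left _ _ _
      _ = ∑ c ∈ (hfin n).toFinset, ∫⁻ ω, (g ⁻¹' {c}).indicator Z ω *
            ENNReal.ofReal (Real.exp (c * ε ω - c ^ 2 * σ ^ 2 / 2)) ∂P :=
          lintegral_finsetSum _ fun c _ => hmeas c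
      _ ≤ ∑ c ∈ (hfin n).toFinset, ∫⁻ ω, (g ⁻¹' {c}).indicator Z ω ∂P :=
          Finset.sum_le_sum fun c _ => h.lintegral_mul_exp_le hm hε c (hZc c)
      _ = ∫⁻ ω, ∑ c ∈ (hfin n).toFinset, (g ⁻¹' {c}).indicator Z ω ∂P :=
          (lintegral_finsetSum _ fun c _ => (hZc c).mono hm le_rfl).symm
      _ = ∫⁻ ω, Z ω ∂P := lintegral_congr fun ω => (hsplit (fun _ => Z) ω).symm
  have hmeas : ∀ n, Measurable fun ω => Z ω * ENNReal.ofReal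
      (Real.exp (f n ω * ε ω - f n ω ^ 2 * σ ^ 2 / 2)) := fun n =>
    hZ0.mul ((((((hfm n).mono hm le_rfl).mul hε).sub
      (((((hfm n).mono hm le_rfl).pow_const 2).mul_const _).div_const 2)).exp)
      |>.ennreal_ofReal)
  calc ∫⁻ ω, Z ω * ENNReal.ofReal (Real.exp (l ω * ε ω - l ω ^ 2 * σ ^ 2 / 2)) ∂P
      = ∫⁻ ω, liminf (fun n => Z ω * ENNReal.ofReal
          (Real.exp (f n ω * ε ω - f n ω ^ 2 * σ ^ 2 / 2))) atTop ∂P := by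
        refine lintegral_congr fun ω => ?_
        refine (Tendsto.liminf_eq ?_).symm
        refine ENNReal.Tendsto.const_mul (ENNReal.tendsto_ofReal ?_)
          (Or.inl (by simpa using Real.exp_pos _))
        exact (Real.continuous_exp.tendsto _).comp
          (((hlim ω).mul_const _).sub ((((hlim ω).pow 2).mul_const _).div_const 2))
    _ ≤ liminf (fun n => ∫⁻ ω, Z ω * ENNReal.ofReal
          (Real.exp (f n ω * ε ω - f n ω ^ 2 * σ ^ 2 / 2)) ∂P) atTop :=
        lintegral_liminf_le hmeas
    _ ≤ ∫⁻ ω, Z ω ∂P := by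
        refine (liminf_le_liminf (Eventually.of_forall hsimple)).trans ?_
        simp

/-- Integral of `exp (λ ε - λ² / 2)` against the law `N(b, w)` of `λ`. -/
lemma lintegral_gaussian_mixture {w : ℝ} (hw : 0 ≤ w) (b e : ℝ) :
    ∫⁻ z : ℝ, ENNReal.ofReal ((√(2 * Real.pi))⁻¹ * Real.exp (-z ^ 2 / 2)) *
        ENNReal.ofReal (Real.exp ((b + √w * z) * e - (b + √w * z) ^ 2 / 2)) =
      ENNReal.ofReal ((√(1 + w))⁻¹ *
        Real.exp ((2 * e * b + e ^ 2 * w - b ^ 2) / (2 * (1 + w)))) := by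
  have hw1 : 0 < 1 + w := by linarith
  set c := √w * (e - b) / (1 + w) with hc
  set K := (√(2 * Real.pi))⁻¹ * Real.exp ((2 * e * b + e ^ 2 * w - b ^ 2) / (2 * (1 + w))) with hK
  have hsq : √w ^ 2 = w := Real.sq_sqrt hw
  have hpt : ∀ z : ℝ, ENNReal.ofReal ((√(2 * Real.pi))⁻¹ * Real.exp (-z ^ 2 / 2)) *
        ENNReal.ofReal (Real.exp ((b + √w * z) * e - (b + √w * z) ^ 2 / 2)) =
      ENNReal.ofReal (K * Real.exp (-((1 + w) / 2) * (z - c) ^ 2)) := by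
    intro z
    rw [← ENNReal.ofReal_mul (by positivity), hK, mul_assoc, mul_assoc, ← Real.exp_add,
      ← Real.exp_add]
    congr 3
    rw [hc]
    field_simp
    linear_combination (-(z ^ 2 * (1 + w)) + (e - b) ^ 2) * hsq
  have hint : Integrable fun z : ℝ => K * Real.exp (-((1 + w) / 2) * (z - c) ^ 2) :=
    ((integrable_exp_neg_mul_sq (by positivity : 0 < (1 + w) / 2)).comp_sub_right c).const_mul K
  rw [lintegral_congr hpt, ← ofReal_integral_eq_lintegral_ofReal hint
    (Eventually.of_forall fun z => by positivity), integral_const_mul,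
    integral_sub_right_eq_self (fun z => Real.exp (-((1 + w) / 2) * z ^ 2)) c, integral_gaussian]
  congr 1
  rw [hK, show Real.pi / ((1 + w) / 2) = 2 * Real.pi / (1 + w) by field_simp,
    Real.sqrt_div (by positivity)]
  field_simp

lemma lintegral_gaussian_weight :
    ∫⁻ z : ℝ, ENNReal.ofReal ((√(2 * Real.pi))⁻¹ * Real.exp (-z ^ 2 / 2)) = 1 := by
  simpa using lintegral_gaussian_mixture le_rfl 0 0

/-- One step of the method of mixtures. -/
theorem CondSubGaussian.lintegral_mul_mixture_le (hm : m ≤ m0) (h : CondSubGaussian P m ε σ)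
    (hσ : 0 < σ) (hε : Measurable ε) {b w : Ω → ℝ} (hb : Measurable[m] b) (hw : Measurable[m] w)
    (hw0 : ∀ ω, 0 ≤ w ω) {Z : Ω → ℝ≥0∞} (hZ : Measurable[m] Z) :
    ∫⁻ ω, Z ω * ENNReal.ofReal ((√(1 + w ω))⁻¹ *
      Real.exp ((2 * ε ω * b ω + ε ω ^ 2 * w ω - b ω ^ 2) / (1 + w ω) / (2 * σ ^ 2))) ∂P ≤
      ∫⁻ ω, Z ω ∂P := by
  set G : ℝ → ℝ≥0∞ := fun z => ENNReal.ofReal ((√(2 * Real.pi))⁻¹ * Real.exp (-z ^ 2 / 2)) with hG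
  set l : ℝ → Ω → ℝ := fun z ω => (b ω / σ + √(w ω) * z) / σ with hl
  have hGm : Measurable G := by fun_prop
  have hZ0 : Measurable Z := hZ.mono hm le_rfl
  have hb0 : Measurable b := hb.mono hm le_rfl
  have hww : Measurable w := hw.mono hm le_rfl
  have hlm : ∀ z, Measurable[m] (l z) := fun z =>
    ((hb.div_const σ).add (hw.sqrt.mul_const z)).div_const σ
  calc ∫⁻ ω, Z ω * ENNReal.ofReal ((√(1 + w ω))⁻¹ *
        Real.exp ((2 * ε ω * b ω + ε ω ^ 2 * w ω - b ω ^ 2) / (1 + w ω) / (2 * σ ^ 2))) ∂P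
      = ∫⁻ ω, (∫⁻ z, G z * (Z ω * ENNReal.ofReal
          (Real.exp (l z ω * ε ω - l z ω ^ 2 * σ ^ 2 / 2)))) ∂P := by
        refine lintegral_congr fun ω => ?_
        have hmix := lintegral_gaussian_mixture (hw0 ω) (b ω / σ) (ε ω / σ)
        have hpos : 1 + w ω ≠ 0 := by have := hw0 ω; positivity
        rw [show (2 * ε ω * b ω + ε ω ^ 2 * w ω - b ω ^ 2) / (1 + w ω) / (2 * σ ^ 2) =
          (2 * (ε ω / σ) * (b ω / σ) + (ε ω / σ) ^ 2 * w ω - (b ω / σ) ^ 2) / (2 * (1 + w ω)) by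
            field_simp, ← hmix, ← lintegral_const_mul _ (by fun_prop)]
        refine lintegral_congr fun z => ?_
        rw [mul_left_comm]
        congr 4
        simp only [hl]
        field_simp
    _ = ∫⁻ z, (∫⁻ ω, G z * (Z ω * ENNReal.ofReal
          (Real.exp (l z ω * ε ω - l z ω ^ 2 * σ ^ 2 / 2))) ∂P) := by
        refine lintegral_lintegral_swap (Measurable.aemeasurable ?_)
        simp only [Function.uncurry_def, hl]
        fun_prop
    _ ≤ ∫⁻ z, (G z * ∫⁻ ω, Z ω ∂P) := by
        refine lintegral_mono fun z => ?_
        rw [lintegral_const_mul]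
        · refine mul_le_mul_right ?_ _
          exact h.lintegral_mul_exp_le' hm hε (hlm z) hZ
        · have := (hlm z).mono hm le_rfl
          fun_prop
    _ = ∫⁻ ω, Z ω ∂P := by
        rw [lintegral_mul_const _ hGm, lintegral_gaussian_weight, one_mul]

omit [IsProbabilityMeasure P] in
/-- Ville's maximal inequality. -/
theorem maximal_inequality {M : ℕ → Ω → ℝ≥0∞} {𝓕 : ℕ → MeasurableSpace Ω} {T : ℕ} {c : ℝ≥0∞}
    (hM : ∀ t ≤ T, Measurable (M t)) (hadapted : ∀ t < T, ∀ s ≤ t, Measurable[𝓕 t] (M s))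
    (hsuper : ∀ t < T, ∀ A, MeasurableSet[𝓕 t] A → MeasurableSet A →
      ∫⁻ ω in A, M (t + 1) ω ∂P ≤ ∫⁻ ω in A, M t ω ∂P)
    (h0 : ∫⁻ ω, M 0 ω ∂P ≤ 1) : c * P {ω | ∃ t ≤ T, c < M t ω} ≤ 1 := by
  set B : ℕ → Set Ω := fun n => {ω | ∀ s ≤ n, M s ω ≤ c} with hB
  have hBm : ∀ n ≤ T, MeasurableSet (B n) := fun n hn => by
    simp only [hB, Set.ofPred_forall]
    exact MeasurableSet.iInter fun s => MeasurableSet.iInter fun hs =>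
      measurableSet_le (hM s (hs.trans hn)) measurable_const
  have hBF : ∀ n < T, MeasurableSet[𝓕 n] (B n) := fun n hn => by
    simp only [hB, Set.ofPred_forall]
    exact MeasurableSet.iInter fun s => MeasurableSet.iInter fun hs =>
      measurableSet_le (hadapted n hn s hs) measurable_const
  have hsplit : ∀ t ≤ T, ∀ A, MeasurableSet A →
      c * P (A ∩ {ω | c < M t ω}) + ∫⁻ ω in A ∩ {ω | M t ω ≤ c}, M t ω ∂P ≤
        ∫⁻ ω in A, M t ω ∂P := by
    intro t ht A hA
    have hset : MeasurableSet {ω | M t ω ≤ c} := measurableSet_le (hM t ht) measurable_const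
    have hcompl : A \ {ω | M t ω ≤ c} = A ∩ {ω | c < M t ω} := by
      ext ω; simp
    rw [← lintegral_inter_add_sdiff (M t) A hset, hcompl, add_comm]
    gcongr
    rw [← setLIntegral_const]
    exact setLIntegral_mono (hM t ht) fun ω hω => hω.2.le
  have key : ∀ n ≤ T, c * P (B n)ᶜ + ∫⁻ ω in B n, M n ω ∂P ≤ 1 := by
    intro n
    induction n with
    | zero =>
      intro _
      refine le_trans ?_ h0
      have h := hsplit 0 (Nat.zero_le _) Set.univ MeasurableSet.univ
      have e1 : (B 0)ᶜ = {ω | c < M 0 ω} := by ext ω; simp [hB]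
      have e2 : B 0 = {ω | M 0 ω ≤ c} := by ext ω; simp [hB]
      rw [e1, e2]
      simpa using h
    | succ n ih =>
      intro hn
      have hn' : n < T := hn
      have e1 : (B (n + 1))ᶜ ⊆ (B n)ᶜ ∪ (B n ∩ {ω | c < M (n + 1) ω}) := by
        intro ω hω
        by_cases hmem : ω ∈ B n
        · refine Or.inr ⟨hmem, ?_⟩
          by_contra hle
          refine hω fun s hs => ?_
          rcases Nat.le_succ_iff.1 hs with h | h
          · exact hmem s h
          · rw [h]; exact not_lt.1 hle
        · exact Or.inl hmem
      have e2 : B (n + 1) ⊆ B n ∩ {ω | M (n + 1) ω ≤ c} := fun ω hω =>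
        ⟨fun s hs => hω s (hs.trans n.le_succ), hω _ le_rfl⟩
      calc c * P (B (n + 1))ᶜ + ∫⁻ ω in B (n + 1), M (n + 1) ω ∂P
          ≤ c * (P (B n)ᶜ + P (B n ∩ {ω | c < M (n + 1) ω})) +
              ∫⁻ ω in B n ∩ {ω | M (n + 1) ω ≤ c}, M (n + 1) ω ∂P := by
            gcongr
            exact (measure_mono e1).trans (measure_union_le _ _)
        _ = c * P (B n)ᶜ + (c * P (B n ∩ {ω | c < M (n + 1) ω}) +
              ∫⁻ ω in B n ∩ {ω | M (n + 1) ω ≤ c}, M (n + 1) ω ∂P) := by rw [mul_add, add_assoc]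
        _ ≤ c * P (B n)ᶜ + ∫⁻ ω in B n, M n ω ∂P := by
            gcongr
            exact (hsplit _ hn _ (hBm n hn'.le)).trans
              (hsuper n hn' _ (hBF n hn') (hBm n hn'.le))
        _ ≤ 1 := ih hn'.le
  refine le_trans ?_ (key T le_rfl)
  refine le_trans ?_ le_self_add
  gcongr
  rintro ω ⟨t, ht, hlt⟩ hmem
  exact absurd (hmem t ht) (not_le.2 hlt)

end SubGaussian

/-! ### Reproducing property and measurability -/

section Reproducing

variable {S : Type*} {H : Type*} [NormedAddCommGroup H] [InnerProductSpace ℝ H] [CompleteSpace H]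
  [RKHS ℝ H S ℝ]

lemma inner_kerAt (x : S) (f : H) : inner ℝ (kerAt H x) f = f x := by
  rw [kerAt, RKHS.kerFun_inner]
  simp

lemma rkhsKer_eq_inner (x y : S) : rkhsKer H x y = inner ℝ (kerAt H x) (kerAt H y) := by
  rw [inner_kerAt, kerAt, RKHS.kerFun_apply]
  rfl

lemma rkhsKer_eq_apply (x y : S) : rkhsKer H x y = kerAt H y x := by
  rw [rkhsKer_eq_inner, inner_kerAt]

lemma rkhsKer_comm (x y : S) : rkhsKer H x y = rkhsKer H y x := by
  rw [rkhsKer_eq_inner, rkhsKer_eq_inner, real_inner_comm]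

lemma norm_kerAt_sq (x : S) : ‖kerAt H x‖ ^ 2 = rkhsKer H x x := by
  rw [rkhsKer_eq_inner, real_inner_self_eq_norm_sq]

lemma regDet_eq (ρ : ℝ) {t : ℕ} (x : Fin t → S) : regDet (rkhsKer H) ρ x =
    (1 + ρ⁻¹ • Matrix.of (fun i j => inner ℝ (kerAt H (x i)) (kerAt H (x j)))).det := by
  simp only [regDet, rkhsKer_eq_inner]

lemma regDet_succ {ρ : ℝ} (hρ : 0 < ρ) (x : ℕ → S) (t : ℕ) :
    regDet (rkhsKer H) ρ (fun i : Fin (t + 1) => x i) =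
      regDet (rkhsKer H) ρ (fun i : Fin t => x i) *
        (1 + sqWidth ρ (fun s => kerAt H (x s)) t) := by
  rw [regDet_eq, regDet_eq]
  exact det_one_add_gram_succ hρ (fun s => kerAt H (x s)) t

lemma regDet_zero (k : S → S → ℝ) (ρ : ℝ) (x : Fin 0 → S) : regDet k ρ x = 1 := by simp [regDet]

lemma one_le_regDet {ρ : ℝ} (hρ : 0 < ρ) (x : ℕ → S) (t : ℕ) :
    1 ≤ regDet (rkhsKer H) ρ (fun i : Fin t => x i) := by
  induction t with
  | zero => rw [regDet_zero]
  | succ t ih =>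
    rw [regDet_succ hρ]
    have := sqWidth_nonneg (a := fun s => kerAt H (x s)) (t := t) hρ
    nlinarith

lemma regDet_mono {ρ : ℝ} (hρ : 0 < ρ) (x : ℕ → S) :
    Monotone fun t => regDet (rkhsKer H) ρ (fun i : Fin t => x i) := by
  refine monotone_nat_of_le_succ fun t => ?_
  rw [regDet_succ hρ]
  have := sqWidth_nonneg (a := fun s => kerAt H (x s)) (t := t) hρ
  have := one_le_regDet (H := H) hρ x t
  nlinarith

lemma abs_apply_le {L : ℝ} (hL : ∀ x y, |rkhsKer H x y| ≤ L) (f : H) (x : S) :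
    |f x| ≤ √L * ‖f‖ := by
  rw [← inner_kerAt]
  refine (abs_real_inner_le_norm _ _).trans (mul_le_mul_of_nonneg_right ?_ (norm_nonneg _))
  refine Real.le_sqrt_of_sq_le ?_
  rw [norm_kerAt_sq]
  exact (le_abs_self _).trans (hL x x)

variable [MeasurableSpace S]

/-- The elements of a reproducing kernel Hilbert space with measurable kernel are measurable. -/
lemma measurable_coe (hk : Measurable (Function.uncurry (rkhsKer H))) (f : H) :
    Measurable (f : S → ℝ) := by
  have hcl : IsClosed {g : H | Measurable (g : S → ℝ)} := by
    refine IsSeqClosed.isClosed fun g h hg hgh => ?_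
    refine measurable_of_tendsto_metrizable hg (tendsto_pi_nhds.2 fun x => ?_)
    exact ((RKHS.continuous_eval x).tendsto h).comp hgh
  have hspan : (Submodule.span ℝ {RKHS.kerFun H x v | (x : S) (v : ℝ)} : Set H) ⊆
      {g : H | Measurable (g : S → ℝ)} := by
    intro g hg
    refine Submodule.span_induction ?_ ?_ ?_ ?_ hg
    · rintro _ ⟨x, v, rfl⟩
      have hv : RKHS.kerFun H x v = v • kerAt H x := by
        rw [kerAt, ← map_smul, smul_eq_mul, mul_one]
      simp only [Set.mem_ofPred_eq, hv, RKHS.coe_smul]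
      have : (kerAt H x : S → ℝ) = fun y => Function.uncurry (rkhsKer H) (y, x) :=
        funext fun y => (rkhsKer_eq_apply y x).symm
      rw [this]
      exact (hk.comp measurable_prodMk_right).const_smul v
    · simp only [Set.mem_ofPred_eq, RKHS.coe_zero]
      exact measurable_const
    · intro g h _ _ hg hh
      simp only [Set.mem_ofPred_eq, RKHS.coe_add]
      exact hg.add hh
    · intro c g _ hg
      simp only [Set.mem_ofPred_eq, RKHS.coe_smul]
      exact hg.const_smul c
  have hmem : f ∈ (Submodule.span ℝ {RKHS.kerFun H x v | (x : S) (v : ℝ)}).topologicalClosure := by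
    rw [RKHS.kerFun_dense]; trivial
  exact closure_minimal hspan hcl hmem

variable {Ω : Type*} {m : MeasurableSpace Ω} {X : ℕ → Ω → S} {ρ : ℝ}

lemma measurable_inner_regInv (hk : Measurable (Function.uncurry (rkhsKer H))) {n : ℕ}
    (hX : ∀ s < n, Measurable (X s)) {t : ℕ} (ht : t ≤ n) {i j : ℕ} (hi : i < n) (hj : j < n) :
    Measurable fun ω => inner ℝ (kerAt H (X i ω))
      (regInv ρ (fun s => kerAt H (X s ω)) t (kerAt H (X j ω))) := by
  induction t generalizing i j with
  | zero =>
    simp only [regInv, _root_.smul_apply, ContinuousLinearMap.id_apply,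
      inner_smul_right, ← rkhsKer_eq_inner]
    exact (hk.comp ((hX i hi).prodMk (hX j hj))).const_mul _
  | succ t ih =>
    simp only [regInv_succ_apply, inner_sub_right, inner_smul_right, sqWidth]
    have ht' : t < n := ht
    simp only [regInv_symm]
    exact (ih ht'.le hi hj).sub
      ((((ih ht'.le ht' ht').const_add 1).inv.mul (ih ht'.le ht' hj)).mul (ih ht'.le hi ht'))

lemma measurable_sqWidth (hk : Measurable (Function.uncurry (rkhsKer H))) {t : ℕ}
    (hX : ∀ s < t + 1, Measurable (X s)) :
    Measurable fun ω => sqWidth ρ (fun s => kerAt H (X s ω)) t :=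
  measurable_inner_regInv hk hX (Nat.le_succ t) (Nat.lt_succ_self t) (Nat.lt_succ_self t)

lemma measurable_regDet (hk : Measurable (Function.uncurry (rkhsKer H))) (hρ : 0 < ρ) {t : ℕ}
    (hX : ∀ s < t, Measurable (X s)) :
    Measurable fun ω => regDet (rkhsKer H) ρ (fun i : Fin t => X i ω) := by
  induction t with
  | zero => simp only [regDet_zero]; exact measurable_const
  | succ t ih =>
    have e : ∀ ω, regDet (rkhsKer H) ρ (fun i : Fin (t + 1) => X i ω) = _ :=
      fun ω => regDet_succ hρ (fun s => X s ω) t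
    simp only [e]
    exact (ih fun s hs => hX s (hs.trans (Nat.lt_succ_self t))).mul
      ((measurable_sqWidth hk hX).const_add 1)

/-- The accumulated noise `∑_{s < t} ε_s k(·, X_s)`. -/
def noiseSum (H : Type*) [NormedAddCommGroup H] [InnerProductSpace ℝ H] [CompleteSpace H]
    [RKHS ℝ H S ℝ] (x : ℕ → S) (e : ℕ → ℝ) (t : ℕ) : H :=
  ∑ s ∈ Finset.range t, e s • kerAt H (x s)

/-- The squared norm of the accumulated noise, weighted by `(ρ id + V_t)⁻¹`. -/
def noiseSq (H : Type*) [NormedAddCommGroup H] [InnerProductSpace ℝ H] [CompleteSpace H]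
    [RKHS ℝ H S ℝ] (ρ : ℝ) (x : ℕ → S) (e : ℕ → ℝ) (t : ℕ) : ℝ :=
  inner ℝ (noiseSum H x e t) (regInv ρ (fun s => kerAt H (x s)) t (noiseSum H x e t))

lemma measurable_inner_noiseSum (hk : Measurable (Function.uncurry (rkhsKer H))) {t : ℕ}
    {ε : ℕ → Ω → ℝ} (hX : ∀ s < t + 1, Measurable (X s)) (hε : ∀ s < t, Measurable (ε s)) :
    Measurable fun ω => inner ℝ (kerAt H (X t ω)) (regInv ρ (fun s => kerAt H (X s ω)) t
      (noiseSum H (fun s => X s ω) (fun s => ε s ω) t)) := by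
  simp only [noiseSum, map_sum, map_smul, inner_sum, inner_smul_right]
  refine Finset.measurable_sum _ fun s hs => ?_
  have hs' := Finset.mem_range.1 hs
  exact (hε s hs').mul (measurable_inner_regInv hk hX (Nat.le_succ t) (Nat.lt_succ_self t)
    (hs'.trans (Nat.lt_succ_self t)))

lemma measurable_noiseSq (hk : Measurable (Function.uncurry (rkhsKer H))) {t : ℕ}
    {ε : ℕ → Ω → ℝ} (hX : ∀ s < t, Measurable (X s)) (hε : ∀ s < t, Measurable (ε s)) :
    Measurable fun ω => noiseSq H ρ (fun s => X s ω) (fun s => ε s ω) t := by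
  simp only [noiseSq, noiseSum, map_sum, map_smul, inner_sum, sum_inner, inner_smul_left,
    inner_smul_right, conj_trivial]
  refine Finset.measurable_sum _ fun s hs => ?_
  have hs' := Finset.mem_range.1 hs
  refine (hε s hs').mul (Finset.measurable_sum _ fun r hr => ?_)
  have hr' := Finset.mem_range.1 hr
  exact (hε r hr').mul (measurable_inner_regInv hk hX le_rfl hr' hs')

end Reproducing

/-! ### The confidence bound -/

section Confidence

open scoped ENNReal

variable {S : Type*} [MeasurableSpace S] {H : Type*} [NormedAddCommGroup H]
  [InnerProductSpace ℝ H] [CompleteSpace H] [RKHS ℝ H S ℝ] {Ω : Type*} [m0 : MeasurableSpace Ω]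
  {P : Measure Ω} [IsProbabilityMeasure P] {f : H} {X : ℕ → Ω → S} {ε : ℕ → Ω → ℝ} {T : ℕ}
  {σ D ρ : ℝ}

omit [CompleteSpace H] m0 in
lemma measurable_action_history {s t : ℕ} (hst : s ≤ t) :
    Measurable[history f X ε t] (X s) := by
  refine measurable_iff_comap_le.2 (le_trans ?_ le_sup_right)
  exact le_iSup₂_of_le s (Finset.mem_range.2 (Nat.lt_succ_of_le hst)) le_rfl

omit m0 in
lemma measurable_noise_history (hk : Measurable (Function.uncurry (rkhsKer H))) {s t : ℕ}
    (hst : s < t) : Measurable[history f X ε t] (ε s) := by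
  have h1 : Measurable[history f X ε t] (reward f X ε s) := by
    refine measurable_iff_comap_le.2 (le_trans ?_ le_sup_left)
    exact le_iSup₂_of_le s (Finset.mem_range.2 hst) le_rfl
  have h2 : Measurable[history f X ε t] fun ω => f (X s ω) :=
    (measurable_coe hk f).comp (measurable_action_history hst.le)
  have h3 : ε s = fun ω => reward f X ε s ω - f (X s ω) := by
    funext ω; simp [reward]
  rw [h3]
  exact h1.sub h2

omit [IsProbabilityMeasure P] in
lemma IsBandit.history_le (hk : Measurable (Function.uncurry (rkhsKer H)))
    (hB : IsBandit P T σ D f X ε) {t : ℕ} (ht : t < T) : history f X ε t ≤ m0 := by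
  refine sup_le (iSup₂_le fun s hs => ?_) (iSup₂_le fun s hs => ?_)
  · have hs' := (Finset.mem_range.1 hs).trans ht
    exact (((measurable_coe hk f).comp (hB.measurable_action s hs')).add
      (hB.measurable_noise s hs')).comap_le
  · exact (hB.measurable_action s
      (lt_of_le_of_lt (Nat.lt_succ_iff.1 (Finset.mem_range.1 hs)) ht)).comap_le

lemma one_sub_le_measureReal_of_ae {δ : ℝ} (hδ : 0 ≤ δ) {p : Ω → Prop} (hp : ∀ᵐ ω ∂P, p ω) :
    1 - δ ≤ P.real {ω | p ω} := by
  rw [measureReal_congr (eventuallyEq_univ.2 hp), probReal_univ]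
  linarith

/-- The supermartingale `det (I + ρ⁻¹ K_t)^{-1/2} exp (‖S_t‖² / (2 σ²))`. -/
def mixtureProcess (H : Type*) [NormedAddCommGroup H] [InnerProductSpace ℝ H] [CompleteSpace H]
    [RKHS ℝ H S ℝ] (σ ρ : ℝ) (X : ℕ → Ω → S) (ε : ℕ → Ω → ℝ) (t : ℕ) (ω : Ω) : ℝ≥0∞ :=
  ENNReal.ofReal ((√(regDet (rkhsKer H) ρ (fun i : Fin t => X i ω)))⁻¹ *
    Real.exp (noiseSq H ρ (fun s => X s ω) (fun s => ε s ω) t / (2 * σ ^ 2)))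

omit m0 in
lemma measurable_mixtureProcess {m : MeasurableSpace Ω}
    (hk : Measurable (Function.uncurry (rkhsKer H))) (hρ : 0 < ρ) {t : ℕ}
    (hX : ∀ s < t, Measurable[m] (X s)) (hε : ∀ s < t, Measurable[m] (ε s)) :
    Measurable[m] (mixtureProcess H σ ρ X ε t) :=
  ((measurable_regDet hk hρ hX).sqrt.inv.mul
    ((measurable_noiseSq hk hX hε).div_const _).exp).ennreal_ofReal

omit [MeasurableSpace S] m0 in
lemma mixtureProcess_succ (hρ : 0 < ρ) (t : ℕ) (ω : Ω) :
    mixtureProcess H σ ρ X ε (t + 1) ω = mixtureProcess H σ ρ X ε t ω *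
      ENNReal.ofReal ((√(1 + sqWidth ρ (fun s => kerAt H (X s ω)) t))⁻¹ *
        Real.exp ((2 * ε t ω * inner ℝ (kerAt H (X t ω)) (regInv ρ (fun s => kerAt H (X s ω)) t
          (noiseSum H (fun s => X s ω) (fun s => ε s ω) t)) +
          ε t ω ^ 2 * sqWidth ρ (fun s => kerAt H (X s ω)) t -
          inner ℝ (kerAt H (X t ω)) (regInv ρ (fun s => kerAt H (X s ω)) t
            (noiseSum H (fun s => X s ω) (fun s => ε s ω) t)) ^ 2) /
          (1 + sqWidth ρ (fun s => kerAt H (X s ω)) t) / (2 * σ ^ 2))) := by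
  have hd := one_le_regDet (H := H) hρ (fun s => X s ω) t
  have e1 := regDet_succ (H := H) hρ (fun s => X s ω) t
  have e2 : noiseSum H (fun s => X s ω) (fun s => ε s ω) (t + 1) =
      noiseSum H (fun s => X s ω) (fun s => ε s ω) t + ε t ω • kerAt H (X t ω) :=
    Finset.sum_range_succ _ _
  have e3 := inner_regInv_succ (a := fun s => kerAt H (X s ω)) (t := t) hρ
    (noiseSum H (fun s => X s ω) (fun s => ε s ω) t) (ε t ω)
  rw [mixtureProcess, mixtureProcess, noiseSq, e2, e3, e1,
    Real.sqrt_mul (by linarith : 0 ≤ regDet (rkhsKer H) ρ (fun i : Fin t => X i ω)),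
    add_div, Real.exp_add, mul_inv, ← ENNReal.ofReal_mul (by positivity)]
  congr 1
  rw [noiseSq]
  ring

/-- Self-normalized concentration: with probability at least `1 - δ`, all the accumulated noises
up to time `T` are bounded as in `confRadius`. -/
theorem IsBandit.noise_bound (hk : Measurable (Function.uncurry (rkhsKer H)))
    (hB : IsBandit P T σ D f X ε) (hσ : 0 ≤ σ) {δ : ℝ} (hδ : 0 < δ) (hρ : 0 < ρ) :
    1 - δ ≤ P.real {ω | ∀ t ≤ T, √(noiseSq H ρ (fun s => X s ω) (fun s => ε s ω) t) ≤
      σ * √(2 * Real.log (δ⁻¹ * √(regDet (rkhsKer H) ρ (fun i : Fin t => X i ω))))} := by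
  rcases hσ.eq_or_lt with rfl | hσ
  · have hz : ∀ᵐ ω ∂P, ∀ t < T, ε t ω = 0 := by
      rw [ae_all_iff]
      intro t
      by_cases ht : t < T
      · filter_upwards [(hB.subGaussian t ht).ae_eq_zero (hB.history_le hk ht)] with ω hω _
        exact hω
      · exact Eventually.of_forall fun ω h => absurd h ht
    refine one_sub_le_measureReal_of_ae hδ.le ?_
    filter_upwards [hz] with ω hω t ht
    have : noiseSum H (fun s => X s ω) (fun s => ε s ω) t = 0 :=
      Finset.sum_eq_zero fun s hs => by
        simp [hω s ((Finset.mem_range.1 hs).trans_le ht)]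
    simp [noiseSq, this]
  set M := mixtureProcess H σ ρ X ε with hM
  have hville : ENNReal.ofReal δ⁻¹ * P {ω | ∃ t ≤ T, ENNReal.ofReal δ⁻¹ < M t ω} ≤ 1 := by
    refine maximal_inequality (𝓕 := history f X ε) (fun t ht => ?_) (fun t ht s hs => ?_)
      (fun t ht A hA hA0 => ?_) ?_
    · exact measurable_mixtureProcess hk hρ (fun s hs => hB.measurable_action s (hs.trans_le ht))
        (fun s hs => hB.measurable_noise s (hs.trans_le ht))
    · exact measurable_mixtureProcess hk hρ
        (fun r hr => measurable_action_history (hr.le.trans hs))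
        (fun r hr => measurable_noise_history hk (hr.trans_le hs))
    · have hX : ∀ s < t + 1, Measurable[history f X ε t] (X s) := fun s hs =>
        measurable_action_history (Nat.lt_succ_iff.1 hs)
      have hε : ∀ s < t, Measurable[history f X ε t] (ε s) := fun s hs =>
        measurable_noise_history hk hs
      have hMt : Measurable[history f X ε t] (M t) :=
        measurable_mixtureProcess hk hρ (fun s hs => hX s (hs.trans (Nat.lt_succ_self t))) hε
      have h := (hB.subGaussian t ht).lintegral_mul_mixture_le (hB.history_le hk ht) hσ
        (hB.measurable_noise t ht) (measurable_inner_noiseSum (ρ := ρ) hk hX hε)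
        (measurable_sqWidth (ρ := ρ) hk hX) (fun ω => sqWidth_nonneg hρ) (hMt.indicator hA)
      rw [← lintegral_indicator hA0, ← lintegral_indicator hA0]
      refine le_trans (le_of_eq (lintegral_congr fun ω => ?_)) h
      by_cases hω : ω ∈ A
      · rw [Set.indicator_of_mem hω, Set.indicator_of_mem hω, hM, mixtureProcess_succ hρ]
      · rw [Set.indicator_of_notMem hω, Set.indicator_of_notMem hω, zero_mul]
    · have : ∀ ω, M 0 ω = 1 := fun ω => by
        simp [hM, mixtureProcess, regDet_zero, noiseSq, noiseSum]
      simp [this]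
  set bad := {ω | ∃ t ≤ T, ENNReal.ofReal δ⁻¹ < M t ω} with hbad
  set good := {ω | ∀ t ≤ T, √(noiseSq H ρ (fun s => X s ω) (fun s => ε s ω) t) ≤
      σ * √(2 * Real.log (δ⁻¹ * √(regDet (rkhsKer H) ρ (fun i : Fin t => X i ω))))} with hgood
  have hbadle : P.real bad ≤ δ := by
    have h := ENNReal.toReal_mono ENNReal.one_ne_top hville
    rw [ENNReal.toReal_mul, ENNReal.toReal_ofReal (by positivity), ENNReal.toReal_one] at h
    rw [measureReal_def]
    field_simp at h
    exact h
  have hcover : Set.univ ⊆ good ∪ bad := by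
    intro ω _
    by_cases hω : ω ∈ bad
    · exact Or.inr hω
    · refine Or.inl fun t ht => ?_
      have h1 : M t ω ≤ ENNReal.ofReal δ⁻¹ := not_lt.1 fun h => hω ⟨t, ht, h⟩
      rw [hM, mixtureProcess, ENNReal.ofReal_le_ofReal_iff (by positivity)] at h1
      have hd := one_le_regDet (H := H) hρ (fun s => X s ω) t
      have hs : 0 < √(regDet (rkhsKer H) ρ (fun i : Fin t => X i ω)) :=
        Real.sqrt_pos.2 (by linarith)
      rw [inv_mul_le_iff₀ hs, mul_comm √_ δ⁻¹] at h1
      have h2 := (Real.le_log_iff_exp_le (by positivity)).2 h1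
      rw [div_le_iff₀ (by positivity)] at h2
      refine Real.sqrt_le_iff.2 ⟨by positivity, ?_⟩
      have h3 : 0 ≤ noiseSq H ρ (fun s => X s ω) (fun s => ε s ω) t := inner_regInv_nonneg hρ _
      have h4 : 0 ≤ 2 * Real.log (δ⁻¹ * √(regDet (rkhsKer H) ρ (fun i : Fin t => X i ω))) := by
        by_contra hneg
        have : 0 < σ ^ 2 := by positivity
        nlinarith
      rw [mul_pow, Real.sq_sqrt h4]
      linarith
  have h1 : 1 ≤ P.real good + P.real bad := by
    calc (1 : ℝ) = P.real Set.univ := by simp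
      _ ≤ P.real (good ∪ bad) := measureReal_mono hcover
      _ ≤ _ := measureReal_union_le _ _
  linarith

end Confidence

/-! ### Information gain -/

section InfoGain

variable {S : Type*} {H : Type*} [NormedAddCommGroup H] [InnerProductSpace ℝ H] [CompleteSpace H]
  [RKHS ℝ H S ℝ]

/-- A low-dimensional approximation of a feature map bounds the information gain. -/
theorem half_log_regDet_le {E : Type*} [NormedAddCommGroup E] [InnerProductSpace ℝ E]
    {k : S → S → ℝ} {ψ : S → E} (hk : ∀ x y, k x y = inner ℝ (ψ x) (ψ y)) {N : ℕ}
    (W : Submodule ℝ E) [FiniteDimensional ℝ W] (hN : Module.finrank ℝ W ≤ N) {ρ L η : ℝ}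
    (hρ : 0 < ρ) (hL : 0 ≤ L) (hψ : ∀ x, ‖ψ x‖ ^ 2 ≤ L)
    (hW : ∀ x, ∃ w ∈ W, ‖ψ x - w‖ ^ 2 ≤ η) {t : ℕ} (x : Fin t → S) :
    (1 / 2) * Real.log (regDet k ρ x) ≤
      (1 / 2) * (N * Real.log (1 + t * L / ρ) + t * η / ρ) := by
  have h := det_one_add_gram_le (fun i => ψ (x i)) W hN hρ hL (fun i => hψ (x i))
    (fun i => hW (x i))
  have hdet : regDet k ρ x =
      (1 + ρ⁻¹ • Matrix.of (fun i j => inner ℝ (ψ (x i)) (ψ (x j)))).det := by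
    simp only [regDet, hk]
  have hpos : 0 < regDet k ρ x := by
    rw [hdet]
    exact (Matrix.PosDef.one.add_posSemidef
      ((Matrix.posSemidef_gram ℝ fun i => ψ (x i)).smul (inv_nonneg.2 hρ.le))).det_pos
  rw [← hdet] at h
  have hlog := Real.log_le_log hpos h
  have h1 : 0 < 1 + t * L / ρ := by positivity
  rw [Real.log_mul (by positivity) (Real.exp_pos _).ne', Real.log_exp, Real.log_pow] at hlog
  linarith

lemma bddAbove_half_log_regDet {ρ L : ℝ} (hρ : 0 < ρ) (hL : ∀ x y, |rkhsKer H x y| ≤ L)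
    (hL0 : 0 ≤ L) (t : ℕ) :
    BddAbove (Set.range fun x : Fin t → S => (1 / 2) * Real.log (regDet (rkhsKer H) ρ x)) := by
  have hn : ∀ x : S, ‖kerAt H x‖ ^ 2 ≤ L := fun x => by
    rw [norm_kerAt_sq]; exact (le_abs_self _).trans (hL x x)
  refine ⟨_, Set.forall_mem_range.2 fun x => half_log_regDet_le (η := L) rkhsKer_eq_inner
    (⊥ : Submodule ℝ H) (N := 0) (by simp) hρ hL0 hn
    (fun x => ⟨0, Submodule.zero_mem _, by simpa using hn x⟩) x⟩

lemma half_log_regDet_le_infoGain {ρ L : ℝ} (hρ : 0 < ρ) (hL : ∀ x y, |rkhsKer H x y| ≤ L)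
    (hL0 : 0 ≤ L) {t : ℕ} (x : Fin t → S) :
    (1 / 2) * Real.log (regDet (rkhsKer H) ρ x) ≤ infoGain (rkhsKer H) t ρ :=
  le_ciSup (bddAbove_half_log_regDet hρ hL hL0 t) x

end InfoGain

/-! ### The regret bound in terms of the information gain -/

section Regret

variable {S : Type*} {H : Type*} [NormedAddCommGroup H] [InnerProductSpace ℝ H] [CompleteSpace H]
  [RKHS ℝ H S ℝ] {σ D δ ρ L : ℝ} {f : H} {x : ℕ → S} {e : ℕ → ℝ}

lemma regCovOp_eq (ρ : ℝ) (x : ℕ → S) (t : ℕ) :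
    regCovOp H ρ x t = regSum ρ (fun s => kerAt H (x s)) t := rfl

lemma ridge_sub (hρ : 0 < ρ) (t : ℕ) :
    ridge H ρ x (fun s => f (x s) + e s) t - f =
      regInv ρ (fun s => kerAt H (x s)) t (noiseSum H x e t - ρ • f) := by
  have h1 : ∑ s ∈ Finset.range t, (f (x s) + e s) • kerAt H (x s) =
      noiseSum H x e t - ρ • f + regSum ρ (fun s => kerAt H (x s)) t f := by
    rw [regSum_apply, noiseSum]
    simp only [add_smul, Finset.sum_add_distrib, inner_kerAt]
    abel
  rw [ridge, regCovOp_eq, ringInverse_regSum hρ, h1, map_add, regInv_regSum hρ,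
    add_sub_cancel_right]

lemma mem_confSet (hρ : 0 < ρ) (hf : ‖f‖ ≤ D) (t : ℕ)
    (hnoise : √(noiseSq H ρ x e t) ≤
      σ * √(2 * Real.log (δ⁻¹ * √(regDet (rkhsKer H) ρ (fun i : Fin t => x i))))) :
    f ∈ confSet H σ D δ ρ x (fun s => f (x s) + e s) t := by
  rw [confSet]
  split_ifs with ht
  · exact hf
  · rw [Set.mem_ofPred_eq, ridge_sub hρ, regCovOp_eq, regSum_regInv hρ, confRadius]
    refine (sqrt_inner_regInv_sub_le hρ _ _).trans (add_le_add hnoise ?_)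
    refine Real.sqrt_le_iff.2 ⟨by have := norm_nonneg f; have := this.trans hf; positivity, ?_⟩
    refine (inner_regInv_le hρ _).trans ?_
    rw [norm_smul, Real.norm_of_nonneg hρ.le, mul_pow, mul_pow, Real.sq_sqrt hρ.le,
      div_le_iff₀ hρ]
    have : ‖f‖ ^ 2 ≤ D ^ 2 := pow_le_pow_left₀ (norm_nonneg _) hf 2
    nlinarith [mul_pos hρ hρ]

lemma abs_inner_le_confRadius (hρ : 0 < ρ) {y : ℕ → ℝ} {t : ℕ} (ht : t ≠ 0) {g : H}
    (hg : g ∈ confSet H σ D δ ρ x y t) :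
    |inner ℝ (ridge H ρ x y t - g) (kerAt H (x t))| ≤
      confRadius (rkhsKer H) σ D δ ρ x t * √(sqWidth ρ (fun s => kerAt H (x s)) t) := by
  rw [confSet, if_neg ht, Set.mem_ofPred_eq, regCovOp_eq] at hg
  refine le_trans ?_ (mul_le_mul_of_nonneg_right hg (Real.sqrt_nonneg _))
  rw [← Real.sqrt_mul (inner_regSum_nonneg hρ _)]
  exact Real.abs_le_sqrt (inner_sq_le_regSum_mul_regInv hρ _ _)

lemma confRadius_mono (hρ : 0 < ρ) (hσ : 0 ≤ σ) (hδ : 0 < δ) :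
    Monotone fun t => confRadius (rkhsKer H) σ D δ ρ x t := by
  intro s t hst
  have h1 := regDet_mono (H := H) hρ x hst
  have h2 := one_le_regDet (H := H) hρ x s
  simp only [confRadius] at h1 ⊢
  have h3 : 0 < δ⁻¹ * √(regDet (rkhsKer H) ρ (fun i : Fin s => x i)) :=
    mul_pos (inv_pos.2 hδ) (Real.sqrt_pos.2 (by linarith))
  gcongr

/-- Regret of one round in terms of the confidence radius and the width. -/
lemma iSup_sub_le (hρ : 0 < ρ) (hσ : 0 ≤ σ) {t : ℕ}
    (hf : f ∈ confSet H σ D δ ρ x (fun s => f (x s) + e s) t)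
    (hopt : IsOptimistic (confSet H σ D δ ρ x (fun s => f (x s) + e s) t) (x t)) :
    (⨆ z, f z) - f (x t) ≤ 2 * confRadius (rkhsKer H) σ D δ ρ x t *
      √(sqWidth ρ (fun s => kerAt H (x s)) t) := by
  obtain ⟨g, hg, hmax⟩ := hopt
  have : Nonempty S := ⟨x t⟩
  have h1 : (⨆ z, f z) ≤ g (x t) := ciSup_le fun z => hmax f hf z
  have h2 : (⨆ z, f z) - f (x t) ≤ g (x t) - f (x t) := by linarith
  refine h2.trans ?_
  rw [← inner_kerAt, ← inner_kerAt]
  by_cases ht : t = 0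
  · subst ht
    simp only [confSet, if_true, Set.mem_ofPred_eq] at hf hg
    have hw : sqWidth ρ (fun s => kerAt H (x s)) 0 = ρ⁻¹ * ‖kerAt H (x 0)‖ ^ 2 := by
      simp [sqWidth, regInv, inner_smul_right]
    have hsw : √ρ * √(sqWidth ρ (fun s => kerAt H (x s)) 0) = ‖kerAt H (x 0)‖ := by
      rw [← Real.sqrt_mul hρ.le, hw, ← mul_assoc, mul_inv_cancel₀ hρ.ne', one_mul,
        Real.sqrt_sq (norm_nonneg _)]
    have hU : √ρ * D ≤ confRadius (rkhsKer H) σ D δ ρ x 0 :=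
      le_add_of_nonneg_left (by positivity)
    have a1 := real_inner_le_norm (kerAt H (x 0)) g
    have a2 := neg_le_of_abs_le (abs_real_inner_le_norm (kerAt H (x 0)) f)
    calc inner ℝ (kerAt H (x 0)) g - inner ℝ (kerAt H (x 0)) f
        ≤ 2 * (‖kerAt H (x 0)‖ * D) := by nlinarith [norm_nonneg (kerAt H (x 0))]
      _ = 2 * (√ρ * D) * √(sqWidth ρ (fun s => kerAt H (x s)) 0) := by rw [← hsw]; ring
      _ ≤ _ := by gcongr
  · have b1 := abs_inner_le_confRadius hρ ht hf
    have b2 := abs_inner_le_confRadius hρ ht hg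
    rw [inner_sub_left] at b1 b2
    rw [real_inner_comm, real_inner_comm f]
    have := le_of_abs_le b1
    have := neg_le_of_abs_le b2
    linarith

lemma sum_sqWidth_le (hρ : 1 ≤ ρ) (hLρ : L ≤ ρ) (hL : ∀ x y, |rkhsKer H x y| ≤ L) (T : ℕ) :
    ∑ t ∈ Finset.range T, sqWidth ρ (fun s => kerAt H (x s)) t ≤
      2 * Real.log (regDet (rkhsKer H) ρ (fun i : Fin T => x i)) := by
  have hρ0 : 0 < ρ := by linarith
  induction T with
  | zero => simp [regDet_zero]
  | succ T ih =>
    set w := sqWidth ρ (fun s => kerAt H (x s)) T with hw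
    have hw0 : 0 ≤ w := sqWidth_nonneg hρ0
    have hw1 : w ≤ 1 := by
      refine (inner_regInv_le hρ0 _).trans ?_
      rw [norm_kerAt_sq, div_le_one hρ0]
      exact ((le_abs_self _).trans (hL _ _)).trans hLρ
    have hd := one_le_regDet (H := H) hρ0 x T
    rw [Finset.sum_range_succ, regDet_succ hρ0, Real.log_mul (by linarith) (by linarith), mul_add]
    have h1 := Real.one_sub_inv_le_log_of_pos (by linarith : 0 < 1 + w)
    have h2 : w / 2 ≤ 1 - (1 + w)⁻¹ := by
      have : 1 - (1 + w)⁻¹ = w / (1 + w) := by field_simp; ring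
      rw [this]
      exact div_le_div_of_nonneg_left hw0 (by linarith) (by linarith)
    linarith

/-- The constant of the regret bound. -/
def regretConst (σ D δ : ℝ) : ℝ := 4 * (2 * σ + σ * √(2 * Real.log δ⁻¹) + D)

lemma regretConst_pos (hσ : 0 ≤ σ) (hD : 0 < D) : 0 < regretConst σ D δ := by
  unfold regretConst; positivity

lemma sum_regret_le (hσ : 0 ≤ σ) (hD : 0 < D) (hδ : 0 < δ) (hδ1 : δ < 1) (hL0 : 0 < L)
    (hL : ∀ x y, |rkhsKer H x y| ≤ L) (hρ : max 1 L ≤ ρ) {T : ℕ}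
    (hf : ∀ t < T, f ∈ confSet H σ D δ ρ x (fun s => f (x s) + e s) t)
    (hopt : ∀ t < T, IsOptimistic (confSet H σ D δ ρ x (fun s => f (x s) + e s) t) (x t)) :
    ∑ t ∈ Finset.range T, ((⨆ z, f z) - f (x t)) ≤ regretConst σ D δ *
      (infoGain (rkhsKer H) T ρ * √T + √(ρ * infoGain (rkhsKer H) T ρ * T)) := by
  have hρ1 : 1 ≤ ρ := (le_max_left _ _).trans hρ
  have hρ0 : 0 < ρ := by linarith
  have hd := one_le_regDet (H := H) hρ0 x T
  set γ := infoGain (rkhsKer H) T ρ with hγ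
  set U := confRadius (rkhsKer H) σ D δ ρ x T with hU
  set w : ℕ → ℝ := fun t => sqWidth ρ (fun s => kerAt H (x s)) t with hw
  have hlog : (1 / 2) * Real.log (regDet (rkhsKer H) ρ (fun i : Fin T => x i)) ≤ γ :=
    half_log_regDet_le_infoGain hρ0 hL hL0.le _
  have hγ0 : 0 ≤ γ := le_trans (by have := Real.log_nonneg hd; positivity) hlog
  have hδlog : 0 ≤ Real.log δ⁻¹ := Real.log_nonneg (one_le_inv_iff₀.2 ⟨hδ, hδ1.le⟩)
  have hw0 : ∀ t, 0 ≤ w t := fun t => sqWidth_nonneg hρ0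
  have hU0 : 0 ≤ U := by rw [hU, confRadius]; positivity
  have h1 : ∑ t ∈ Finset.range T, ((⨆ z, f z) - f (x t)) ≤
      ∑ t ∈ Finset.range T, 2 * U * √(w t) := by
    refine Finset.sum_le_sum fun t ht => ?_
    have ht' := Finset.mem_range.1 ht
    refine (iSup_sub_le hρ0 hσ (hf t ht') (hopt t ht')).trans ?_
    have : confRadius (rkhsKer H) σ D δ ρ x t ≤ U := confRadius_mono hρ0 hσ hδ ht'.le
    gcongr
  have h2 : ∑ t ∈ Finset.range T, √(w t) ≤ 2 * (√γ * √T) := by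
    have hcs := Finset.sum_mul_sq_le_sq_mul_sq (Finset.range T) (fun t => √(w t)) (fun _ => 1)
    simp only [mul_one, one_pow, Finset.sum_const, Finset.card_range, nsmul_eq_mul,
      Real.sq_sqrt (hw0 _)] at hcs
    have hsum := sum_sqWidth_le (x := x) hρ1 ((le_max_right _ _).trans hρ) hL T
    refine abs_le_of_sq_le_sq' (hcs.trans ?_) (by positivity) |>.2
    rw [mul_pow, mul_pow, Real.sq_sqrt hγ0, Real.sq_sqrt (Nat.cast_nonneg T)]
    have : ∑ t ∈ Finset.range T, w t ≤ 4 * γ := by linarith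
    nlinarith [(Nat.cast_nonneg T : (0 : ℝ) ≤ T)]
  have h3 : U ≤ σ * (√(2 * Real.log δ⁻¹) + √2 * √γ) + √ρ * D := by
    rw [hU, confRadius, Real.log_mul (inv_ne_zero hδ.ne') (Real.sqrt_pos.2 (by linarith)).ne',
      Real.log_sqrt (by linarith)]
    gcongr
    rw [← Real.sqrt_mul (by norm_num)]
    refine Real.sqrt_le_iff.2 ⟨by positivity, ?_⟩
    nlinarith [Real.sq_sqrt (by positivity : 0 ≤ 2 * Real.log δ⁻¹),
      Real.sq_sqrt (by positivity : 0 ≤ 2 * γ),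
      mul_nonneg (Real.sqrt_nonneg (2 * Real.log δ⁻¹)) (Real.sqrt_nonneg (2 * γ))]
  have hsq2 : √2 ≤ 2 := Real.sqrt_le_iff.2 ⟨by norm_num, by norm_num⟩
  have hsqρ : 1 ≤ √ρ := Real.one_le_sqrt.2 hρ1
  have h4 : √(ρ * γ * T) = √ρ * (√γ * √T) := by
    rw [mul_assoc, Real.sqrt_mul hρ0.le, Real.sqrt_mul hγ0]
  have h5 : √γ * √γ = γ := Real.mul_self_sqrt hγ0
  rw [h4]
  calc ∑ t ∈ Finset.range T, ((⨆ z, f z) - f (x t))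
      ≤ 2 * U * ∑ t ∈ Finset.range T, √(w t) := by rw [Finset.mul_sum]; exact h1
    _ ≤ 2 * (σ * (√(2 * Real.log δ⁻¹) + 2 * √γ) + √ρ * D) * (2 * (√γ * √T)) := by
        gcongr
        exact h3.trans (by gcongr)
    _ = 4 * (2 * σ * (√γ * √γ * √T) + (1 * (σ * √(2 * Real.log δ⁻¹)) + √ρ * D) * (√γ * √T)) := by
        ring
    _ ≤ 4 * (2 * σ * (√γ * √γ * √T) +
          (√ρ * (σ * √(2 * Real.log δ⁻¹)) + √ρ * D) * (√γ * √T)) := by gcongr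
    _ ≤ regretConst σ D δ * (γ * √T + √ρ * (√γ * √T)) := by
        rw [h5, regretConst]
        have q1 : 0 ≤ (σ * √(2 * Real.log δ⁻¹) + D) * (γ * √T) := by positivity
        have q2 : 0 ≤ 2 * σ * (√ρ * (√γ * √T)) := by positivity
        linarith

variable [MeasurableSpace S] {Ω : Type*} [MeasurableSpace Ω] {P : Measure Ω}
  [IsProbabilityMeasure P] {X : ℕ → Ω → S} {ε : ℕ → Ω → ℝ} {T : ℕ}

theorem regret_bound (hσ : 0 ≤ σ) (hD : 0 < D) (hδ : 0 < δ) (hδ1 : δ < 1)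
    (hk : Measurable (Function.uncurry (rkhsKer H))) (hL0 : 0 < L)
    (hL : ∀ x y, |rkhsKer H x y| ≤ L) (hρ : max 1 L ≤ ρ) (hB : IsBandit P T σ D f X ε)
    (hG : IsGPUCB P T σ D δ ρ f X ε) :
    1 - δ ≤ P.real {ω | regret f X T ω ≤ regretConst σ D δ *
      (infoGain (rkhsKer H) T ρ * √T + √(ρ * infoGain (rkhsKer H) T ρ * T))} := by
  have hρ0 : 0 < ρ := lt_of_lt_of_le one_pos ((le_max_left _ _).trans hρ)
  refine (hB.noise_bound hk hσ hδ hρ0).trans ?_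
  refine ENNReal.toReal_mono (measure_ne_top _ _) (measure_mono_ae ?_)
  have hall : ∀ᵐ ω ∂P, ∀ t < T, IsOptimistic (confSet H σ D δ ρ (fun s => X s ω)
      (fun s => reward f X ε s ω) t) (X t ω) := by
    rw [ae_all_iff]
    intro t
    by_cases ht : t < T
    · filter_upwards [hG t ht] with ω hω _
      exact hω
    · exact Eventually.of_forall fun ω h => absurd h ht
  filter_upwards [hall] with ω hω hgood
  exact sum_regret_le hσ hD hδ hδ1 hL0 hL hρ
    (fun t ht => mem_confSet hρ0 hB.norm_le t (hgood t ht.le)) hω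

end Regret

/-! ### Regret rates from approximation rates -/

section Rates

variable {S : Type*}

/-- The information gain for a feature map that is approximable at a polynomial rate. -/
theorem infoGain_le_rpow [Nonempty S] {E : Type*} [NormedAddCommGroup E] [InnerProductSpace ℝ E]
    {k : S → S → ℝ} {ψ : S → E} (hk : ∀ x y, k x y = inner ℝ (ψ x) (ψ y)) {N T : ℕ}
    (W : Submodule ℝ E) [FiniteDimensional ℝ W] (hN : Module.finrank ℝ W ≤ N)
    {ρ L η a c₁ c₃ c₄ : ℝ} (hL : 0 ≤ L) (hψ : ∀ x, ‖ψ x‖ ^ 2 ≤ L)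
    (hW : ∀ x, ∃ w ∈ W, ‖ψ x - w‖ ^ 2 ≤ η) (hT : 1 ≤ T) (hρ : 1 ≤ ρ) (hc₁ : 0 < c₁)
    (hc₁ρ : c₁ * (T : ℝ) ^ a ≤ ρ) (hN' : (N : ℝ) ≤ c₃ * (T : ℝ) ^ a) (hc₄ : 0 ≤ c₄)
    (hη : η ≤ c₄ * (T : ℝ) ^ (2 * a - 1)) :
    infoGain k T ρ ≤
      (1 / 2) * (c₃ * (1 + L) + c₄ / c₁) * (T : ℝ) ^ a * (1 + Real.log T) := by
  have hρ0 : 0 < ρ := by linarith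
  have hT' : (1 : ℝ) ≤ T := by exact_mod_cast hT
  have hT0 : (0 : ℝ) < T := by linarith
  have hlogT : 0 ≤ Real.log T := Real.log_nonneg hT'
  have hTa : 0 < (T : ℝ) ^ a := Real.rpow_pos_of_pos hT0 a
  refine ciSup_le fun x => (half_log_regDet_le hk W hN hρ0 hL hψ hW x).trans ?_
  have h1 : Real.log (1 + T * L / ρ) ≤ (1 + L) * (1 + Real.log T) := by
    have hle : 1 + T * L / ρ ≤ (1 + L) * T := by
      have : T * L / ρ ≤ T * L := div_le_self (by positivity) hρ
      nlinarith
    have h := Real.log_le_log (by positivity) hle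
    rw [Real.log_mul (by positivity) hT0.ne'] at h
    have h2 := Real.log_le_sub_one_of_pos (by linarith : 0 < 1 + L)
    nlinarith
  have h2 : T * η / ρ ≤ c₄ / c₁ * (T : ℝ) ^ a * (1 + Real.log T) := by
    rw [div_le_iff₀ hρ0]
    calc T * η ≤ T * (c₄ * (T : ℝ) ^ (2 * a - 1)) := by gcongr
      _ = c₄ * (T : ℝ) ^ a * (T : ℝ) ^ a := by
          rw [Real.rpow_sub_one hT0.ne', two_mul, Real.rpow_add hT0]
          field_simp
      _ = c₄ / c₁ * (T : ℝ) ^ a * 1 * (c₁ * (T : ℝ) ^ a) := by field_simp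
      _ ≤ c₄ / c₁ * (T : ℝ) ^ a * (1 + Real.log T) * ρ := by
          gcongr
          linarith
  have h3 : N * Real.log (1 + T * L / ρ) ≤ c₃ * (T : ℝ) ^ a * ((1 + L) * (1 + Real.log T)) := by
    have h0 : 0 ≤ c₃ * (T : ℝ) ^ a := (Nat.cast_nonneg N).trans hN'
    refine mul_le_mul hN' h1 (Real.log_nonneg ?_) h0
    have : 0 ≤ T * L / ρ := by positivity
    linarith
  linarith

variable {H : Type*} [NormedAddCommGroup H] [InnerProductSpace ℝ H] [CompleteSpace H]
  [RKHS ℝ H S ℝ] [MeasurableSpace S] {Ω : Type*} [MeasurableSpace Ω] {P : Measure Ω}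
  [IsProbabilityMeasure P] {f : H} {X : ℕ → Ω → S} {ε : ℕ → Ω → ℝ} {T : ℕ} {σ D δ ρ L : ℝ}

theorem regret_bound_rpow (hσ : 0 ≤ σ) (hD : 0 < D) (hδ : 0 < δ) (hδ1 : δ < 1)
    (hk : Measurable (Function.uncurry (rkhsKer H))) (hL0 : 0 < L)
    (hL : ∀ x y, |rkhsKer H x y| ≤ L) (hρ : max 1 L ≤ ρ) (hB : IsBandit P T σ D f X ε)
    (hG : IsGPUCB P T σ D δ ρ f X ε) (hT : 1 ≤ T) {a c₂ G : ℝ} (hc₂ : 0 < c₂) (hG0 : 0 < G)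
    (hρc : ρ ≤ c₂ * (T : ℝ) ^ a)
    (hγ : infoGain (rkhsKer H) T ρ ≤ G * (T : ℝ) ^ a * (1 + Real.log T)) :
    1 - δ ≤ P.real {ω | regret f X T ω ≤
      regretConst σ D δ * (G + √(c₂ * G)) * (T : ℝ) ^ (a + 1 / 2) * (1 + Real.log T) ^ 1} := by
  refine (regret_bound hσ hD hδ hδ1 hk hL0 hL hρ hB hG).trans ?_
  refine measureReal_mono fun ω hω => ?_
  rw [Set.mem_ofPred_eq] at hω ⊢
  refine hω.trans ?_
  have hK := regretConst_pos (δ := δ) hσ hD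
  have hρ0 : 0 < ρ := lt_of_lt_of_le one_pos ((le_max_left _ _).trans hρ)
  have hT' : (1 : ℝ) ≤ T := by exact_mod_cast hT
  have hT0 : (0 : ℝ) < T := by linarith
  set l := 1 + Real.log T with hl
  have hl1 : 1 ≤ l := by have := Real.log_nonneg hT'; linarith
  have hTa : 0 < (T : ℝ) ^ a := Real.rpow_pos_of_pos hT0 a
  have h1 : √(ρ * infoGain (rkhsKer H) T ρ * T) ≤ √(c₂ * G) * ((T : ℝ) ^ a * √T * l) := by
    refine Real.sqrt_le_iff.2 ⟨by positivity, ?_⟩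
    rw [mul_pow, mul_pow, mul_pow, Real.sq_sqrt (by positivity), Real.sq_sqrt hT0.le]
    calc ρ * infoGain (rkhsKer H) T ρ * T ≤ ρ * (G * (T : ℝ) ^ a * l) * T := by gcongr
      _ ≤ (c₂ * (T : ℝ) ^ a) * (G * (T : ℝ) ^ a * l) * T := by gcongr
      _ = c₂ * G * (((T : ℝ) ^ a) ^ 2 * T * l) := by ring
      _ ≤ c₂ * G * (((T : ℝ) ^ a) ^ 2 * T * l ^ 2) := by
          gcongr
          nlinarith
  have h2 : infoGain (rkhsKer H) T ρ * √T ≤ G * ((T : ℝ) ^ a * √T * l) := by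
    calc infoGain (rkhsKer H) T ρ * √T ≤ (G * (T : ℝ) ^ a * l) * √T := by gcongr
      _ = _ := by ring
  calc regretConst σ D δ * (infoGain (rkhsKer H) T ρ * √T + √(ρ * infoGain (rkhsKer H) T ρ * T))
      ≤ regretConst σ D δ *
          (G * ((T : ℝ) ^ a * √T * l) + √(c₂ * G) * ((T : ℝ) ^ a * √T * l)) := by gcongr
    _ = _ := by rw [Real.rpow_add hT0, ← Real.sqrt_eq_rpow]; ring

omit [MeasurableSpace S] [MeasurableSpace Ω] in
lemma regret_le_linear (hL : ∀ x y, |rkhsKer H x y| ≤ L) (hf : ‖f‖ ≤ D) (T : ℕ) (ω : Ω) :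
    regret f X T ω ≤ 2 * √L * D * T := by
  have hle : ∀ x, |f x| ≤ √L * D := fun x => (abs_apply_le hL f x).trans (by gcongr)
  rw [regret]
  calc ∑ t ∈ Finset.range T, ((⨆ x : S, f x) - f (X t ω))
      ≤ ∑ _t ∈ Finset.range T, 2 * √L * D := by
        refine Finset.sum_le_sum fun t _ => ?_
        have : Nonempty S := ⟨X t ω⟩
        have h1 : (⨆ x : S, f x) ≤ √L * D := ciSup_le fun x => le_of_abs_le (hle x)
        have h2 := neg_le_of_abs_le (hle (X t ω))
        linarith
    _ = 2 * √L * D * T := by simp; ring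

lemma tendsto_rpow_mul_log_div {e A : ℝ} (he : e < 1) (p : ℕ) :
    Tendsto (fun T : ℕ => A * (T : ℝ) ^ e * (1 + Real.log T) ^ p / T) atTop (𝓝 0) := by
  have hs : 0 < 1 - e := by linarith
  have h1 : (fun x : ℝ => (1 + Real.log x) ^ p) =o[atTop] fun x => x ^ (1 - e) := by
    have hlog : (fun x : ℝ => 1 + Real.log x) =O[atTop] fun x => Real.log x := by
      refine Asymptotics.IsBigO.add ?_ (Asymptotics.isBigO_refl _ _)
      refine Asymptotics.IsBigO.of_bound 1 ?_
      filter_upwards [eventually_ge_atTop (Real.exp 1)] with x hx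
      have : 1 ≤ Real.log x := (Real.le_log_iff_exp_le ((Real.exp_pos 1).trans_le hx)).2 hx
      rw [norm_one, one_mul, Real.norm_of_nonneg (by linarith)]
      exact this
    refine (hlog.pow p).trans_isLittleO ?_
    simpa using isLittleO_log_rpow_rpow_atTop (s := 1 - e) (p : ℝ) hs
  have h2 := (h1.tendsto_div_nhds_zero.comp tendsto_natCast_atTop_atTop).const_mul A
  rw [mul_zero] at h2
  refine h2.congr' ?_
  filter_upwards [eventually_gt_atTop 0] with T hT
  have hT0 : (0 : ℝ) < T := by exact_mod_cast hT
  simp only [Function.comp]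
  rw [Real.rpow_sub hT0, Real.rpow_one]
  have := Real.rpow_pos_of_pos hT0 e
  field_simp

end Rates

/-! ### Mercer expansion -/

section Mercer

variable {S : Type*} [MeasureSpace S] [IsFiniteMeasure (volume : Measure S)]
  {H : Type*} [NormedAddCommGroup H] [InnerProductSpace ℝ H] [CompleteSpace H] [RKHS ℝ H S ℝ]
  {L : ℝ} {μ : ℕ → ℝ} {φ : ℕ → S → ℝ}

lemma memLp_coe (hk : Measurable (Function.uncurry (rkhsKer H)))
    (hL : ∀ x y, |rkhsKer H x y| ≤ L) (f : H) : MemLp (f : S → ℝ) 2 volume :=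
  MemLp.of_bound (measurable_coe hk f).aestronglyMeasurable (√L * ‖f‖)
    (Eventually.of_forall fun x => abs_apply_le hL f x)

/-- `T_k g` belongs to the reproducing kernel Hilbert space and represents `h ↦ ∫ g h`. -/
lemma exists_inner_eq_integral (hk : Measurable (Function.uncurry (rkhsKer H)))
    (hL : ∀ x y, |rkhsKer H x y| ≤ L) {g : S → ℝ} (hg : MemLp g 2 volume) :
    ∃ r : H, (∀ h : H, inner ℝ r h = ∫ y, g y * h y) ∧ ∀ x, r x = kerOp (rkhsKer H) g x := by
  have hg1 : Integrable g volume := hg.integrable (by norm_num)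
  have hint : ∀ h : H, Integrable (fun y => g y * h y) volume := fun h =>
    hg.integrable_mul (memLp_coe hk hL h)
  let ℓ : H →ₗ[ℝ] ℝ :=
    { toFun := fun h => ∫ y, g y * h y
      map_add' := fun h h' => by
        simp only [RKHS.coe_add, Pi.add_apply, mul_add]
        exact integral_add (hint h) (hint h')
      map_smul' := fun c h => by
        simp only [RKHS.coe_smul, Pi.smul_apply, smul_eq_mul, mul_left_comm _ c, RingHom.id_apply]
        exact integral_const_mul _ _ }
  have hbound : ∀ h, ‖ℓ h‖ ≤ ((∫ y, ‖g y‖) * √L) * ‖h‖ := by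
    intro h
    refine (norm_integral_le_integral_norm _).trans ?_
    rw [mul_assoc, ← integral_mul_const]
    refine integral_mono (hint h).norm (hg1.norm.mul_const _) fun y => ?_
    simp only [norm_mul]
    exact mul_le_mul_of_nonneg_left (abs_apply_le hL h y) (norm_nonneg _)
  have hinner : ∀ h : H, inner ℝ ((InnerProductSpace.toDual ℝ H).symm (ℓ.mkContinuous _ hbound)) h =
      ∫ y, g y * h y := fun h => by
    rw [InnerProductSpace.toDual_symm_apply]; rfl
  refine ⟨_, hinner, fun x => ?_⟩
  rw [← inner_kerAt, real_inner_comm, hinner, kerOp]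
  refine integral_congr_ae (Eventually.of_forall fun y => ?_)
  simp only
  rw [← rkhsKer_eq_apply, rkhsKer_comm, mul_comm]

/-- The eigenfunctions, scaled by `√μ_n`, form an orthonormal basis of the reproducing kernel
Hilbert space. -/
theorem exists_hilbertBasis (hk : Measurable (Function.uncurry (rkhsKer H)))
    (hL : ∀ x y, |rkhsKer H x y| ≤ L) (hae : AEDetermined (S := S) H)
    (hE : IsEigensystem (rkhsKer H) μ φ) :
    ∃ b : HilbertBasis {n // μ n ≠ 0} ℝ H, ∀ n x, b n x = √(μ n) * φ n x := by
  have hex : ∀ n : {n // μ n ≠ 0}, ∃ q : H, (∀ h : H, inner ℝ q h = (μ n)⁻¹ * ∫ y, φ n y * h y) ∧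
      ∀ x, q x = φ n x := by
    rintro ⟨n, hn⟩
    obtain ⟨r, hr, hrx⟩ := exists_inner_eq_integral hk hL (hE.memLp n hn)
    refine ⟨(μ n)⁻¹ • r, fun h => by rw [inner_smul_left, hr]; rfl, fun x => ?_⟩
    rw [RKHS.coe_smul, Pi.smul_apply, hrx, hE.eigen n hn, smul_eq_mul, inv_mul_cancel_left₀ hn]
  choose q hq hqx using hex
  have hpos : ∀ n : {n // μ n ≠ 0}, 0 < μ n := fun n => (hE.nonneg n).lt_of_ne n.2.symm
  set e : {n // μ n ≠ 0} → H := fun n => √(μ n) • q n with he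
  have hon : Orthonormal ℝ e := by
    rw [orthonormal_iff_ite]
    intro i j
    simp only [he, inner_smul_left, inner_smul_right, hq, hqx, hE.orthonormal i j i.2 j.2,
      conj_trivial, Subtype.ext_iff]
    split_ifs with hij
    · rw [hij]
      have := j.2
      field_simp
      exact Real.sq_sqrt (hpos j).le
    · ring
  have hcomplete : (Submodule.span ℝ (Set.range e))ᗮ = ⊥ := by
    refine (Submodule.eq_bot_iff _).2 fun h hh => ?_
    have horth : ∀ n, μ n ≠ 0 → ∫ x, φ n x * h x = 0 := by
      intro n hn
      have h0 := Submodule.inner_right_of_mem_orthogonal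
        (Submodule.subset_span (Set.mem_range_self (⟨n, hn⟩ : {n // μ n ≠ 0}))) hh
      simp only [he, inner_smul_left, hq, conj_trivial] at h0
      have h1 := hpos ⟨n, hn⟩
      have h2 : √(μ n) ≠ 0 := (Real.sqrt_pos.2 h1).ne'
      have h3 : (μ n)⁻¹ ≠ 0 := inv_ne_zero hn
      simpa [h2, h3, hn] using h0
    have hTk := hE.complete h (memLp_coe hk hL h) horth
    obtain ⟨r, hr, hrx⟩ := exists_inner_eq_integral hk hL (memLp_coe hk hL h)
    have hr0 : (r : S → ℝ) =ᵐ[volume] 0 := by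
      filter_upwards [hTk] with x hx
      rw [hrx, hx]
    have hr0' : r = 0 := hae r hr0
    have hint : ∫ y, h y * h y = 0 := by rw [← hr h, hr0', inner_zero_left]
    have hii : Integrable (fun y => h y * h y) volume :=
      (memLp_coe hk hL h).integrable_mul (memLp_coe hk hL h)
    refine hae h ?_
    filter_upwards [(integral_eq_zero_iff_of_nonneg (fun y => mul_self_nonneg (h y)) hii).1 hint]
      with y hy
    exact mul_self_eq_zero.1 hy
  refine ⟨HilbertBasis.mkOfOrthogonalEqBot hon hcomplete, fun n x => ?_⟩
  rw [HilbertBasis.coe_mkOfOrthogonalEqBot]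
  simp only [he, RKHS.coe_smul, Pi.smul_apply, smul_eq_mul, hqx]

/-- The kernel functions are approximated by the span of the first `N` eigenfunctions. -/
theorem exists_submodule_of_eigensystem (hk : Measurable (Function.uncurry (rkhsKer H)))
    (hL : ∀ x y, |rkhsKer H x y| ≤ L) (hae : AEDetermined (S := S) H)
    (hE : IsEigensystem (rkhsKer H) μ φ) {B : ℝ} (hB : EigenfunctionsBounded μ φ B) (N : ℕ)
    {τ : ℕ → ℝ} (hτ0 : ∀ n, 0 ≤ τ n) (hτ : Summable τ) (hμτ : ∀ n, N ≤ n → μ n ≤ τ n) :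
    ∃ (W : Submodule ℝ H) (_ : FiniteDimensional ℝ W), Module.finrank ℝ W ≤ N ∧
      ∀ x : S, ∃ w ∈ W, ‖kerAt H x - w‖ ^ 2 ≤ B ^ 2 * ∑' n, τ n := by
  classical
  obtain ⟨b, hb⟩ := exists_hilbertBasis hk hL hae hE
  set c : Fin N → H := fun n => if h : μ n ≠ 0 then b ⟨n, h⟩ else 0 with hc
  have hfin : FiniteDimensional ℝ (Submodule.span ℝ (Set.range c)) :=
    FiniteDimensional.span_of_finite ℝ (Set.finite_range c)
  refine ⟨Submodule.span ℝ (Set.range c), hfin, ?_, fun x => ?_⟩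
  · simpa [Set.finrank] using finrank_range_le_card (R := ℝ) c
  set W := Submodule.span ℝ (Set.range c) with hW
  set r := kerAt H x - W.starProjection (kerAt H x) with hr
  refine ⟨W.starProjection (kerAt H x), W.starProjection_apply_mem _, ?_⟩
  have hlow : ∀ n : {n // μ n ≠ 0}, (n : ℕ) < N → inner ℝ (b n) r = 0 := by
    intro n hn
    refine Submodule.inner_right_of_mem_orthogonal (K := W) ?_
      (W.sub_starProjection_mem_orthogonal _)
    refine Submodule.subset_span ⟨⟨n, hn⟩, ?_⟩
    simp [hc, n.2]
  have hhigh : ∀ n : {n // μ n ≠ 0}, N ≤ (n : ℕ) → inner ℝ (b n) r = b n x := by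
    intro n hn
    have hmem : b n ∈ Wᗮ := by
      rw [hW, Submodule.mem_orthogonal]
      intro u hu
      refine Submodule.span_induction ?_ ?_ ?_ ?_ hu
      · rintro _ ⟨m, rfl⟩
        simp only [hc]
        split_ifs with hm
        · exact b.orthonormal.2 fun heq => by
            have := congrArg Subtype.val heq
            simp only at this
            omega
        · exact inner_zero_left _
      · exact inner_zero_left _
      · intro u u' _ _ hu hu'
        rw [inner_add_left, hu, hu', add_zero]
      · intro a u _ hu
        rw [inner_smul_left, hu, mul_zero]
    rw [hr, inner_sub_right, Submodule.inner_left_of_mem_orthogonal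
      (W.starProjection_apply_mem _) hmem, sub_zero, real_inner_comm, inner_kerAt]
  have hsum := b.hasSum_inner_mul_inner r r
  rw [real_inner_self_eq_norm_sq] at hsum
  have hterm : ∀ n : {n // μ n ≠ 0}, inner ℝ r (b n) * inner ℝ (b n) r ≤ B ^ 2 * τ n := by
    intro n
    rw [real_inner_comm]
    rcases lt_or_ge (n : ℕ) N with hn | hn
    · rw [hlow n hn, mul_zero]
      exact mul_nonneg (sq_nonneg _) (hτ0 _)
    · rw [hhigh n hn, hb]
      have h1 : |φ n x| ^ 2 ≤ B ^ 2 := pow_le_pow_left₀ (abs_nonneg _) (hB n n.2 x) 2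
      rw [sq_abs] at h1
      calc √(μ n) * φ n x * (√(μ n) * φ n x) = (√(μ n) * √(μ n)) * φ n x ^ 2 := by ring
        _ = μ n * φ n x ^ 2 := by rw [Real.mul_self_sqrt (hE.nonneg n)]
        _ ≤ τ n * B ^ 2 := mul_le_mul (hμτ n hn) h1 (sq_nonneg _) (hτ0 _)
        _ = _ := mul_comm _ _
  have hinj : Function.Injective (Subtype.val : {n // μ n ≠ 0} → ℕ) := Subtype.val_injective
  calc ‖r‖ ^ 2 = ∑' n, inner ℝ r (b n) * inner ℝ (b n) r := hsum.tsum_eq.symm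
    _ ≤ ∑' n : {n // μ n ≠ 0}, B ^ 2 * τ n :=
        hsum.summable.tsum_le_tsum hterm ((hτ.comp_injective hinj).mul_left _)
    _ = B ^ 2 * ∑' n : {n // μ n ≠ 0}, τ n := tsum_mul_left
    _ ≤ B ^ 2 * ∑' n, τ n := by
        gcongr
        exact tsum_comp_le_tsum_of_inj hτ hτ0 hinj

end Mercer

/-! ### Tails of power series of exponents -/

section Tail

lemma rpow_neg_le_sub {β : ℝ} (hβ : 1 < β) {n : ℕ} (hn : 1 ≤ n) :
    (β - 1) * ((n : ℝ) + 1) ^ (-β) ≤ (n : ℝ) ^ (1 - β) - ((n : ℝ) + 1) ^ (1 - β) := by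
  have hn0 : (0 : ℝ) < n := by exact_mod_cast hn
  have hn1 : (0 : ℝ) < (n : ℝ) + 1 := by linarith
  set y : ℝ := (n : ℝ) / (n + 1) with hy
  have hy0 : 0 < y := by positivity
  have h1 : (n : ℝ) ^ (1 - β) = y ^ (1 - β) * ((n : ℝ) + 1) ^ (1 - β) := by
    rw [← Real.mul_rpow hy0.le hn1.le, hy, div_mul_cancel₀ _ hn1.ne']
  have h2 : ((n : ℝ) + 1) ^ (-β) = ((n : ℝ) + 1)⁻¹ * ((n : ℝ) + 1) ^ (1 - β) := by
    rw [← Real.rpow_neg_one, ← Real.rpow_add hn1]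
    congr 1; ring
  have h3 : 1 + (β - 1) * ((n : ℝ) + 1)⁻¹ ≤ y ^ (1 - β) := by
    rw [Real.rpow_def_of_pos hy0]
    have hlog : Real.log y ≤ -((n : ℝ) + 1)⁻¹ := by
      refine (Real.log_le_sub_one_of_pos hy0).trans (le_of_eq ?_)
      rw [hy]; field_simp; ring
    have := Real.add_one_le_exp (Real.log y * (1 - β))
    nlinarith
  rw [h1, h2]
  have h4 : 0 < ((n : ℝ) + 1) ^ (1 - β) := Real.rpow_pos_of_pos hn1 _
  nlinarith

/-- The tail sequence `(n + 1)^(-β)`, `n ≥ N`. -/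
def powTail (β : ℝ) (N n : ℕ) : ℝ := if n < N then 0 else ((n : ℝ) + 1) ^ (-β)

lemma powTail_nonneg (β : ℝ) (N n : ℕ) : 0 ≤ powTail β N n := by
  unfold powTail
  split_ifs
  · exact le_rfl
  · positivity

lemma sum_powTail_le {β : ℝ} (hβ : 1 < β) {N : ℕ} (hN : 1 ≤ N) (M : ℕ) :
    ∑ n ∈ Finset.range M, powTail β N n ≤ (N : ℝ) ^ (1 - β) / (β - 1) := by
  have hβ0 : 0 < β - 1 := by linarith
  suffices h : ∑ n ∈ Finset.range M, powTail β N n + ((max M N : ℕ) : ℝ) ^ (1 - β) / (β - 1) ≤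
      (N : ℝ) ^ (1 - β) / (β - 1) by
    have : 0 ≤ ((max M N : ℕ) : ℝ) ^ (1 - β) / (β - 1) := by positivity
    linarith
  induction M with
  | zero => simp
  | succ M ih =>
    rw [Finset.sum_range_succ]
    rcases lt_or_ge M N with h | h
    · rw [max_eq_right h, powTail, if_pos h, add_zero]
      rwa [max_eq_right h.le] at ih
    · rw [max_eq_left (h.trans M.le_succ), powTail, if_neg (not_lt.2 h)]
      rw [max_eq_left h] at ih
      have h1 := rpow_neg_le_sub hβ (hN.trans h)
      have h2 : ((M : ℝ) + 1) ^ (-β) + ((M + 1 : ℕ) : ℝ) ^ (1 - β) / (β - 1) ≤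
          (M : ℝ) ^ (1 - β) / (β - 1) := by
        push_cast
        rw [← sub_nonneg] at h1 ⊢
        have : (M : ℝ) ^ (1 - β) / (β - 1) -
            (((M : ℝ) + 1) ^ (-β) + ((M : ℝ) + 1) ^ (1 - β) / (β - 1)) =
            ((M : ℝ) ^ (1 - β) - ((M : ℝ) + 1) ^ (1 - β) - (β - 1) * ((M : ℝ) + 1) ^ (-β)) /
              (β - 1) := by field_simp; ring
        rw [this]
        positivity
      linarith

lemma summable_powTail {β : ℝ} (hβ : 1 < β) {N : ℕ} (hN : 1 ≤ N) : Summable (powTail β N) :=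
  summable_of_sum_range_le (powTail_nonneg β N) (sum_powTail_le hβ hN)

lemma tsum_powTail_le {β : ℝ} (hβ : 1 < β) {N : ℕ} (hN : 1 ≤ N) :
    ∑' n, powTail β N n ≤ (N : ℝ) ^ (1 - β) / (β - 1) :=
  Real.tsum_le_of_sum_range_le (powTail_nonneg β N) (sum_powTail_le hβ hN)

end Tail

/-- The information gain of a kernel with polynomial eigendecay. -/
theorem infoGain_le_of_polyEigendecay {S : Type*} [MeasureSpace S]
    [IsFiniteMeasure (volume : Measure S)] [Nonempty S] {H : Type*} [NormedAddCommGroup H]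
    [InnerProductSpace ℝ H] [CompleteSpace H] [RKHS ℝ H S ℝ] {L B C β c₁ ρ : ℝ} {μ : ℕ → ℝ}
    {φ : ℕ → S → ℝ} (hk : Measurable (Function.uncurry (rkhsKer H))) (hL0 : 0 < L)
    (hL : ∀ x y, |rkhsKer H x y| ≤ L) (hae : AEDetermined (S := S) H)
    (hE : IsEigensystem (rkhsKer H) μ φ) (hB : EigenfunctionsBounded μ φ B) (hC : 0 < C)
    (hβ : 1 < β) (hμ : PolyEigendecay μ C β) {T : ℕ} (hT : 1 ≤ T) (hρ : 1 ≤ ρ) (hc₁ : 0 < c₁)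
    (hc₁ρ : c₁ * (T : ℝ) ^ (1 / (1 + β)) ≤ ρ) :
    infoGain (rkhsKer H) T ρ ≤ (1 / 2) * (2 * (1 + L) + B ^ 2 * (C * (1 / (β - 1))) / c₁) *
      (T : ℝ) ^ (1 / (1 + β)) * (1 + Real.log T) := by
  have hT' : (1 : ℝ) ≤ T := by exact_mod_cast hT
  have hT0 : (0 : ℝ) < T := by linarith
  have hβ0 : 0 < β - 1 := by linarith
  set a : ℝ := 1 / (1 + β) with ha
  have ha0 : 0 < a := by positivity
  have hTa1 : 1 ≤ (T : ℝ) ^ a := Real.one_le_rpow hT' ha0.le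
  set N := ⌈(T : ℝ) ^ a⌉₊ with hN
  have hN1 : (T : ℝ) ^ a ≤ N := Nat.le_ceil _
  have hN2 : (N : ℝ) ≤ 2 * (T : ℝ) ^ a := by
    have := Nat.ceil_lt_add_one (zero_le_one.trans hTa1)
    linarith
  have hNpos : 1 ≤ N := by
    have : (1 : ℝ) ≤ N := hTa1.trans hN1
    exact_mod_cast this
  have hn : ∀ x : S, ‖kerAt H x‖ ^ 2 ≤ L := fun x => by
    rw [norm_kerAt_sq]; exact (le_abs_self _).trans (hL x x)
  obtain ⟨W, _, hWN, hW⟩ := exists_submodule_of_eigensystem hk hL hae hE hB N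
    (τ := fun n => C * powTail β N n) (fun n => mul_nonneg hC.le (powTail_nonneg _ _ _))
    ((summable_powTail hβ hNpos).mul_left C)
    (fun n hn => by
      simp only [powTail, if_neg (not_lt.2 hn)]
      exact hμ n)
  refine infoGain_le_rpow rkhsKer_eq_inner W hWN hL0.le hn hW hT hρ hc₁ hc₁ρ hN2
    (by positivity) ?_
  rw [tsum_mul_left, mul_assoc, mul_assoc]
  refine mul_le_mul_of_nonneg_left (mul_le_mul_of_nonneg_left ?_ hC.le) (sq_nonneg B)
  refine (tsum_powTail_le hβ hNpos).trans ?_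
  rw [div_eq_mul_one_div, mul_comm]
  refine mul_le_mul_of_nonneg_left ?_ (by positivity)
  have he : 2 * a - 1 = a * (1 - β) := by rw [ha]; field_simp; ring
  rw [he, Real.rpow_mul hT0.le]
  exact Real.rpow_le_rpow_of_nonpos (by linarith) hN1 (by linarith)

/-! ### Matérn kernels as mixtures of Gaussian kernels -/

section Matern

lemma integrable_exp_sub_exp {ν : ℝ} (hν : 0 < ν) :
    Integrable fun s : ℝ => Real.exp (ν * s - Real.exp s) := by
  have h := integrableOn_image_iff_integrableOn_abs_deriv_smul (s := Set.univ) MeasurableSet.univ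
    (fun x _ => (Real.hasDerivAt_exp x).hasDerivWithinAt) Real.exp_injective.injOn
    (fun x => Real.exp (-x) * x ^ (ν - 1))
  rw [Set.image_univ, Real.range_exp, integrableOn_univ] at h
  refine (h.1 (Real.GammaIntegral_convergent hν)).congr (Eventually.of_forall fun s => ?_)
  simp only [smul_eq_mul, abs_of_pos (Real.exp_pos s)]
  rw [← Real.exp_mul, ← Real.exp_add, ← Real.exp_add]
  congr 1; ring

lemma integral_exp_sub_exp {ν : ℝ} (hν : 0 < ν) :
    ∫ s : ℝ, Real.exp (ν * s - Real.exp s) = Real.Gamma ν := by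
  have h := integral_image_eq_integral_abs_deriv_smul (s := Set.univ) MeasurableSet.univ
    (fun x _ => (Real.hasDerivAt_exp x).hasDerivWithinAt) Real.exp_injective.injOn
    (fun x => Real.exp (-x) * x ^ (ν - 1))
  rw [Set.image_univ, Real.range_exp, setIntegral_univ] at h
  rw [Real.Gamma_eq_integral hν, h]
  refine integral_congr_ae (Eventually.of_forall fun s => ?_)
  simp only [smul_eq_mul, abs_of_pos (Real.exp_pos s)]
  rw [← Real.exp_mul, ← Real.exp_add, ← Real.exp_add]
  congr 1; ring

lemma integrable_exp_sub_exp_mul {ν : ℝ} (hν : 0 < ν) {c : ℝ} (hc : 0 ≤ c) :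
    Integrable fun s : ℝ => Real.exp (ν * s - Real.exp s) * Real.exp (-(c * Real.exp (-s))) := by
  refine (integrable_exp_sub_exp hν).mul_bdd (c := 1) (by fun_prop)
    (Eventually.of_forall fun s => ?_)
  rw [Real.norm_of_nonneg (Real.exp_pos _).le, Real.exp_le_one_iff]
  have : 0 ≤ c * Real.exp (-s) := by positivity
  linarith

/-- Gamma mixture representation of the modified Bessel function of the second kind. -/
lemma rpow_mul_besselK {ν z : ℝ} (hν : 0 < ν) (hz : 0 < z) :
    z ^ ν * besselK ν z = 2 ^ (ν - 1) * ∫ s : ℝ, Real.exp (ν * s - Real.exp s) *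
      Real.exp (-(z ^ 2 / 4 * Real.exp (-s))) := by
  set F : ℝ → ℝ := fun s => Real.exp (ν * s - Real.exp s) *
      Real.exp (-(z ^ 2 / 4 * Real.exp (-s))) with hF
  set G : ℝ → ℝ := fun t => Real.exp (ν * t - z * Real.cosh t) with hG
  have hz2 : 0 < z / 2 := by positivity
  have hFi : Integrable F := integrable_exp_sub_exp_mul hν (by positivity)
  have hshift : ∀ t, F (t + Real.log (z / 2)) = (z / 2) ^ ν * G t := by
    intro t
    simp only [hF, hG]
    rw [neg_add, Real.exp_add t, Real.exp_add (-t), Real.exp_neg (Real.log _), Real.exp_log hz2,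
      Real.rpow_def_of_pos hz2, ← Real.exp_add, ← Real.exp_add, Real.cosh_eq]
    congr 1
    field_simp
    ring
  have hGi : Integrable G := by
    have h1 : Integrable fun t => F (t + Real.log (z / 2)) := hFi.comp_add_right _
    simp only [hshift] at h1
    have hne : (z / 2) ^ ν ≠ 0 := (Real.rpow_pos_of_pos hz2 ν).ne'
    refine (h1.const_mul ((z / 2) ^ ν)⁻¹).congr (Eventually.of_forall fun t => ?_)
    simp only
    rw [inv_mul_cancel_left₀ hne]
  have h1 : ∫ s, F s = (z / 2) ^ ν * ∫ t, G t := by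
    rw [← integral_add_right_eq_self F (Real.log (z / 2)), ← integral_const_mul]
    exact integral_congr_ae (Eventually.of_forall hshift)
  have h2 : ∫ t, G t = 2 * besselK ν z := by
    have hneg := integral_comp_neg_Ioi 0 G
    rw [neg_zero] at hneg
    rw [← intervalIntegral.integral_Iic_add_Ioi (b := 0) hGi.integrableOn hGi.integrableOn, ← hneg,
      ← integral_add hGi.comp_neg.integrableOn hGi.integrableOn, besselK, ← integral_const_mul]
    refine integral_congr_ae (Eventually.of_forall fun t => ?_)
    simp only [hG, Real.cosh_neg]
    rw [Real.cosh_eq (ν * t), sub_eq_add_neg, sub_eq_add_neg, Real.exp_add, Real.exp_add, neg_mul,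
      mul_neg]
    ring
  rw [h1, h2, Real.div_rpow hz.le (by norm_num), Real.rpow_sub_one (by norm_num)]
  have : (2 : ℝ) ^ ν ≠ 0 := (Real.rpow_pos_of_pos (by norm_num) ν).ne'
  field_simp

/-- The law of the logarithm of a `Gamma(ν, 1)` random variable. -/
def logGamma (ν : ℝ) : Measure ℝ :=
  volume.withDensity fun s => ENNReal.ofReal (Real.exp (ν * s - Real.exp s) / Real.Gamma ν)

lemma isProbabilityMeasure_logGamma {ν : ℝ} (hν : 0 < ν) : IsProbabilityMeasure (logGamma ν) := by
  have hΓ := Real.Gamma_pos_of_pos hν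
  refine ⟨?_⟩
  rw [logGamma, withDensity_apply _ MeasurableSet.univ, setLIntegral_univ,
    ← ofReal_integral_eq_lintegral_ofReal ((integrable_exp_sub_exp hν).div_const _)
      (Eventually.of_forall fun s => by positivity), integral_div, integral_exp_sub_exp hν,
    div_self hΓ.ne', ENNReal.ofReal_one]

lemma integral_logGamma {ν : ℝ} (hν : 0 < ν) (g : ℝ → ℝ) :
    ∫ s, g s ∂(logGamma ν) = ∫ s, Real.exp (ν * s - Real.exp s) / Real.Gamma ν * g s := by
  have hΓ := Real.Gamma_pos_of_pos hν
  rw [logGamma, integral_withDensity_eq_integral_toReal_smul (by fun_prop)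
    (Eventually.of_forall fun _ => ENNReal.ofReal_lt_top)]
  refine integral_congr_ae (Eventually.of_forall fun s => ?_)
  simp only [smul_eq_mul]
  rw [ENNReal.toReal_ofReal (by positivity)]

/-- The standard deviation of the frequencies in the Matérn mixture. -/
def maternFreq (ν l s : ℝ) : ℝ := √ν / l * Real.exp (-s / 2)

lemma maternFun_eq {ν l r : ℝ} (hν : 0 < ν) (hl : 0 < l) (hr : 0 ≤ r) :
    maternFun ν l r = ∫ s, Real.exp (-(maternFreq ν l s * r) ^ 2 / 2) ∂(logGamma ν) := by
  have hΓ := Real.Gamma_pos_of_pos hν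
  rcases hr.eq_or_lt with rfl | hr
  · have := isProbabilityMeasure_logGamma hν
    simp [maternFun]
  have hz : 0 < √(2 * ν) * r / l := by positivity
  rw [maternFun, if_neg hr.ne', mul_assoc, rpow_mul_besselK hν hz, integral_logGamma hν]
  have h2 : (2 : ℝ) ^ (ν - 1) ≠ 0 := (Real.rpow_pos_of_pos (by norm_num) _).ne'
  rw [one_div, mul_inv, mul_assoc, inv_mul_cancel_left₀ h2, ← integral_const_mul]
  refine integral_congr_ae (Eventually.of_forall fun s => ?_)
  simp only
  have e1 : Real.exp (-s / 2) ^ 2 = Real.exp (-s) := by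
    rw [← Real.exp_nat_mul]; congr 1; push_cast; ring
  have e2 : -((√(2 * ν) * r / l) ^ 2 / 4 * Real.exp (-s)) = -(maternFreq ν l s * r) ^ 2 / 2 := by
    rw [maternFreq, mul_pow, mul_pow, div_pow, e1, div_pow, mul_pow, Real.sq_sqrt (by positivity),
      Real.sq_sqrt hν.le]
    ring
  rw [e2]
  ring

lemma measurable_maternFreq (ν l : ℝ) : Measurable (maternFreq ν l) := by
  unfold maternFreq; fun_prop

lemma measurable_matern {d : ℕ} {𝒳 : Set (EuclideanSpace ℝ (Fin d))} {ν l : ℝ} (hν : 0 < ν)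
    (hl : 0 < l) : Measurable (Function.uncurry (matern (𝒳 := 𝒳) ν l)) := by
  have := isProbabilityMeasure_logGamma hν
  have h1 : StronglyMeasurable fun r : ℝ =>
      ∫ s, Real.exp (-(maternFreq ν l s * r) ^ 2 / 2) ∂(logGamma ν) := by
    refine StronglyMeasurable.integral_prod_right
      (f := fun r s => Real.exp (-(maternFreq ν l s * r) ^ 2 / 2)) ?_
    have := measurable_maternFreq ν l
    refine Measurable.stronglyMeasurable ?_
    simp only [Function.uncurry_def]
    fun_prop
  have h2 : Function.uncurry (matern (𝒳 := 𝒳) ν l) = fun p =>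
      (fun r : ℝ => ∫ s, Real.exp (-(maternFreq ν l s * r) ^ 2 / 2) ∂(logGamma ν))
        ‖(p.1 : EuclideanSpace ℝ (Fin d)) - p.2‖ := by
    funext p
    simp only [Function.uncurry_def, matern]
    exact maternFun_eq hν hl (norm_nonneg _)
  rw [h2]
  exact h1.measurable.comp (by fun_prop)

end Matern

/-! ### Random Fourier features of the Matérn kernel -/

section Features

open ProbabilityTheory

/-- Taylor remainder of `exp (i t)`. -/
lemma norm_exp_mul_I_sub_sum_le (t : ℝ) (r : ℕ) :
    ‖Complex.exp (t * Complex.I) -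
      ∑ j ∈ Finset.range r, (t * Complex.I) ^ j / (j.factorial : ℂ)‖ ≤ 4 * |t| ^ r := by
  have hn : ‖(t : ℂ) * Complex.I‖ = |t| := by simp
  have he : Real.exp 1 ≤ 3 := by linarith [Real.exp_one_lt_d9]
  rcases le_or_gt |t| 1 with ht | ht
  · refine (Complex.norm_exp_sub_sum_le_norm_mul_exp _ r).trans ?_
    rw [hn]
    have h1 : Real.exp |t| ≤ 4 := (Real.exp_le_exp.2 ht).trans (by linarith)
    have h2 : 0 ≤ |t| ^ r := by positivity
    nlinarith
  · have h1 : ‖∑ j ∈ Finset.range r, ((t : ℂ) * Complex.I) ^ j / (j.factorial : ℂ)‖ ≤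
        3 * |t| ^ r := by
      calc ‖∑ j ∈ Finset.range r, ((t : ℂ) * Complex.I) ^ j / (j.factorial : ℂ)‖
          ≤ ∑ j ∈ Finset.range r, |t| ^ r * (1 ^ j / (j.factorial : ℝ)) := by
            refine norm_sum_le_of_le _ fun j hj => ?_
            rw [norm_div, norm_pow, hn, Complex.norm_natCast, one_pow, ← mul_div_assoc, mul_one]
            gcongr
            exacts [ht.le, (Finset.mem_range.1 hj).le]
        _ = |t| ^ r * ∑ j ∈ Finset.range r, 1 ^ j / (j.factorial : ℝ) := by rw [Finset.mul_sum]
        _ ≤ |t| ^ r * 3 := by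
            gcongr
            exact (Real.sum_le_exp_of_nonneg zero_le_one r).trans he
        _ = 3 * |t| ^ r := mul_comm _ _
    have h2 : 1 ≤ |t| ^ r := one_le_pow₀ ht.le
    refine (norm_sub_le _ _).trans ?_
    rw [Complex.norm_exp_ofReal_mul_I]
    linarith

variable {d : ℕ}

/-- The law of the frequencies: a scale mixture of Gaussians. -/
def freqMeasure (d : ℕ) (ν : ℝ) : Measure (ℝ × EuclideanSpace ℝ (Fin d)) :=
  (logGamma ν).prod (stdGaussian (EuclideanSpace ℝ (Fin d)))

lemma isProbabilityMeasure_freqMeasure {ν : ℝ} (hν : 0 < ν) :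
    IsProbabilityMeasure (freqMeasure d ν) := by
  have := isProbabilityMeasure_logGamma hν
  unfold freqMeasure
  infer_instance

/-- The phase `σ_s ⟪g, x⟫`. -/
def phase (ν l : ℝ) (x : EuclideanSpace ℝ (Fin d)) (q : ℝ × EuclideanSpace ℝ (Fin d)) : ℝ :=
  maternFreq ν l q.1 * inner ℝ q.2 x

lemma measurable_phase (ν l : ℝ) (x : EuclideanSpace ℝ (Fin d)) : Measurable (phase ν l x) := by
  have := measurable_maternFreq ν l
  unfold phase
  fun_prop

/-- The random Fourier feature `exp (i σ_s ⟪g, x⟫)`. -/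
def wave (ν l : ℝ) (x : EuclideanSpace ℝ (Fin d)) (q : ℝ × EuclideanSpace ℝ (Fin d)) : ℂ :=
  Complex.exp (phase ν l x q * Complex.I)

lemma measurable_wave (ν l : ℝ) (x : EuclideanSpace ℝ (Fin d)) : Measurable (wave ν l x) := by
  have := measurable_phase ν l x
  unfold wave
  fun_prop

lemma norm_wave (ν l : ℝ) (x : EuclideanSpace ℝ (Fin d)) (q : ℝ × EuclideanSpace ℝ (Fin d)) :
    ‖wave ν l x q‖ = 1 := Complex.norm_exp_ofReal_mul_I _

lemma memLp_wave {ν : ℝ} (hν : 0 < ν) (l : ℝ) (x : EuclideanSpace ℝ (Fin d)) :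
    MemLp (wave ν l x) 2 (freqMeasure d ν) := by
  have := isProbabilityMeasure_freqMeasure (d := d) hν
  exact MemLp.of_bound (measurable_wave ν l x).aestronglyMeasurable 1
    (Eventually.of_forall fun q => (norm_wave ν l x q).le)

/-- The feature map of the Matérn kernel. -/
def maternFeature {ν : ℝ} (hν : 0 < ν) (l : ℝ) (x : EuclideanSpace ℝ (Fin d)) :
    Lp ℂ 2 (freqMeasure d ν) := (memLp_wave hν l x).toLp _

lemma inner_toLp {α : Type*} [MeasurableSpace α] {m : Measure α} {f g : α → ℂ}
    (hf : MemLp f 2 m) (hg : MemLp g 2 m) :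
    inner ℝ (hf.toLp f) (hg.toLp g) = ∫ a, inner ℝ (f a) (g a) ∂m := by
  rw [L2.inner_def]
  refine integral_congr_ae ?_
  filter_upwards [hf.coeFn_toLp, hg.coeFn_toLp] with a h1 h2
  rw [h1, h2]

lemma integral_re_exp_stdGaussian (t : EuclideanSpace ℝ (Fin d)) :
    ∫ g, (Complex.exp ((inner ℝ g t : ℝ) * Complex.I)).re
      ∂(stdGaussian (EuclideanSpace ℝ (Fin d))) = Real.exp (-‖t‖ ^ 2 / 2) := by
  have hint : Integrable (fun g => Complex.exp ((inner ℝ g t : ℝ) * Complex.I))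
      (stdGaussian (EuclideanSpace ℝ (Fin d))) := by
    refine Integrable.of_bound (Measurable.aestronglyMeasurable (by fun_prop)) 1
      (Eventually.of_forall fun g => (Complex.norm_exp_ofReal_mul_I _).le)
  have h := integral_re hint
  simp only [RCLike.re_eq_complex_re] at h
  rw [h, ← charFun_apply, charFun_stdGaussian]
  rw [show (-(‖t‖ : ℂ) ^ 2 / 2) = ((-‖t‖ ^ 2 / 2 : ℝ) : ℂ) by push_cast; ring,
    Complex.exp_ofReal_re]

lemma inner_maternFeature {ν l : ℝ} (hν : 0 < ν) (hl : 0 < l) (x y : EuclideanSpace ℝ (Fin d)) :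
    inner ℝ (maternFeature hν l x) (maternFeature hν l y) = maternFun ν l ‖x - y‖ := by
  have := isProbabilityMeasure_logGamma hν
  have hprob := isProbabilityMeasure_freqMeasure (d := d) hν
  have hpt : ∀ q : ℝ × EuclideanSpace ℝ (Fin d), inner ℝ (wave ν l x q) (wave ν l y q) =
      (Complex.exp ((inner ℝ q.2 (maternFreq ν l q.1 • (y - x)) : ℝ) * Complex.I)).re := by
    intro q
    rw [Complex.inner, wave, wave, ← Complex.exp_conj, ← Complex.exp_add]
    congr 2
    simp only [map_mul, Complex.conj_ofReal, Complex.conj_I, phase, inner_smul_right,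
      inner_sub_right]
    push_cast
    ring
  have hint : Integrable (fun q : ℝ × EuclideanSpace ℝ (Fin d) =>
      (Complex.exp ((inner ℝ q.2 (maternFreq ν l q.1 • (y - x)) : ℝ) * Complex.I)).re)
      (freqMeasure d ν) := by
    have := measurable_maternFreq ν l
    refine Integrable.of_bound (Measurable.aestronglyMeasurable (by fun_prop)) 1
      (Eventually.of_forall fun q => ?_)
    exact (Complex.abs_re_le_norm _).trans (Complex.norm_exp_ofReal_mul_I _).le
  rw [maternFeature, maternFeature, inner_toLp]
  simp only [hpt]
  rw [freqMeasure] at hint ⊢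
  rw [integral_prod _ hint, maternFun_eq hν hl (norm_nonneg _)]
  refine integral_congr_ae (Eventually.of_forall fun s => ?_)
  simp only
  rw [integral_re_exp_stdGaussian, norm_smul, mul_pow, mul_pow, norm_sub_rev y x,
    Real.norm_eq_abs, sq_abs]

lemma norm_maternFeature_sq {ν l : ℝ} (hν : 0 < ν) (hl : 0 < l) (x : EuclideanSpace ℝ (Fin d)) :
    ‖maternFeature hν l x‖ ^ 2 = 1 := by
  rw [← real_inner_self_eq_norm_sq, inner_maternFeature hν hl, sub_self, norm_zero, maternFun,
    if_pos rfl]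

/-! ### Local polynomial approximation of the features -/

/-- The monomials `exp (i σ_s ⟪g, c⟫) ∏ (i σ_s g_{p j})`, cut off at `s₀`. -/
def waveMonomial (ν l s₀ : ℝ) (c : EuclideanSpace ℝ (Fin d)) {j : ℕ} (p : Fin j → Fin d)
    (q : ℝ × EuclideanSpace ℝ (Fin d)) : ℂ :=
  if s₀ < q.1 then wave ν l c q * ∏ i, ((maternFreq ν l q.1 * q.2 (p i) : ℝ) * Complex.I) else 0

lemma measurable_waveMonomial (ν l s₀ : ℝ) (c : EuclideanSpace ℝ (Fin d)) {j : ℕ}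
    (p : Fin j → Fin d) : Measurable (waveMonomial ν l s₀ c p) := by
  have h1 := measurable_maternFreq ν l
  have h2 := measurable_wave ν l c
  unfold waveMonomial
  refine Measurable.ite (measurableSet_lt measurable_const measurable_fst) ?_ measurable_const
  refine h2.mul (Finset.measurable_prod _ fun i _ => ?_)
  fun_prop

lemma maternFreq_pos {ν l : ℝ} (hν : 0 < ν) (hl : 0 < l) (s : ℝ) : 0 < maternFreq ν l s := by
  unfold maternFreq; positivity

lemma maternFreq_anti {ν l : ℝ} (hl : 0 < l) : Antitone (maternFreq ν l) := by
  intro s t hst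
  unfold maternFreq
  gcongr

lemma integrable_norm_pow_stdGaussian (n : ℕ) :
    Integrable (fun g => ‖g‖ ^ n) (stdGaussian (EuclideanSpace ℝ (Fin d))) := by
  rcases eq_or_ne n 0 with rfl | hn
  · simp
  · exact MemLp.integrable_norm_pow
      (IsGaussian.memLp_id (stdGaussian (EuclideanSpace ℝ (Fin d))) n (by simp)) hn

lemma memLp_waveMonomial {ν l : ℝ} (hν : 0 < ν) (hl : 0 < l) (s₀ : ℝ)
    (c : EuclideanSpace ℝ (Fin d)) {j : ℕ} (p : Fin j → Fin d) :
    MemLp (waveMonomial ν l s₀ c p) 2 (freqMeasure d ν) := by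
  have := isProbabilityMeasure_logGamma hν
  have hm := measurable_waveMonomial ν l s₀ c p
  rw [memLp_two_iff_integrable_sq_norm hm.aestronglyMeasurable]
  have hdom : Integrable (fun q : ℝ × EuclideanSpace ℝ (Fin d) =>
      (maternFreq ν l s₀ ^ j) ^ 2 * ‖q.2‖ ^ (2 * j)) (freqMeasure d ν) :=
    ((integrable_norm_pow_stdGaussian (2 * j)).comp_snd _).const_mul _
  refine hdom.mono' (hm.norm.pow_const 2).aestronglyMeasurable (Eventually.of_forall fun q => ?_)
  rw [Real.norm_of_nonneg (by positivity), mul_comm 2 j, pow_mul, ← mul_pow, ← mul_pow]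
  have hs₀ := maternFreq_pos hν hl s₀
  have : ‖waveMonomial ν l s₀ c p q‖ ≤ (maternFreq ν l s₀ * ‖q.2‖) ^ j := by
    unfold waveMonomial
    split_ifs with h
    · rw [norm_mul, norm_wave, one_mul, norm_prod]
      calc ∏ i, ‖((maternFreq ν l q.1 * q.2 (p i) : ℝ) : ℂ) * Complex.I‖
          ≤ ∏ _i : Fin j, maternFreq ν l s₀ * ‖q.2‖ := by
            refine Finset.prod_le_prod (fun i _ => norm_nonneg _) fun i _ => ?_
            rw [norm_mul, Complex.norm_I, mul_one, Complex.norm_real, norm_mul,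
              Real.norm_of_nonneg (maternFreq_pos hν hl _).le]
            exact mul_le_mul (maternFreq_anti hl h.le) (PiLp.norm_apply_le _ _) (norm_nonneg _)
              hs₀.le
        _ = _ := by simp
    · rw [norm_zero]; positivity
  exact pow_le_pow_left₀ (norm_nonneg _) this 2

/-- The local Taylor approximation of a wave. -/
lemma sum_waveMonomial (ν l s₀ : ℝ) (c x : EuclideanSpace ℝ (Fin d)) (r : ℕ)
    (q : ℝ × EuclideanSpace ℝ (Fin d)) :
    ∑ j : Fin r, ∑ p : Fin j → Fin d,
      ((∏ i, (x - c) (p i)) / (j : ℕ).factorial : ℝ) • waveMonomial ν l s₀ c p q =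
    if s₀ < q.1 then wave ν l c q * ∑ j ∈ Finset.range r,
      (phase ν l (x - c) q * Complex.I) ^ j / (j.factorial : ℂ) else 0 := by
  unfold waveMonomial
  split_ifs with h
  · rw [Finset.mul_sum, ← Fin.sum_univ_eq_sum_range (fun j => wave ν l c q *
      ((phase ν l (x - c) q * Complex.I) ^ j / (j.factorial : ℂ)))]
    refine Finset.sum_congr rfl fun j _ => ?_
    have hphase : (phase ν l (x - c) q : ℂ) * Complex.I =
        ∑ a, ((x - c) a : ℂ) * ((maternFreq ν l q.1 * q.2 a : ℝ) * Complex.I) := by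
      rw [phase, PiLp.inner_apply, Finset.mul_sum]
      push_cast
      rw [Finset.sum_mul]
      refine Finset.sum_congr rfl fun a _ => ?_
      simp only [RCLike.inner_apply, conj_trivial]
      push_cast
      ring
    rw [hphase, Fintype.sum_pow, Finset.sum_div, Finset.mul_sum]
    refine Finset.sum_congr rfl fun p _ => ?_
    rw [Complex.real_smul]
    simp only [Finset.prod_mul_distrib]
    push_cast
    ring
  · simp

/-- The constant in the local approximation error. -/
def maternErr (d : ℕ) (ν l : ℝ) (r : ℕ) : ℝ :=
  (ν⁻¹ + 16 * (√ν / l) ^ (2 * r) *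
    (∫ g, ‖g‖ ^ (2 * r) ∂(stdGaussian (EuclideanSpace ℝ (Fin d)))) / (r - ν)) / Real.Gamma ν

lemma maternErr_nonneg (d : ℕ) {ν l : ℝ} (hν : 0 < ν) (hl : 0 < l) {r : ℕ} (hr : ν < r) :
    0 ≤ maternErr d ν l r := by
  have hΓ := Real.Gamma_pos_of_pos hν
  have h1 : 0 < (r : ℝ) - ν := by linarith
  have h2 : 0 ≤ ∫ g, ‖g‖ ^ (2 * r) ∂(stdGaussian (EuclideanSpace ℝ (Fin d))) :=
    integral_nonneg fun g => by positivity
  unfold maternErr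
  positivity

/-- Mass of the low scales. -/
lemma integral_logGamma_Iic_le {ν : ℝ} (hν : 0 < ν) (s₀ : ℝ) :
    ∫ s, (Set.Iic s₀).indicator (fun _ => (1 : ℝ)) s ∂(logGamma ν) ≤
      Real.exp (ν * s₀) * ν⁻¹ / Real.Gamma ν := by
  have hΓ := Real.Gamma_pos_of_pos hν
  rw [integral_logGamma hν]
  calc ∫ s, Real.exp (ν * s - Real.exp s) / Real.Gamma ν *
        (Set.Iic s₀).indicator (fun _ => (1 : ℝ)) s
      = ∫ s in Set.Iic s₀, Real.exp (ν * s - Real.exp s) / Real.Gamma ν := by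
        rw [← integral_indicator measurableSet_Iic]
        refine integral_congr_ae (Eventually.of_forall fun s => ?_)
        simp only [Set.indicator_apply]
        split_ifs <;> simp
    _ ≤ ∫ s in Set.Iic s₀, Real.exp (ν * s) / Real.Gamma ν := by
        refine setIntegral_mono ((integrable_exp_sub_exp hν).div_const _).integrableOn
          ((integrableOn_exp_mul_Iic hν s₀).div_const _) fun s => ?_
        have := Real.exp_pos s
        simp only
        gcongr
        linarith
    _ = _ := by rw [integral_div, integral_exp_mul_Iic hν, div_eq_mul_inv (Real.exp _)]

/-- Moments of the frequencies over the high scales. -/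
lemma integral_logGamma_Ioi_le {ν l : ℝ} (hν : 0 < ν) {r : ℕ} (hr : ν < r) (s₀ : ℝ) :
    ∫ s, (Set.Ioi s₀).indicator (fun s => maternFreq ν l s ^ (2 * r)) s ∂(logGamma ν) ≤
      (√ν / l) ^ (2 * r) * Real.exp ((ν - r) * s₀) / (r - ν) / Real.Gamma ν := by
  have hΓ := Real.Gamma_pos_of_pos hν
  have hneg : ν - r < 0 := by linarith
  have heven : 0 ≤ (√ν / l) ^ (2 * r) := by rw [pow_mul]; positivity
  have hfreq : ∀ s, maternFreq ν l s ^ (2 * r) = (√ν / l) ^ (2 * r) * Real.exp (-(r * s)) := by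
    intro s
    rw [maternFreq, mul_pow, ← Real.exp_nat_mul]
    congr 2
    push_cast
    ring
  have hle : ∀ s, Real.exp (ν * s - Real.exp s) / Real.Gamma ν * maternFreq ν l s ^ (2 * r) ≤
      (√ν / l) ^ (2 * r) / Real.Gamma ν * Real.exp ((ν - r) * s) := by
    intro s
    rw [hfreq]
    calc Real.exp (ν * s - Real.exp s) / Real.Gamma ν *
          ((√ν / l) ^ (2 * r) * Real.exp (-(r * s)))
        = (√ν / l) ^ (2 * r) / Real.Gamma ν *
            (Real.exp (ν * s - Real.exp s) * Real.exp (-(r * s))) := by ring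
      _ ≤ _ := by
          rw [← Real.exp_add]
          have := Real.exp_pos s
          gcongr
          linarith
  have hdom := (integrableOn_exp_mul_Ioi hneg s₀).const_mul ((√ν / l) ^ (2 * r) / Real.Gamma ν)
  have heq : ∀ s, Real.exp (ν * s - Real.exp s) / Real.Gamma ν *
      (Set.Ioi s₀).indicator (fun s => maternFreq ν l s ^ (2 * r)) s =
      (Set.Ioi s₀).indicator (fun s => Real.exp (ν * s - Real.exp s) / Real.Gamma ν *
        maternFreq ν l s ^ (2 * r)) s := by
    intro s
    simp only [Set.indicator_apply]
    split_ifs <;> simp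
  rw [integral_logGamma hν, integral_congr_ae (Eventually.of_forall heq),
    integral_indicator measurableSet_Ioi]
  calc ∫ s in Set.Ioi s₀, Real.exp (ν * s - Real.exp s) / Real.Gamma ν *
        maternFreq ν l s ^ (2 * r)
      ≤ ∫ s in Set.Ioi s₀, (√ν / l) ^ (2 * r) / Real.Gamma ν * Real.exp ((ν - r) * s) := by
        refine integral_mono_of_nonneg (Eventually.of_forall fun s => ?_) hdom
          (Eventually.of_forall hle)
        simp only [Pi.zero_apply, pow_mul]
        positivity
    _ = _ := by
        rw [integral_const_mul, integral_exp_mul_Ioi hneg, ← neg_sub ν, div_neg]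
        ring

/-- Features of points near `c` are approximated by wave monomials at `c`. -/
theorem integral_norm_wave_sub_le {ν l h : ℝ} (hν : 0 < ν) (hl : 0 < l) (hh : 0 < h) {r : ℕ}
    (hr : ν < r) {c x : EuclideanSpace ℝ (Fin d)} (hxc : ‖x - c‖ ≤ h) :
    ∫ q, ‖wave ν l x q - ∑ j : Fin r, ∑ p : Fin j → Fin d,
        ((∏ i, (x - c) (p i)) / (j : ℕ).factorial : ℝ) •
          waveMonomial ν l (2 * Real.log h) c p q‖ ^ 2 ∂(freqMeasure d ν) ≤
      maternErr d ν l r * h ^ (2 * ν) := by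
  have := isProbabilityMeasure_logGamma hν
  have hΓ := Real.Gamma_pos_of_pos hν
  have hrν : 0 < (r : ℝ) - ν := by linarith
  set s₀ := 2 * Real.log h with hs₀
  set M := ∫ g, ‖g‖ ^ (2 * r) ∂(stdGaussian (EuclideanSpace ℝ (Fin d))) with hM
  have hM0 : 0 ≤ M := integral_nonneg fun g => by positivity
  set A : ℝ → ℝ := (Set.Iic s₀).indicator fun _ => (1 : ℝ) with hA
  set F : ℝ → ℝ := (Set.Ioi s₀).indicator fun s => maternFreq ν l s ^ (2 * r) with hF
  set U : ℝ × EuclideanSpace ℝ (Fin d) → ℝ := fun q =>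
    A q.1 + 16 * h ^ (2 * r) * (F q.1 * ‖q.2‖ ^ (2 * r)) with hU
  have hpt : ∀ q, ‖wave ν l x q - ∑ j : Fin r, ∑ p : Fin j → Fin d,
      ((∏ i, (x - c) (p i)) / (j : ℕ).factorial : ℝ) • waveMonomial ν l s₀ c p q‖ ^ 2 ≤ U q := by
    intro q
    rw [sum_waveMonomial]
    simp only [hU, hA, hF, Set.indicator_apply, Set.mem_Iic, Set.mem_Ioi]
    split_ifs with h1 h2 h2
    · exact absurd h1 (not_lt.2 h2)
    · have hw : wave ν l x q = wave ν l c q * wave ν l (x - c) q := by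
        rw [wave, wave, wave, ← Complex.exp_add]
        congr 1
        simp only [phase, inner_sub_right]
        push_cast
        ring
      rw [hw, ← mul_sub, norm_mul, norm_wave, one_mul, zero_add]
      have h3 := norm_exp_mul_I_sub_sum_le (phase ν l (x - c) q) r
      have h4 : |phase ν l (x - c) q| ≤ maternFreq ν l q.1 * (‖q.2‖ * h) := by
        rw [phase, abs_mul, abs_of_pos (maternFreq_pos hν hl _)]
        refine mul_le_mul_of_nonneg_left ?_ (maternFreq_pos hν hl _).le
        exact (abs_real_inner_le_norm _ _).trans (by gcongr)
      have h5 : ‖wave ν l (x - c) q - ∑ j ∈ Finset.range r,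
          (phase ν l (x - c) q * Complex.I) ^ j / (j.factorial : ℂ)‖ ≤
          4 * (maternFreq ν l q.1 * (‖q.2‖ * h)) ^ r := h3.trans (by gcongr)
      refine (pow_le_pow_left₀ (norm_nonneg _) h5 2).trans (le_of_eq ?_)
      ring
    · rw [sub_zero, norm_wave]
      simp
    · exact absurd (not_lt.1 h1) h2
  have hAi : Integrable A (logGamma ν) := (integrable_const (1 : ℝ)).indicator measurableSet_Iic
  have hFi : Integrable F (logGamma ν) := by
    refine Integrable.of_bound (((measurable_maternFreq ν l).pow_const _).indicator
      measurableSet_Ioi).aestronglyMeasurable (maternFreq ν l s₀ ^ (2 * r))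
      (Eventually.of_forall fun s => ?_)
    have hp := fun s => maternFreq_pos hν hl s
    simp only [hF, Set.indicator_apply, Set.mem_Ioi]
    split_ifs with hs
    · rw [Real.norm_of_nonneg (pow_nonneg (hp s).le _)]
      exact pow_le_pow_left₀ (hp s).le (maternFreq_anti hl hs.le) _
    · rw [norm_zero]
      exact pow_nonneg (hp s₀).le _
  have hFg : Integrable (fun q : ℝ × EuclideanSpace ℝ (Fin d) => F q.1 * ‖q.2‖ ^ (2 * r))
      (freqMeasure d ν) := hFi.mul_prod (integrable_norm_pow_stdGaussian (2 * r))
  have hA2 : Integrable (fun q : ℝ × EuclideanSpace ℝ (Fin d) => A q.1) (freqMeasure d ν) :=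
    hAi.comp_fst _
  have hUi : Integrable U (freqMeasure d ν) := hA2.add (hFg.const_mul _)
  have hUint : ∫ q, U q ∂(freqMeasure d ν) =
      ∫ s, A s ∂(logGamma ν) + 16 * h ^ (2 * r) * ((∫ s, F s ∂(logGamma ν)) * M) := by
    rw [hU, integral_add hA2 (hFg.const_mul _), integral_const_mul]
    congr 1
    · have := integral_prod_mul (μ := logGamma ν)
        (ν := stdGaussian (EuclideanSpace ℝ (Fin d))) A (fun _ => (1 : ℝ))
      simpa [freqMeasure] using this
    · exact congrArg _ (integral_prod_mul (μ := logGamma ν)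
        (ν := stdGaussian (EuclideanSpace ℝ (Fin d))) F fun g => ‖g‖ ^ (2 * r))
  have e1 : Real.exp (ν * s₀) = h ^ (2 * ν) := by
    rw [Real.rpow_def_of_pos hh, hs₀]; congr 1; ring
  have e2 : h ^ (2 * r) * Real.exp ((ν - r) * s₀) = h ^ (2 * ν) := by
    rw [← Real.rpow_natCast, Real.rpow_def_of_pos hh, Real.rpow_def_of_pos hh, ← Real.exp_add, hs₀]
    congr 1
    push_cast
    ring
  refine (integral_mono_of_nonneg (Eventually.of_forall fun q => by positivity) hUi
    (Eventually.of_forall hpt)).trans ?_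
  rw [hUint]
  have b1 := integral_logGamma_Iic_le hν s₀
  have b2 := integral_logGamma_Ioi_le (l := l) hν hr s₀
  calc ∫ s, A s ∂(logGamma ν) + 16 * h ^ (2 * r) * ((∫ s, F s ∂(logGamma ν)) * M)
      ≤ Real.exp (ν * s₀) * ν⁻¹ / Real.Gamma ν + 16 * h ^ (2 * r) *
          (((√ν / l) ^ (2 * r) * Real.exp ((ν - r) * s₀) / (r - ν) / Real.Gamma ν) * M) := by
        gcongr
    _ = h ^ (2 * ν) * ν⁻¹ / Real.Gamma ν + 16 * (h ^ (2 * r) * Real.exp ((ν - r) * s₀)) *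
          (((√ν / l) ^ (2 * r) / (r - ν) / Real.Gamma ν) * M) := by
        rw [e1]; ring
    _ = maternErr d ν l r * h ^ (2 * ν) := by
        rw [e2, maternErr]; ring

/-- The dimension of the local approximation space. -/
def localDim (d r : ℕ) : ℕ := Fintype.card (Σ j : Fin r, (Fin j → Fin d))

lemma toLp_sum_mem {α ι : Type*} [MeasurableSpace α] {m : Measure α} (W : Submodule ℝ (Lp ℂ 2 m))
    {g : ι → α → ℂ} (s : Finset ι) (hg : ∀ i ∈ s, ∃ h : MemLp (g i) 2 m, h.toLp _ ∈ W) :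
    ∃ h : MemLp (fun q => ∑ i ∈ s, g i q) 2 m, h.toLp _ ∈ W := by
  classical
  induction s using Finset.induction_on with
  | empty => exact ⟨by simp, W.zero_mem⟩
  | insert i s hi ih =>
    obtain ⟨h1, h1'⟩ := hg i (Finset.mem_insert_self i s)
    obtain ⟨h2, h2'⟩ := ih fun j hj => hg j (Finset.mem_insert_of_mem hj)
    simp only [Finset.sum_insert hi]
    exact ⟨h1.add h2, W.add_mem h1' h2'⟩

/-- A subspace approximating all the features of points near a finite set. -/
theorem exists_submodule_of_net {ν l h : ℝ} (hν : 0 < ν) (hl : 0 < l) (hh : 0 < h) {r : ℕ}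
    (hr : ν < r) (𝒞 : Finset (EuclideanSpace ℝ (Fin d))) :
    ∃ (W : Submodule ℝ (Lp ℂ 2 (freqMeasure d ν))) (_ : FiniteDimensional ℝ W),
      Module.finrank ℝ W ≤ 𝒞.card * localDim d r ∧
      ∀ x, (∃ c ∈ 𝒞, ‖x - c‖ ≤ h) →
        ∃ w ∈ W, ‖maternFeature hν l x - w‖ ^ 2 ≤ maternErr d ν l r * h ^ (2 * ν) := by
  set b : 𝒞 × (Σ j : Fin r, (Fin j → Fin d)) → Lp ℂ 2 (freqMeasure d ν) := fun a =>
    (memLp_waveMonomial hν hl (2 * Real.log h) a.1 a.2.2).toLp _ with hb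
  refine ⟨Submodule.span ℝ (Set.range b),
    FiniteDimensional.span_of_finite ℝ (Set.finite_range b), ?_, ?_⟩
  · have := finrank_range_le_card (R := ℝ) b
    simpa [Set.finrank, localDim] using this
  · rintro x ⟨c, hc, hxc⟩
    have hterm : ∀ (j : Fin r) (p : Fin j → Fin d), ∃ h : MemLp (fun q =>
        ((∏ i, (x - c) (p i)) / (j : ℕ).factorial : ℝ) •
          waveMonomial ν l (2 * Real.log h) c p q) 2 (freqMeasure d ν),
        h.toLp _ ∈ Submodule.span ℝ (Set.range b) := fun j p =>
      ⟨(memLp_waveMonomial hν hl (2 * Real.log h) c p).const_smul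
          ((∏ i, (x - c) (p i)) / (j : ℕ).factorial : ℝ),
        Submodule.smul_mem _ _
          (Submodule.subset_span (Set.mem_range_self (f := b) (⟨c, hc⟩, ⟨j, p⟩)))⟩
    obtain ⟨hmem, hw⟩ := toLp_sum_mem _ Finset.univ
      fun j _ => toLp_sum_mem _ Finset.univ fun p _ => hterm j p
    refine ⟨_, hw, ?_⟩
    rw [maternFeature, ← MemLp.toLp_sub, ← real_inner_self_eq_norm_sq, inner_toLp]
    simp only [real_inner_self_eq_norm_sq]
    exact integral_norm_wave_sub_le hν hl hh hr hxc

end Features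

/-! ### The information gain of Matérn kernels -/

/-- Bounded sets of `ℝ^d` have grid nets of polynomial cardinality. -/
theorem exists_grid_net {d : ℕ} {𝒳 : Set (EuclideanSpace ℝ (Fin d))}
    (h𝒳 : Bornology.IsBounded 𝒳) :
    ∃ Q : ℕ, ∀ n : ℕ, 1 ≤ n → ∃ 𝒞 : Finset (EuclideanSpace ℝ (Fin d)),
      𝒞.card ≤ Q * n ^ d ∧ ∀ x ∈ 𝒳, ∃ c ∈ 𝒞, ‖x - c‖ ≤ √d / n := by
  classical
  obtain ⟨R, hR⟩ := h𝒳.exists_norm_le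
  set M := ⌈R⌉₊ + 1 with hM
  refine ⟨(2 * M + 1) ^ d, fun n hn => ?_⟩
  have hn0 : (0 : ℝ) < n := by exact_mod_cast hn
  set Z : Finset ℤ := Finset.Icc (-(M * n : ℤ)) (M * n) with hZ
  refine ⟨(Fintype.piFinset fun _ : Fin d => Z).image
    fun z => WithLp.toLp 2 fun a => (z a : ℝ) / n, ?_, fun x hx => ?_⟩
  · refine Finset.card_image_le.trans ?_
    have hcard : Z.card ≤ (2 * M + 1) * n := by
      rw [hZ, Int.card_Icc, Int.toNat_le]
      push_cast
      have : (1 : ℤ) ≤ n := by exact_mod_cast hn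
      nlinarith
    rw [Fintype.card_piFinset_const, ← mul_pow]
    exact Nat.pow_le_pow_left hcard d
  · refine ⟨WithLp.toLp 2 fun a => (⌊n * x a⌋ : ℝ) / n, Finset.mem_image.2
      ⟨fun a => ⌊n * x a⌋, Fintype.mem_piFinset.2 fun a => ?_, rfl⟩, ?_⟩
    · have hxa : |x a| ≤ R := by
        rw [← Real.norm_eq_abs]
        exact (PiLp.norm_apply_le x a).trans (hR x hx)
      have hRM : R ≤ M := by
        rw [hM]; push_cast
        linarith [Nat.le_ceil R]
      have h1 := abs_le.1 (hxa.trans hRM)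
      rw [hZ, Finset.mem_Icc]
      constructor
      · rw [Int.le_floor]
        push_cast
        nlinarith
      · rw [← Int.cast_le (R := ℝ)]
        refine (Int.floor_le _).trans ?_
        push_cast
        nlinarith
    · rw [EuclideanSpace.norm_eq, Real.sqrt_le_iff]
      refine ⟨by positivity, ?_⟩
      rw [div_pow, Real.sq_sqrt (Nat.cast_nonneg d)]
      have hterm : ∀ a : Fin d, ‖(x - WithLp.toLp 2 fun a => (⌊n * x a⌋ : ℝ) / n) a‖ ^ 2 ≤
          1 / (n : ℝ) ^ 2 := by
        intro a
        have h1 := Int.floor_le (n * x a)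
        have h2 := Int.lt_floor_add_one (n * x a)
        have e : (x - WithLp.toLp 2 fun a => (⌊n * x a⌋ : ℝ) / n) a =
            (n * x a - ⌊n * x a⌋) / n := by
          simp only [PiLp.sub_apply]
          field_simp
        rw [e, norm_div, div_pow, Real.norm_eq_abs, sq_abs, Real.norm_eq_abs, sq_abs]
        gcongr
        nlinarith
      refine (Finset.sum_le_sum fun a _ => hterm a).trans (le_of_eq ?_)
      simp
      ring

/-- The information gain of a Matérn kernel on a bounded set. -/
theorem exists_infoGain_matern_le {d : ℕ} {𝒳 : Set (EuclideanSpace ℝ (Fin d))}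
    (hd : 1 ≤ d) (h𝒳 : Bornology.IsBounded 𝒳) {ν l c₁ : ℝ} (hν : 0 < ν) (hl : 0 < l)
    (hc₁ : 0 < c₁) :
    ∃ G : ℝ, 0 < G ∧ (Nonempty 𝒳 → ∀ T : ℕ, 1 ≤ T → ∀ ρ : ℝ, 1 ≤ ρ →
      c₁ * (T : ℝ) ^ (d / (2 * ν + 2 * d)) ≤ ρ →
      infoGain (matern (𝒳 := 𝒳) ν l) T ρ ≤
        G * (T : ℝ) ^ (d / (2 * ν + 2 * d)) * (1 + Real.log T)) := by
  obtain ⟨Q, hQ⟩ := exists_grid_net h𝒳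
  set r := ⌊ν⌋₊ + 1 with hr
  have hνr : ν < r := by rw [hr]; push_cast; exact Nat.lt_floor_add_one ν
  set c₃ : ℝ := Q * 2 ^ d * localDim d r with hc₃
  set c₄ : ℝ := maternErr d ν l r * (d : ℝ) ^ ν with hc₄
  have hd0 : (0 : ℝ) < d := by exact_mod_cast hd
  have hc₄0 : 0 ≤ c₄ := mul_nonneg (maternErr_nonneg d hν hl hνr) (by positivity)
  refine ⟨(1 / 2) * (c₃ * (1 + 1) + c₄ / c₁) + 1, by positivity, fun _ T hT ρ hρ hcρ => ?_⟩
  have hT' : (1 : ℝ) ≤ T := by exact_mod_cast hT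
  have hT0 : (0 : ℝ) < T := by linarith
  have hlogT : 0 ≤ Real.log T := Real.log_nonneg hT'
  set b : ℝ := 1 / (2 * ν + 2 * d) with hb
  have hb0 : 0 < b := by positivity
  have hab : (d : ℝ) / (2 * ν + 2 * d) = b * d := by rw [hb]; ring
  have hab' : 2 * (b * d) - 1 = -(b * (2 * ν)) := by rw [hb]; field_simp; ring
  rw [hab] at hcρ ⊢
  have hTb : 1 ≤ (T : ℝ) ^ b := Real.one_le_rpow hT' hb0.le
  set n := ⌈(T : ℝ) ^ b⌉₊ with hn
  have hn1 : (T : ℝ) ^ b ≤ n := Nat.le_ceil _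
  have hn2 : (n : ℝ) ≤ 2 * (T : ℝ) ^ b := by
    have := Nat.ceil_lt_add_one (zero_le_one.trans hTb)
    linarith
  have hn' : 1 ≤ n := by
    have : (1 : ℝ) ≤ n := hTb.trans hn1
    exact_mod_cast this
  have hn0 : (0 : ℝ) < n := by exact_mod_cast hn'
  obtain ⟨𝒞, hcard, hnet⟩ := hQ n hn'
  obtain ⟨W, _, hdim, hW⟩ := exists_submodule_of_net hν hl
    (h := √d / n) (by positivity) hνr 𝒞
  have hN : ((𝒞.card * localDim d r : ℕ) : ℝ) ≤ c₃ * (T : ℝ) ^ (b * d) := by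
    rw [Real.rpow_mul_natCast hT0.le, hc₃]
    calc ((𝒞.card * localDim d r : ℕ) : ℝ) ≤ ((Q * n ^ d * localDim d r : ℕ) : ℝ) := by
          exact_mod_cast Nat.mul_le_mul_right _ hcard
      _ = Q * (n : ℝ) ^ d * localDim d r := by push_cast; ring
      _ ≤ Q * (2 * (T : ℝ) ^ b) ^ d * localDim d r := by gcongr
      _ = _ := by rw [mul_pow]; ring
  have hη : maternErr d ν l r * (√d / n) ^ (2 * ν) ≤ c₄ * (T : ℝ) ^ (2 * (b * d) - 1) := by
    rw [hab', Real.rpow_neg hT0.le, Real.rpow_mul hT0.le, hc₄, mul_assoc]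
    refine mul_le_mul_of_nonneg_left ?_ (maternErr_nonneg d hν hl hνr)
    rw [Real.div_rpow (Real.sqrt_nonneg _) hn0.le, Real.rpow_mul (Real.sqrt_nonneg _),
      Real.rpow_two, Real.sq_sqrt hd0.le, div_eq_mul_inv]
    gcongr
  have hgain := infoGain_le_rpow (k := matern (𝒳 := 𝒳) ν l)
    (ψ := fun x : 𝒳 => maternFeature hν l (x : EuclideanSpace ℝ (Fin d)))
    (fun x y => (inner_maternFeature hν hl _ _).symm) W hdim zero_le_one
    (fun x => (norm_maternFeature_sq hν hl _).le) (fun x => hW x (hnet x x.2)) hT hρ hc₁ hcρ hN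
    hc₄0 hη
  refine hgain.trans ?_
  gcongr
  linarith

lemma isFiniteMeasure_volume_subtype {d : ℕ} {𝒳 : Set (EuclideanSpace ℝ (Fin d))}
    (hb : Bornology.IsBounded 𝒳) (hm : MeasurableSet 𝒳) :
    IsFiniteMeasure (volume : Measure 𝒳) := by
  refine ⟨?_⟩
  rw [Measure.Subtype.volume_univ hm.nullMeasurableSet]
  exact hb.measure_lt_top

section

variable {S : Type*} {H : Type*} [NormedAddCommGroup H]
  [InnerProductSpace ℝ H] [CompleteSpace H] [RKHS ℝ H S ℝ] {Ω : Type*} [MeasurableSpace Ω]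
  {P : Measure Ω} [IsProbabilityMeasure P] {f : H} {X : ℕ → Ω → S} {L D δ : ℝ} {T : ℕ}

/-- Rates at least linear hold trivially. -/
lemma one_sub_le_measureReal_regret_le (hδ : 0 ≤ δ) (hD : 0 ≤ D)
    (hL : ∀ x y, |rkhsKer H x y| ≤ L) (hf : ‖f‖ ≤ D) (hT : 1 ≤ T) {A e : ℝ}
    (hA : 2 * √L * D ≤ A) (he : 1 ≤ e) :
    1 - δ ≤ P.real {ω | regret f X T ω ≤ A * (T : ℝ) ^ e * (1 + Real.log T) ^ 1} := by
  refine one_sub_le_measureReal_of_ae hδ (Eventually.of_forall fun ω => ?_)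
  have hT' : (1 : ℝ) ≤ T := by exact_mod_cast hT
  have hlog : 0 ≤ Real.log T := Real.log_nonneg hT'
  have hTe : (T : ℝ) ≤ (T : ℝ) ^ e := by
    simpa using Real.rpow_le_rpow_of_exponent_le hT' he
  have hLD : 0 ≤ 2 * √L * D := by positivity
  calc regret f X T ω ≤ 2 * √L * D * T := regret_le_linear hL hf T ω
    _ ≤ A * (T : ℝ) ^ e := by gcongr; exact hLD.trans hA
    _ ≤ A * (T : ℝ) ^ e * (1 + Real.log T) ^ 1 := by
        refine le_mul_of_one_le_right (mul_nonneg (hLD.trans hA) (by positivity)) ?_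
        rw [pow_one]; linarith

end

end GPUCB

end

theorem mainTheorem1 (σ D δ : ℝ) (hσ : 0 ≤ σ) (hD : 0 < D) (hδ : 0 < δ) (hδ1 : δ < 1) :
    -- the bound in terms of the maximum information gain
    (∃ K : ℝ, 0 < K ∧
      ∀ (d : ℕ) (𝒳 : Set (EuclideanSpace ℝ (Fin d))), Bornology.IsBounded 𝒳 → MeasurableSet 𝒳 →
      ∀ (H : Type v) [NormedAddCommGroup H] [InnerProductSpace ℝ H] [CompleteSpace H]
        [RKHS ℝ H 𝒳 ℝ],
      Measurable (Function.uncurry (GPUCB.rkhsKer H)) →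
      ∀ L : ℝ, 0 < L → (∀ x y, |GPUCB.rkhsKer H x y| ≤ L) →
      ∀ (T : ℕ), 1 ≤ T → ∀ ρ : ℝ, max 1 L ≤ ρ →
      ∀ (Ω : Type u) [MeasurableSpace Ω] (P : Measure Ω) [IsProbabilityMeasure P]
        (f : H) (X : ℕ → Ω → 𝒳) (ε : ℕ → Ω → ℝ),
      GPUCB.IsBandit P T σ D f X ε → GPUCB.IsGPUCB P T σ D δ ρ f X ε →
        1 - δ ≤ P.real {ω | GPUCB.regret f X T ω ≤
          K * (GPUCB.infoGain (GPUCB.rkhsKer H) T ρ * √T +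
            √(ρ * GPUCB.infoGain (GPUCB.rkhsKer H) T ρ * T))}) ∧
    -- kernels with polynomial eigendecay
    (∀ L B C β c₁ c₂ : ℝ, 0 < L → 0 < B → 0 < C → 0 < β → 0 < c₁ → 0 < c₂ →
      ∃ (A : ℝ) (p : ℕ), 0 < A ∧
      (∀ (d : ℕ) (𝒳 : Set (EuclideanSpace ℝ (Fin d))), Bornology.IsBounded 𝒳 → MeasurableSet 𝒳 →
        ∀ (H : Type v) [NormedAddCommGroup H] [InnerProductSpace ℝ H] [CompleteSpace H]
          [RKHS ℝ H 𝒳 ℝ],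
        Measurable (Function.uncurry (GPUCB.rkhsKer H)) → (∀ x y, |GPUCB.rkhsKer H x y| ≤ L) →
        GPUCB.AEDetermined H →
        ∀ (μ : ℕ → ℝ) (φ : ℕ → 𝒳 → ℝ), GPUCB.IsEigensystem (GPUCB.rkhsKer H) μ φ →
        GPUCB.EigenfunctionsBounded μ φ B → GPUCB.PolyEigendecay μ C β →
        ∀ (T : ℕ), 1 ≤ T → ∀ ρ : ℝ, max 1 L ≤ ρ →
        c₁ * (T : ℝ) ^ (1 / (1 + β)) ≤ ρ → ρ ≤ c₂ * (T : ℝ) ^ (1 / (1 + β)) →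
        ∀ (Ω : Type u) [MeasurableSpace Ω] (P : Measure Ω) [IsProbabilityMeasure P]
          (f : H) (X : ℕ → Ω → 𝒳) (ε : ℕ → Ω → ℝ),
        GPUCB.IsBandit P T σ D f X ε → GPUCB.IsGPUCB P T σ D δ ρ f X ε →
          1 - δ ≤ P.real {ω | GPUCB.regret f X T ω ≤
            A * (T : ℝ) ^ ((3 + β) / (2 + 2 * β)) * (1 + Real.log T) ^ p}) ∧
      (1 < β → Tendsto (fun T : ℕ =>
        A * (T : ℝ) ^ ((3 + β) / (2 + 2 * β)) * (1 + Real.log T) ^ p / T) atTop (𝓝 0))) ∧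
    -- Matérn kernels
    (∀ (d : ℕ) (𝒳 : Set (EuclideanSpace ℝ (Fin d))), 1 ≤ d → Bornology.IsBounded 𝒳 →
      MeasurableSet 𝒳 →
      ∀ ν l L B c₁ c₂ : ℝ, 1 / 2 < ν → 0 < l → 0 < L → 0 < B → 0 < c₁ → 0 < c₂ →
      ∃ (A : ℝ) (p : ℕ), 0 < A ∧
      (∀ (H : Type v) [NormedAddCommGroup H] [InnerProductSpace ℝ H] [CompleteSpace H]
          [RKHS ℝ H 𝒳 ℝ],
        (∀ x y, GPUCB.rkhsKer H x y = GPUCB.matern ν l x y) → (∀ x y, |GPUCB.rkhsKer H x y| ≤ L) →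
        GPUCB.AEDetermined H →
        ∀ (μ : ℕ → ℝ) (φ : ℕ → 𝒳 → ℝ), GPUCB.IsEigensystem (GPUCB.rkhsKer H) μ φ →
        GPUCB.EigenfunctionsBounded μ φ B →
        ∀ (T : ℕ), 1 ≤ T → ∀ ρ : ℝ, max 1 L ≤ ρ →
        c₁ * (T : ℝ) ^ (d / (2 * ν + 2 * d)) ≤ ρ → ρ ≤ c₂ * (T : ℝ) ^ (d / (2 * ν + 2 * d)) →
        ∀ (Ω : Type u) [MeasurableSpace Ω] (P : Measure Ω) [IsProbabilityMeasure P]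
          (f : H) (X : ℕ → Ω → 𝒳) (ε : ℕ → Ω → ℝ),
        GPUCB.IsBandit P T σ D f X ε → GPUCB.IsGPUCB P T σ D δ ρ f X ε →
          1 - δ ≤ P.real {ω | GPUCB.regret f X T ω ≤
            A * (T : ℝ) ^ ((ν + 2 * d) / (2 * ν + 2 * d)) * (1 + Real.log T) ^ p}) ∧
      Tendsto (fun T : ℕ =>
        A * (T : ℝ) ^ ((ν + 2 * d) / (2 * ν + 2 * d)) * (1 + Real.log T) ^ p / T)
          atTop (𝓝 0)) := by

  have hK := GPUCB.regretConst_pos (δ := δ) hσ hD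
  refine ⟨⟨GPUCB.regretConst σ D δ, hK, ?_⟩, ?_, ?_⟩
  · intro d 𝒳 _ _ H _ _ _ _ hk L hL0 hL T hT ρ hρ Ω _ P _ f X ε hB hG
    exact GPUCB.regret_bound hσ hD hδ hδ1 hk hL0 hL hρ hB hG
  · intro L B C β c₁ c₂ hL0 hB0 hC hβ hc₁ hc₂
    rcases le_or_gt β 1 with hβ1 | hβ1
    · refine ⟨2 * √L * D, 1, by positivity, ?_, fun h => absurd hβ1 (not_le.2 h)⟩
      intro d 𝒳 _ _ H _ _ _ _ _ hL _ μ φ _ _ _ T hT ρ _ _ _ Ω _ P _ f X ε hB _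
      refine GPUCB.one_sub_le_measureReal_regret_le hδ.le hD.le hL hB.norm_le hT le_rfl ?_
      rw [le_div_iff₀ (by linarith)]
      linarith
    · have hβ0 : 0 < β - 1 := by linarith
      set G := (1 / 2) * (2 * (1 + L) + B ^ 2 * (C * (1 / (β - 1))) / c₁) with hGdef
      have hG0 : 0 < G := by positivity
      refine ⟨GPUCB.regretConst σ D δ * (G + √(c₂ * G)), 1, by positivity, ?_, fun _ => ?_⟩
      · intro d 𝒳 hbdd hmeas H _ _ _ _ hk hL hae μ φ hE hφ hμ T hT ρ hρ hc₁ρ hρc₂ Ω _ P _ f X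
          ε hB hG
        have := GPUCB.isFiniteMeasure_volume_subtype hbdd hmeas
        obtain ⟨ω⟩ := nonempty_of_isProbabilityMeasure P
        have : Nonempty 𝒳 := ⟨X 0 ω⟩
        have hγ := GPUCB.infoGain_le_of_polyEigendecay hk hL0 hL hae hE hφ hC hβ1 hμ hT
          ((le_max_left _ _).trans hρ) hc₁ hc₁ρ
        have h := GPUCB.regret_bound_rpow hσ hD hδ hδ1 hk hL0 hL hρ hB hG hT hc₂ hG0 hρc₂ hγ
        rwa [show 1 / (1 + β) + 1 / 2 = (3 + β) / (2 + 2 * β) by field_simp; ring] at h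
      · refine GPUCB.tendsto_rpow_mul_log_div ?_ 1
        rw [div_lt_one (by linarith)]
        linarith
  · intro d 𝒳 hd hbdd hmeas ν l L B c₁ c₂ hν hl hL0 hB0 hc₁ hc₂
    have hν0 : 0 < ν := by linarith
    have hd0 : (0 : ℝ) < d := by exact_mod_cast hd
    obtain ⟨G, hG0, hγ⟩ := GPUCB.exists_infoGain_matern_le hd hbdd hν0 hl hc₁
    refine ⟨GPUCB.regretConst σ D δ * (G + √(c₂ * G)), 1, by positivity, ?_, ?_⟩
    · intro H _ _ _ _ hker hL _ μ φ _ _ T hT ρ hρ hc₁ρ hρc₂ Ω _ P _ f X ε hB hG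
      obtain ⟨ω⟩ := nonempty_of_isProbabilityMeasure P
      have hk : GPUCB.rkhsKer H = GPUCB.matern ν l := funext₂ hker
      have hkm : Measurable (Function.uncurry (GPUCB.rkhsKer H)) :=
        hk ▸ GPUCB.measurable_matern hν0 hl
      have h := GPUCB.regret_bound_rpow hσ hD hδ hδ1 hkm hL0 hL hρ hB hG hT hc₂ hG0 hρc₂
        (hk ▸ hγ ⟨X 0 ω⟩ T hT ρ ((le_max_left _ _).trans hρ) hc₁ρ)
      rwa [show d / (2 * ν + 2 * d) + 1 / 2 = (ν + 2 * d) / (2 * ν + 2 * d) by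
        field_simp; ring] at h
    · refine GPUCB.tendsto_rpow_mul_log_div ?_ 1
      rw [div_lt_one (by linarith)]
      linarith
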